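/- Let $\mathbb{D}=\{z\in\mathbb{C}:|z|<1\}$ and let $\mathcal{K}_H^0$ be the class of complex-valued harmonic functions $f$ in $\mathbb{D}$ with $f(0)=0$, $f_z(0)=1$, $f_{\bar z}(0)=0$ that are univalent and sense-preserving in $\mathbb{D}$ (that is, $|f_{\bar z}|<|f_z|$ in $\mathbb{D}$) and for which $f(\mathbb{D})$ is convex. Every harmonic $f$ in $\mathbb{D}$ has a unique expansion $f(z)=\sum_{n\ge 0}a_nz^n+\overline{\sum_{n\ge 1}b_nz^n}$; the harmonic convolution of $f$ with $g(z)=\sum_{n\ge 0}A_nz^n+\overline{\sum_{n\ge 1}B_nz^n}$ is $$(f*g)(z)=\sum_{n\ge 0}a_nA_nz^n+\overline{\sum_{n\ge 1}b_nB_nz^n}.$$ For $0\le\alpha<1$, a function $F$ is called fully starlike of order $\alpha$ in $|z|<R$ if it is harmonic there, $F(0)=0$, and for every $0<r<R$ it maps the circle $|z|=r$ in a one-to-one manner onto a curve that bounds a domain starlike with respect to the origin, with $\frac{\partial}{\partial\theta}\arg F(re^{i\theta})>\alpha$ for all $\theta$; fully starlike means fully starlike of order $0$. **Corollary 4.3.**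 Let $0\le\alpha<1$. The equation $$2(1-\alpha)(1-r)^4+\alpha(1-r)^2-(r^2+r+1)=0$$ has exactly one root $r_0=r_0(\alpha)$ in $(0,1)$, and for all $f,g\in\mathcal{K}_H^0$ the function $f*g$ is univalent and fully starlike of order $\alpha$ in $|z|<r_0(\alpha)$. In particular, for all $f,g\in\mathcal{K}_H^0$, $f*g$ is univalent and fully starlike in $|z|<r_0(0)$, where $r_0(0)\approx 0.129831$ (rounded to six decimals, i.e. $|r_0(0)-0.129831|<5\cdot 10^{-7}$). -/

import Mathlib

open Complex Metric Set InnerProductSpace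

namespace HarmonicMapping

noncomputable section

/-- The Wirtinger derivative `f_z = (f_x - i f_y) / 2`. -/
def dz (f : ℂ → ℂ) (z : ℂ) : ℂ := (fderiv ℝ f z 1 - I * fderiv ℝ f z I) / 2

/-- The Wirtinger derivative `f_{z̄} = (f_x + i f_y) / 2`. -/
def dzbar (f : ℂ → ℂ) (z : ℂ) : ℂ := (fderiv ℝ f z 1 + I * fderiv ℝ f z I) / 2

/-- The class `𝓚_H⁰`: complex-valued harmonic functions in the open unit disk with
`f(0) = 0`, `f_z(0) = 1`, `f_{z̄}(0) = 0`, which are sense-preserving and univalent there and map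
the disk onto a convex domain. Only the values on the disk matter. -/
structure IsConvexHarmonic (f : ℂ → ℂ) : Prop where
  harmonic : HarmonicOnNhd f (ball 0 1)
  map_zero : f 0 = 0
  dz_zero : dz f 0 = 1
  dzbar_zero : dzbar f 0 = 0
  sensePreserving : ∀ z ∈ ball (0 : ℂ) 1, ‖dzbar f z‖ < ‖dz f z‖
  univalent : InjOn f (ball 0 1)
  convex_image : Convex ℝ (f '' ball 0 1)

/-- `f(z) = ∑_{n ≥ 0} a_n zⁿ + conj (∑_{n ≥ 1} b_n zⁿ)` in the unit disk, both series being
convergent there. -/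
def IsExpansion (f : ℂ → ℂ) (a b : ℕ → ℂ) : Prop :=
  b 0 = 0 ∧ ∀ z ∈ ball (0 : ℂ) 1, ∃ s t : ℂ,
    HasSum (fun n => a n * z ^ n) s ∧ HasSum (fun n => b n * z ^ n) t ∧
      f z = s + (starRingEnd ℂ) t

theorem exists_hasSum {F : ℂ → ℂ} (hF : AnalyticOnNhd ℂ F (ball 0 1)) :
    ∃ a : ℕ → ℂ, a 0 = F 0 ∧ ∀ z ∈ ball (0 : ℂ) 1, HasSum (fun n => a n * z ^ n) (F z) := by
  refine ⟨fun n => (n.factorial : ℂ)⁻¹ * iteratedDeriv n F 0, by simp, fun z hz => ?_⟩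
  have := Complex.hasSum_taylorSeries_on_ball hF.differentiableOn hz
  convert! this using 2 with n
  simp only [smul_eq_mul, sub_zero]
  ring

/-- Every harmonic function in the unit disk has such an expansion. -/
theorem exists_isExpansion {f : ℂ → ℂ} (hf : HarmonicOnNhd f (ball 0 1)) :
    ∃ p : (ℕ → ℂ) × (ℕ → ℂ), IsExpansion f p.1 p.2 := by
  obtain ⟨U, hU, hUe⟩ := (hf.comp_CLM reCLM).exists_analyticOnNhd_ball_re_eq
  obtain ⟨V, hV, hVe⟩ := (hf.comp_CLM imCLM).exists_analyticOnNhd_ball_re_eq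
  have hc : ∀ c : ℂ, AnalyticOnNhd ℂ (fun _ : ℂ => c) (ball 0 1) := fun c => analyticOnNhd_const
  set k : ℂ := (U 0 - I * V 0) / 2 with hk
  obtain ⟨a, -, ha⟩ := exists_hasSum (F := fun z => (U z + I * V z) * 2⁻¹ + (starRingEnd ℂ) k)
    (((hU.add ((hc I).mul hV)).mul (hc 2⁻¹)).add (hc _))
  obtain ⟨b, hb0, hb⟩ := exists_hasSum (F := fun z => (U z + -I * V z) * 2⁻¹ + -k)
    (((hU.add ((hc (-I)).mul hV)).mul (hc 2⁻¹)).add (hc _))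
  refine ⟨(a, b), ?_, fun z hz => ⟨_, _, ha z hz, hb z hz, ?_⟩⟩
  · simp only [hb0, hk]; ring
  · have h1 : (U z).re = (f z).re := hUe hz
    have h2 : (V z).re = (f z).im := hVe hz
    apply Complex.ext <;> simp <;> linarith

theorem hasFPowerSeriesOnBall_of_hasSum {c : ℕ → ℂ} {F : ℂ → ℂ}
    (h : ∀ z ∈ ball (0 : ℂ) 1, HasSum (fun n => c n * z ^ n) (F z)) :
    HasFPowerSeriesOnBall F (FormalMultilinearSeries.ofScalars ℂ c) 0 ((1 / 2 : NNReal) : ENNReal) where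
  r_le := by
    have h2 : ((1 / 2 : ℝ) : ℂ) ∈ ball (0 : ℂ) 1 := by
      rw [mem_ball_zero_iff, Complex.norm_real]; norm_num
    have ht := (h _ h2).summable.tendsto_atTop_zero.norm
    refine FormalMultilinearSeries.le_radius_of_tendsto _ (l := 0) ?_
    simpa [FormalMultilinearSeries.ofScalars_norm] using ht
  r_pos := by simp
  hasSum := by
    intro y hy
    have hy1 : y ∈ ball (0 : ℂ) 1 := by
      rw [Metric.eball_coe] at hy
      exact ball_subset_ball (by norm_num) hy
    simpa [FormalMultilinearSeries.ofScalars_apply_eq, mul_comm] using h y hy1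

theorem coeff_eq_zero {c : ℕ → ℂ} {F : ℂ → ℂ} {C : ℂ}
    (h : ∀ z ∈ ball (0 : ℂ) 1, HasSum (fun n => c n * z ^ n) (F z))
    (hC : ∀ z ∈ ball (0 : ℂ) (1 / 2), F z = C) (n : ℕ) (hn : n ≠ 0) : c n = 0 := by
  have h1 := (hasFPowerSeriesOnBall_of_hasSum h).hasFPowerSeriesAt
  have h2 : HasFPowerSeriesAt F (constFormalMultilinearSeries ℂ ℂ C) 0 :=
    (hasFPowerSeriesAt_const (c := C)).congr
      (Filter.eventually_of_mem (ball_mem_nhds _ (by norm_num)) fun z hz => (hC z hz).symm)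
  have h3 := h1.eq_formalMultilinearSeries h2
  have h4 := congrArg (fun p => p.coeff n) h3
  rw [FormalMultilinearSeries.coeff_ofScalars, FormalMultilinearSeries.coeff,
    constFormalMultilinearSeries_apply_of_nonzero hn] at h4
  simpa only [zero_apply] using h4

/-- The expansion is unique. -/
theorem IsExpansion.unique {f : ℂ → ℂ} {a b a' b' : ℕ → ℂ} (h : IsExpansion f a b)
    (h' : IsExpansion f a' b') : a = a' ∧ b = b' := by
  obtain ⟨h0, h⟩ := h
  obtain ⟨h0', h'⟩ := h'
  have key : ∀ z ∈ ball (0 : ℂ) 1, ∃ s t : ℂ, HasSum (fun n => (a n - a' n) * z ^ n) s ∧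
      HasSum (fun n => (b n - b' n) * z ^ n) t ∧ s + (starRingEnd ℂ) t = 0 := by
    intro z hz
    obtain ⟨s, t, hs, ht, e⟩ := h z hz
    obtain ⟨s', t', hs', ht', e'⟩ := h' z hz
    refine ⟨s - s', t - t', by simpa [sub_mul] using hs.sub hs',
      by simpa [sub_mul] using ht.sub ht', ?_⟩
    rw [map_sub]
    linear_combination e' - e
  choose! H G hH hG hHG using key
  have dH := (hasFPowerSeriesOnBall_of_hasSum hH).differentiableOn
  have dG := (hasFPowerSeriesOnBall_of_hasSum hG).differentiableOn
  rw [Metric.eball_coe] at dH dG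
  have hr : ((1 / 2 : NNReal) : ℝ) = 1 / 2 := by norm_num
  rw [hr] at dH dG
  have sub : ball (0 : ℂ) (1 / 2) ⊆ ball 0 1 := ball_subset_ball (by norm_num)
  have hd : ∀ z ∈ ball (0 : ℂ) (1 / 2), deriv H z = 0 ∧ deriv G z = 0 := by
    intro z hz
    have hn := isOpen_ball.mem_nhds hz
    have eH := (dH.differentiableAt hn).hasDerivAt.hasFDerivAt.restrictScalars ℝ
    have eG := (dG.differentiableAt hn).hasDerivAt.hasFDerivAt.restrictScalars ℝ
    have e := eH.add (conjCLE.hasFDerivAt.comp z eG)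
    have e0 : HasFDerivAt (H + conjCLE ∘ G) (0 : ℂ →L[ℝ] ℂ) z :=
      (hasFDerivAt_const (0 : ℂ) z).congr_of_eventuallyEq
        (Filter.eventually_of_mem hn fun w hw => by simpa using hHG w (sub hw))
    have eq := e.unique e0
    have q1 := congrArg (fun L : ℂ →L[ℝ] ℂ => L 1) eq
    have q2 := congrArg (fun L : ℂ →L[ℝ] ℂ => L I) eq
    simp at q1 q2
    have q3 : (starRingEnd ℂ) (deriv G z) = deriv H z := by
      have : I * (deriv H z - (starRingEnd ℂ) (deriv G z)) = 0 := by linear_combination q2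
      rcases mul_eq_zero.1 this with hI | hI
      · exact absurd hI I_ne_zero
      · exact (sub_eq_zero.1 hI).symm
    have q4 : deriv H z = 0 := by rw [q3] at q1; linear_combination q1 / 2
    exact ⟨q4, by simpa [q4] using q3⟩
  have cst : ∀ F : ℂ → ℂ, DifferentiableOn ℂ F (ball 0 (1 / 2)) →
      (∀ z ∈ ball (0 : ℂ) (1 / 2), deriv F z = 0) → ∀ z ∈ ball (0 : ℂ) (1 / 2), F z = F 0 :=
    fun F hF hF' z hz => isOpen_ball.is_const_of_deriv_eq_zero
      (convex_ball _ _).isPreconnected hF hF' hz (mem_ball_self (by norm_num))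
  have zH := coeff_eq_zero hH (cst H dH fun z hz => (hd z hz).1)
  have zG := coeff_eq_zero hG (cst G dG fun z hz => (hd z hz).2)
  have b0 : b 0 - b' 0 = 0 := by rw [h0, h0', sub_zero]
  have m0 : (0 : ℂ) ∈ ball (0 : ℂ) 1 := mem_ball_self one_pos
  have val : ∀ c : ℕ → ℂ, HasSum (fun n => c n * (0 : ℂ) ^ n) (c 0) := fun c => by
    simpa using hasSum_single (f := fun n => c n * (0 : ℂ) ^ n) 0 (fun n hn => by simp [hn])
  have g0 : G 0 = 0 := ((hG 0 m0).unique (val fun n => b n - b' n)).trans b0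
  have a0 : a 0 - a' 0 = 0 := by
    rw [← (hH 0 m0).unique (val fun n => a n - a' n)]
    simpa [g0] using hHG 0 m0
  refine ⟨funext fun n => sub_eq_zero.1 ?_, funext fun n => sub_eq_zero.1 ?_⟩
  · rcases eq_or_ne n 0 with rfl | hn
    exacts [a0, zH n hn]
  · rcases eq_or_ne n 0 with rfl | hn
    exacts [b0, zG n hn]

open Classical in
/-- The pair of coefficient sequences `(a_n), (b_n)` of the canonical expansion of `f`. It exists
and is unique for each harmonic `f` in the unit disk. -/
def coeffs (f : ℂ → ℂ) : (ℕ → ℂ) × (ℕ → ℂ) :=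
  if h : ∃ p : (ℕ → ℂ) × (ℕ → ℂ), IsExpansion f p.1 p.2 then h.choose else 0

theorem coeffs_spec {f : ℂ → ℂ} (hf : HarmonicOnNhd f (ball 0 1)) :
    IsExpansion f (coeffs f).1 (coeffs f).2 := by
  have h := exists_isExpansion hf
  rw [coeffs, dif_pos h]
  exact h.choose_spec

/-- The harmonic convolution
`(f * g)(z) = ∑ a_n A_n zⁿ + conj (∑ b_n B_n zⁿ)` for `f = ∑ a_n zⁿ + conj (∑ b_n zⁿ)` and
`g = ∑ A_n zⁿ + conj (∑ B_n zⁿ)`. -/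
def conv (f g : ℂ → ℂ) (z : ℂ) : ℂ :=
  (∑' n, (coeffs f).1 n * (coeffs g).1 n * z ^ n) +
    (starRingEnd ℂ) (∑' n, (coeffs f).2 n * (coeffs g).2 n * z ^ n)

/-- The set `C` bounds a domain that is starlike with respect to the origin. -/
def BoundsStarlikeDomain (C : Set ℂ) : Prop :=
  ∃ Ω : Set ℂ, IsOpen Ω ∧ IsConnected Ω ∧ Bornology.IsBounded Ω ∧ StarConvex ℝ 0 Ω ∧
    frontier Ω = C

/-- `∂/∂θ arg (F θ) > α` for all `θ`: the curve `F` avoids the origin and has a differentiable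
branch `φ` of its argument with `φ' > α`. -/
def ArgDerivGT (F : ℝ → ℂ) (α : ℝ) : Prop :=
  (∀ θ, F θ ≠ 0) ∧ ∃ φ : ℝ → ℝ, Differentiable ℝ φ ∧
    (∀ θ, F θ = (‖F θ‖ : ℂ) * exp (φ θ * I)) ∧ ∀ θ, α < deriv φ θ

/-- `f` is fully starlike of order `α` in the disk `|z| < R`: it is harmonic there with
`f(0) = 0`, and it maps each circle `|z| = r`, `0 < r < R`, in a one-to-one manner onto a curve
that bounds a domain starlike with respect to the origin, with `∂/∂θ arg f(r e^{iθ}) > α`. -/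
structure IsFullyStarlike (α R : ℝ) (f : ℂ → ℂ) : Prop where
  harmonic : HarmonicOnNhd f (ball 0 R)
  map_zero : f 0 = 0
  injOn : ∀ r, 0 < r → r < R → InjOn f (sphere 0 r)
  starlike : ∀ r, 0 < r → r < R → BoundsStarlikeDomain (f '' sphere 0 r)
  arg : ∀ r, 0 < r → r < R → ArgDerivGT (fun θ => f (r * exp (θ * I))) α

/-- The left-hand side of the radius equation
`2 (1 - α) (1 - r)⁴ + α (1 - r)² - (r² + r + 1) = 0`. -/
def radiusPoly (α r : ℝ) : ℝ :=
  2 * (1 - α) * (1 - r) ^ 4 + α * (1 - r) ^ 2 - (r ^ 2 + r + 1)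

end

end HarmonicMapping

open Filter Topology

/-! The proof rests on the sharp bounds |a_n| ≤ (n+1)/2 and |b_n| ≤ (n-1)/2 for convex harmonic maps
(`norm_coeff_le_of_convex`). They bound the coefficients of the convolution by ((n+1)/2)² and
((n-1)/2)². The test Σ ((n-α)|A_n| + (n+α)|B_n|) r^(n-1) < 2(1-α) for starlikeness of order α then
follows from positivity of `radiusPoly`, because the majorant has a rational sum
(`hasSum_starlike_majorant`). `radiusPoly` is strictly decreasing on [0,1], so it is positive
exactly up to its root. The test itself (`StarlikeSeries`) works because it makes F minus the
identity a strict contraction, which gives injectivity, and puts ∂_θF/(iF) into the half-plane Re >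
α, so that the argument increases and every ray meets the image of a circle at most once.

The coefficient bounds come from a positivity condition for f = h + conj g
(`exists_re_mul_nonneg_of_convex`): for some unimodular ν, ζ one has Re[(ν h' + conj ν g')(ζ - conj
ζ z²)] ≥ 0. By Carathéodory's bound, Q = h' + ε g' with ε = conj ν / ν has coefficients dominated by
those of (1-z)⁻². As |g'| < |h'|, the function K = (h' - ε g')/(h' + ε g') has positive real part.
Multiplying Q by (1 ± K)/2 recovers h' and ε g'.

Positivity is topological at heart. Suppose the image is bounded and f extends continuously to the
circle. Half-planes cut a convex image in connected pieces, and paths joining alternating points of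
the circle must cross (`exists_eq_of_alternating`), so Re(νf) cannot alternate about a level on the
circle. A connectedness argument over all directions ν finds one whose maximum and minimum on the
circle sit at antipodal points ±ζ (`exists_antipodal_extrema`). The hyperbolic flow from -ζ to ζ
then raises Re(νf) on the circle, hence by the Poisson integral in the disk; its derivative at time
0 is the condition.

A general f is approximated by f∘φ, where φ is a Riemann map onto the preimage of the interior of a
polygon. The length-area principle together with convexity gives f∘φ its boundary values
(`exists_tendsto_boundary`), and the maps φ converge to a rotation. -/

/-! ### Normal families: Montel and Hurwitz. -/

/-- Montel's theorem along an ultrafilter: compactness of the closed disk gives pointwise limits at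
once, with no diagonal subsequence, and the Schwarz lemma supplies the equicontinuity that makes
convergence locally uniform. -/
theorem exists_tendstoLocallyUniformlyOn_of_norm_le_one {ι : Type*} (l : Ultrafilter ι) {U : Set ℂ}
    (hU : IsOpen U) {F : ι → ℂ → ℂ} (hd : ∀ i, DifferentiableOn ℂ (F i) U)
    (hb : ∀ i, ∀ z ∈ U, ‖F i z‖ ≤ 1) : ∃ φ : ℂ → ℂ, TendstoLocallyUniformlyOn F φ l U := by
  have h1 : ∀ z : ℂ, ∃ w : ℂ, z ∈ U → Tendsto (fun i => F i z) l (𝓝 w) := by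
    intro z
    by_cases hz : z ∈ U
    · obtain ⟨w, -, hw⟩ := (isCompact_closedBall (0 : ℂ) 1).ultrafilter_le_nhds
        (l.map fun i => F i z) (by
          rw [le_principal_iff]
          exact Filter.mem_map.2 (Filter.univ_mem' fun i => by simpa using hb i z hz))
      exact ⟨w, fun _ => hw⟩
    · exact ⟨0, fun h => absurd h hz⟩
  choose φ hφ using h1
  refine ⟨φ, ?_⟩
  rw [Metric.tendstoLocallyUniformlyOn_iff]
  intro ε hε x hx
  obtain ⟨R, hR, hRU⟩ := Metric.isOpen_iff.1 hU x hx
  -- A Lipschitz constant independent of `i`. Values differ by at most 2, so the 3 is only a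
  -- convenient radius for the target disk.
  have key : ∀ i, ∀ y ∈ ball x R, dist (F i y) (F i x) ≤ 3 / R * dist y x := by
    intro i y hy
    refine dist_le_div_mul_dist_of_mapsTo_ball ((hd i).mono hRU) (fun z hz => ?_) hy
    rw [mem_closedBall, dist_eq_norm]
    calc _ ≤ ‖F i z‖ + ‖F i x‖ := norm_sub_le _ _
      _ ≤ 1 + 1 := add_le_add (hb i z (hRU hz)) (hb i x hx)
      _ ≤ 3 := by norm_num
  set δ := min R (R * ε / 12) with hδ
  have hδ0 : 0 < δ := by positivity
  refine ⟨U ∩ ball x δ, inter_mem self_mem_nhdsWithin (mem_nhdsWithin_of_mem_nhds (ball_mem_nhds x hδ0)), ?_⟩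
  filter_upwards [Metric.tendsto_nhds.1 (hφ x hx) (ε / 4) (by positivity)] with i hi y hy
  have hyR : y ∈ ball x R := ball_subset_ball (min_le_left _ _) hy.2
  have hsmall : 3 / R * dist y x ≤ ε / 4 := by
    have : dist y x ≤ R * ε / 12 := hy.2.le.trans (min_le_right _ _)
    calc _ ≤ 3 / R * (R * ε / 12) := by gcongr
      _ = ε / 4 := by field_simp; norm_num
  have h2 : dist (φ y) (φ x) ≤ ε / 4 :=
    le_of_tendsto ((hφ y hy.1).dist (hφ x hx)) (Eventually.of_forall fun j => (key j y hyR).trans hsmall)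
  have h3 := (key i y hyR).trans hsmall
  calc dist (φ y) (F i y) ≤ dist (φ y) (φ x) + dist (φ x) (F i x) + dist (F i x) (F i y) :=
        dist_triangle4 _ _ _ _
    _ < ε := by rw [dist_comm (φ x), dist_comm (F i x) (F i y)]; linarith

/-- Hurwitz without counting zeros: around an isolated zero of the limit, |F i| ≥ m/2 on a small
circle eventually, and the maximum principle for 1/F i carries this bound to the centre, where the
limit vanishes. -/
theorem eqOn_zero_of_tendstoLocallyUniformlyOn_of_ne_zero {ι : Type*} {l : Filter ι} [l.NeBot]
    {U : Set ℂ} (hU : IsOpen U) (hc : IsPreconnected U) {F : ι → ℂ → ℂ} {φ : ℂ → ℂ}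
    (hF : ∀ i, DifferentiableOn ℂ (F i) U) (h0 : ∀ i, ∀ z ∈ U, F i z ≠ 0)
    (hφ : TendstoLocallyUniformlyOn F φ l U) {b : ℂ} (hb : b ∈ U) (hφb : φ b = 0) :
    EqOn φ 0 U := by
  have hd : DifferentiableOn ℂ φ U := hφ.differentiableOn (Eventually.of_forall hF) hU
  have ha : AnalyticOnNhd ℂ φ U := hd.analyticOnNhd hU
  rcases (ha b hb).eventually_eq_zero_or_eventually_ne_zero with h | h
  · exact ha.eqOn_zero_of_preconnected_of_eventuallyEq_zero hc hb h
  exfalso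
  rw [eventually_nhdsWithin_iff] at h
  obtain ⟨r, hr, hrU⟩ := Metric.nhds_basis_closedBall.mem_iff.1 (inter_mem h (hU.mem_nhds hb))
  have hs : ∀ z ∈ sphere b r, φ z ≠ 0 := fun z hz =>
    (hrU (sphere_subset_closedBall hz)).1 (ne_of_mem_sphere hz hr.ne')
  have hsub : closedBall b r ⊆ U := fun z hz => (hrU hz).2
  obtain ⟨m, hm, hmin⟩ : ∃ m > 0, ∀ z ∈ sphere b r, m ≤ ‖φ z‖ := by
    obtain ⟨x, hx, hxm⟩ := (isCompact_sphere b r).exists_isMinOn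
      (NormedSpace.sphere_nonempty.2 hr.le)
      (hd.continuousOn.mono (sphere_subset_closedBall.trans hsub)).norm
    exact ⟨‖φ x‖, norm_pos_iff.2 (hs x hx), fun z hz => hxm hz⟩
  have hu := (tendstoLocallyUniformlyOn_iff_forall_isCompact hU).1 hφ _ hsub
    (isCompact_closedBall b r)
  rw [Metric.tendstoUniformlyOn_iff] at hu
  have h4 : ∀ᶠ i in l, m / 2 ≤ ‖F i b‖ := by
    filter_upwards [hu (m / 2) (by positivity)] with i hi
    have hinv : DiffContOnCl ℂ (fun z => (F i z)⁻¹) (ball b r) := by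
      refine (DifferentiableOn.diffContOnCl_ball (U := closedBall b r) ?_ le_rfl)
      exact ((hF i).mono hsub).inv fun z hz => h0 i z (hsub hz)
    have := Complex.norm_le_of_forall_mem_frontier_norm_le (C := 2 / m) isBounded_ball hinv
      (fun z hz => by
        rw [frontier_ball b hr.ne'] at hz
        have e1 := hi z (sphere_subset_closedBall hz)
        rw [dist_eq_norm] at e1
        have e2 := hmin z hz
        have e3 : m / 2 ≤ ‖F i z‖ := by
          have := norm_sub_norm_le (φ z) (F i z); linarith
        rw [norm_inv, inv_le_comm₀ (by linarith) (by positivity), inv_div]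
        exact e3) (subset_closure (mem_ball_self hr))
    rwa [norm_inv, inv_le_comm₀ (norm_pos_iff.2 (h0 i b hb)) (by positivity), inv_div] at this
  have h5 := ge_of_tendsto (hφ.tendsto_at hb).norm h4
  rw [hφb, norm_zero] at h5
  linarith

/-- If φ a = φ b with a ≠ b, the functions F i - F i a have no zero near b, so Hurwitz makes φ
constant there and then on all of `U`, against φ' p ≠ 0. -/
theorem injOn_of_tendstoLocallyUniformlyOn {ι : Type*} {l : Filter ι} [l.NeBot]
    {U : Set ℂ} (hU : IsOpen U) (hc : IsPreconnected U) {F : ι → ℂ → ℂ} {φ : ℂ → ℂ}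
    (hF : ∀ i, DifferentiableOn ℂ (F i) U) (h0 : ∀ i, InjOn (F i) U)
    (hφ : TendstoLocallyUniformlyOn F φ l U) {p : ℂ} (hp : p ∈ U) (hφp : deriv φ p ≠ 0) :
    InjOn φ U := by
  have hd : DifferentiableOn ℂ φ U := hφ.differentiableOn (Eventually.of_forall hF) hU
  intro a ha b hb hab
  by_contra hne
  obtain ⟨r, hr, hrU⟩ := Metric.isOpen_iff.1 (hU.sdiff (isClosed_singleton (x := a))) b ⟨hb, fun h => hne h.symm⟩
  have hsub : ball b r ⊆ U := fun z hz => (hrU hz).1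
  have hlim : TendstoLocallyUniformlyOn (fun i z => F i z - F i a) (fun z => φ z - φ a) l (ball b r) := by
    have h1 := hφ.mono hsub
    have h2 : TendstoLocallyUniformlyOn (fun i (_ : ℂ) => F i a) (fun _ => φ a) l (ball b r) := by
      rw [Metric.tendstoLocallyUniformlyOn_iff]
      intro ε hε x hx
      refine ⟨univ, univ_mem, ?_⟩
      filter_upwards [Metric.tendsto_nhds.1 (hφ.tendsto_at ha) ε hε] with i hi y _
      rwa [dist_comm]
    exact h1.sub h2
  have := eqOn_zero_of_tendstoLocallyUniformlyOn_of_ne_zero isOpen_ball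
    (convex_ball b r).isPreconnected (fun i => ((hF i).mono hsub).sub_const _)
    (fun i z hz => by
      rw [sub_ne_zero]
      exact fun h => (hrU hz).2 (h0 i (hsub hz) ha h)) hlim (mem_ball_self hr)
    (by rw [hab, sub_self])
  have hev : (fun z => φ z - φ a) =ᶠ[𝓝 b] 0 :=
    Filter.eventually_of_mem (ball_mem_nhds b hr) this
  have h6 := ((hd.sub_const (φ a)).analyticOnNhd hU).eqOn_zero_of_preconnected_of_eventuallyEq_zero hc hb hev
  apply hφp
  have h7 : φ =ᶠ[𝓝 p] fun _ => φ a :=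
    Filter.eventually_of_mem (hU.mem_nhds hp) fun z hz => sub_eq_zero.1 (h6 hz)
  rw [h7.deriv_eq, deriv_const]

/-! ### Riemann mapping for simply connected subdomains of the disk. -/

/-- The automorphism `z ↦ (z - w) / (1 - conj w * z)` of the unit disk. -/
noncomputable def discAut (w z : ℂ) : ℂ := (z - w) / (1 - (starRingEnd ℂ) w * z)

theorem discAut_denom_ne_zero {w z : ℂ} (hw : ‖w‖ < 1) (hz : ‖z‖ < 1) :
    1 - (starRingEnd ℂ) w * z ≠ 0 := by
  intro h
  have h1 : ‖(starRingEnd ℂ) w * z‖ = 1 := by rw [← sub_eq_zero.1 h, norm_one]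
  rw [norm_mul, RCLike.norm_conj] at h1
  nlinarith [norm_nonneg w, norm_nonneg z]

theorem norm_discAut_lt_one {w z : ℂ} (hw : ‖w‖ < 1) (hz : ‖z‖ < 1) : ‖discAut w z‖ < 1 := by
  have hd := discAut_denom_ne_zero hw hz
  rw [discAut, norm_div, div_lt_one (norm_pos_iff.2 hd)]
  apply lt_of_pow_lt_pow_left₀ 2 (norm_nonneg _)
  have h1 : ‖w‖ ^ 2 < 1 := by nlinarith [norm_nonneg w]
  have h2 : ‖z‖ ^ 2 < 1 := by nlinarith [norm_nonneg z]
  have key : ‖1 - (starRingEnd ℂ) w * z‖ ^ 2 - ‖z - w‖ ^ 2 = (1 - ‖w‖ ^ 2) * (1 - ‖z‖ ^ 2) := by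
    simp only [← Complex.normSq_eq_norm_sq, Complex.normSq_apply]
    simp
    ring
  nlinarith

theorem hasDerivAt_discAut {w z : ℂ} (hw : ‖w‖ < 1) (hz : ‖z‖ < 1) :
    HasDerivAt (discAut w) ((1 - (starRingEnd ℂ) w * w) / (1 - (starRingEnd ℂ) w * z) ^ 2) z := by
  have hd := discAut_denom_ne_zero hw hz
  have h1 : HasDerivAt (fun z => z - w) 1 z := (hasDerivAt_id z).sub_const w
  have h2 : HasDerivAt (fun z => 1 - (starRingEnd ℂ) w * z) (-((starRingEnd ℂ) w * 1)) z :=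
    ((hasDerivAt_id z).const_mul _).const_sub 1
  refine (h1.div h2 hd).congr_deriv ?_
  congr 1
  ring

theorem injOn_discAut {w : ℂ} (hw : ‖w‖ < 1) : InjOn (discAut w) (ball 0 1) := by
  intro x hx y hy h
  rw [mem_ball_zero_iff] at hx hy
  have h1 := discAut_denom_ne_zero hw hx
  have h2 := discAut_denom_ne_zero hw hy
  rw [discAut, discAut, div_eq_div_iff h1 h2] at h
  have h3 := discAut_denom_ne_zero hw hw
  have : (1 - (starRingEnd ℂ) w * w) * (x - y) = 0 := by linear_combination h
  rcases mul_eq_zero.1 this with h' | h'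
  exacts [absurd h' h3, sub_eq_zero.1 h']

theorem discAut_self (w : ℂ) : discAut w w = 0 := by simp [discAut]

/-- The slope of q is the slope of q² divided by q x + q z, so a continuous square root is
differentiable wherever it does not vanish. -/
theorem hasDerivAt_of_sq_eq {q ψ : ℂ → ℂ} {z d : ℂ} (hq : ContinuousAt q z) (h0 : q z ≠ 0)
    (h : ∀ x, q x ^ 2 = ψ x) (hψ : HasDerivAt ψ d z) : HasDerivAt q (d / (2 * q z)) z := by
  rw [hasDerivAt_iff_tendsto_slope] at hψ ⊢
  have h1 : Tendsto (fun x => q x + q z) (𝓝[≠] z) (𝓝 (2 * q z)) := by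
    rw [two_mul]
    exact (hq.tendsto.mono_left nhdsWithin_le_nhds).add_const _
  have h2 : 2 * q z ≠ 0 := mul_ne_zero two_ne_zero h0
  refine (hψ.div h1 h2).congr' ?_
  filter_upwards [h1.eventually_ne h2] with x hx
  simp only [slope_def_field, Pi.div_apply]
  rw [← h x, ← h z, sq_sub_sq, div_right_comm, mul_div_cancel_left₀ _ hx]

/-- Injective holomorphic maps of `U` into the unit disk which fix the origin. -/
structure IsDiscEmbedding (U : Set ℂ) (F : ℂ → ℂ) : Prop where
  diff : DifferentiableOn ℂ F U
  inj : InjOn F U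
  deriv_ne : ∀ z ∈ U, deriv F z ≠ 0
  mapsTo : MapsTo F U (ball 0 1)
  map_zero : F 0 = 0

/-- Koebe's square root trick. -/
theorem IsDiscEmbedding.exists_larger {U : Set ℂ} {F : ℂ → ℂ} (hU : IsOpen U)
    (hUc : IsSimplyConnected U) (h0 : (0 : ℂ) ∈ U) (hF : IsDiscEmbedding U F) {w : ℂ}
    (hw : ‖w‖ < 1) (hwF : w ∉ F '' U) :
    ∃ K, IsDiscEmbedding U K ∧ ‖deriv F 0‖ < ‖deriv K 0‖ := by
  have hFn : ∀ z ∈ U, ‖F z‖ < 1 := fun z hz => mem_ball_zero_iff.1 (hF.mapsTo hz)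
  have hψd : ∀ z ∈ U, HasDerivAt (fun z => discAut w (F z))
      ((1 - (starRingEnd ℂ) w * w) / (1 - (starRingEnd ℂ) w * F z) ^ 2 * deriv F z) z :=
    fun z hz => (hasDerivAt_discAut hw (hFn z hz)).comp z
      (hF.diff.differentiableAt (hU.mem_nhds hz)).hasDerivAt
  have hψ0 : ∀ z ∈ U, discAut w (F z) ≠ 0 := by
    intro z hz h
    rw [discAut, div_eq_zero_iff, or_iff_left (discAut_denom_ne_zero hw (hFn z hz))] at h
    exact hwF ⟨z, hz, sub_eq_zero.1 h⟩
  obtain ⟨q, hqc, hq⟩ := exists_continuousOn_pow_eq hUc hU (g := fun z => discAut w (F z))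
    (fun z hz => (hψd z hz).continuousAt.continuousWithinAt)
    (by rintro ⟨z, hz, h⟩; exact hψ0 z hz h) two_ne_zero
  have hq0 : ∀ z ∈ U, q z ≠ 0 := fun z hz h => hψ0 z hz (by rw [← hq, h]; simp)
  have hqd := fun z hz => hasDerivAt_of_sq_eq (hqc.continuousAt (hU.mem_nhds hz)) (hq0 z hz) hq (hψd z hz)
  have hqn : ∀ z ∈ U, ‖q z‖ < 1 := by
    intro z hz
    have := norm_discAut_lt_one hw (hFn z hz)
    rw [← hq, norm_pow] at this
    exact (pow_lt_one_iff_of_nonneg (norm_nonneg _) two_ne_zero).1 this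
  set p := q 0 with hp
  have hpn : ‖p‖ < 1 := hqn 0 h0
  have hKd := fun z hz => (hasDerivAt_discAut hpn (hqn z hz)).comp z (hqd z hz)
  have hden : ∀ u v : ℂ, ‖u‖ < 1 → ‖v‖ < 1 →
      (1 - (starRingEnd ℂ) u * u) / (1 - (starRingEnd ℂ) u * v) ^ 2 ≠ 0 := fun u v hu hv =>
    div_ne_zero (discAut_denom_ne_zero hu hu) (pow_ne_zero _ (discAut_denom_ne_zero hu hv))
  refine ⟨discAut p ∘ q, ⟨?_, ?_, ?_, ?_, ?_⟩, ?_⟩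
  · exact fun z hz => (hKd z hz).differentiableAt.differentiableWithinAt
  · refine (injOn_discAut hpn).comp ?_ fun z hz => mem_ball_zero_iff.2 (hqn z hz)
    intro x hx y hy hxy
    apply hF.inj hx hy
    apply injOn_discAut hw (hF.mapsTo hx) (hF.mapsTo hy)
    rw [← hq x, ← hq y, hxy]
  · intro z hz
    rw [(hKd z hz).deriv]
    exact mul_ne_zero (hden _ _ hpn (hqn z hz)) (div_ne_zero
      (mul_ne_zero (hden _ _ hw (hFn z hz)) (hF.deriv_ne z hz)) (mul_ne_zero two_ne_zero (hq0 z hz)))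
  · exact fun z hz => mem_ball_zero_iff.2 (norm_discAut_lt_one hpn (hqn z hz))
  · exact discAut_self p
  · rw [(hKd 0 h0).deriv, ← hp, hF.map_zero]
    have e1 : ∀ u : ℂ, 1 - (starRingEnd ℂ) u * u = ((1 - ‖u‖ ^ 2 : ℝ) : ℂ) := by
      intro u
      rw [mul_comm, Complex.mul_conj, Complex.normSq_eq_norm_sq]
      simp
    -- The root is taken of a function with value -w at 0. This turns the gain in the derivative
    -- into the factor (1 + |p|²)/(2|p|), which exceeds 1 because (1 - |p|)² > 0.
    have hpw : ‖p‖ ^ 2 = ‖w‖ := by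
      rw [← norm_pow, hp, hq 0, hF.map_zero]
      simp [discAut]
    have hp0 : 0 < ‖p‖ := norm_pos_iff.2 (hq0 0 h0)
    rw [e1, e1, ← hpw]
    have hD : 0 < ‖deriv F 0‖ := norm_pos_iff.2 (hF.deriv_ne 0 h0)
    have hp2 : ‖p‖ ^ 2 < 1 := by nlinarith
    have hp4 : (‖p‖ ^ 2) ^ 2 < 1 := by nlinarith [sq_nonneg ‖p‖]
    simp only [norm_mul, norm_div, norm_pow, Complex.norm_real, mul_zero, sub_zero, one_pow, div_one]
    rw [Real.norm_of_nonneg (by linarith), Real.norm_of_nonneg (by linarith)]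
    have : (1 - ‖p‖ ^ 2) / (1 - ‖p‖ ^ 2) ^ 2 * ((1 - (‖p‖ ^ 2) ^ 2) * ‖deriv F 0‖ / (‖(2 : ℂ)‖ * ‖p‖))
        = (1 + ‖p‖ ^ 2) / (2 * ‖p‖) * ‖deriv F 0‖ := by
      have : 1 - ‖p‖ ^ 2 ≠ 0 := by linarith
      rw [Complex.norm_ofNat]
      field_simp
      ring
    rw [this]
    have : 1 < (1 + ‖p‖ ^ 2) / (2 * ‖p‖) := by
      rw [lt_div_iff₀ (by positivity)]
      nlinarith [sq_pos_of_pos (sub_pos.2 hpn)]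
    nlinarith

/-- Among embeddings fixing 0, one of maximal |F'(0)| exists by Montel and Hurwitz; an omitted value
would let Koebe's trick enlarge the derivative. -/
theorem exists_isDiscEmbedding_surjOn {U : Set ℂ} (hU : IsOpen U) (hUc : IsSimplyConnected U)
    (h0 : (0 : ℂ) ∈ U) (hU1 : U ⊆ ball 0 1) :
    ∃ F, IsDiscEmbedding U F ∧ F '' U = ball 0 1 := by
  have hpre : IsPreconnected U := hUc.isPathConnected.isConnected.isPreconnected
  have hid : IsDiscEmbedding U id := ⟨differentiableOn_id, injOn_id U, by simp, hU1, rfl⟩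
  obtain ⟨r, hr, hrU⟩ := Metric.isOpen_iff.1 hU 0 h0
  set S : Set ℝ := {x | ∃ F, IsDiscEmbedding U F ∧ ‖deriv F 0‖ = x} with hS
  have hSb : BddAbove S := by
    refine ⟨1 / r, ?_⟩
    rintro x ⟨F, hF, rfl⟩
    refine norm_deriv_le_div_of_mapsTo_ball (hF.diff.mono hrU) (fun z hz => ?_) hr
    rw [hF.map_zero]
    exact ball_subset_closedBall (hF.mapsTo (hrU hz))
  have h1S : (1 : ℝ) ∈ S := ⟨id, hid, by simp⟩
  obtain ⟨u, -, hu, huS⟩ := exists_seq_tendsto_sSup ⟨1, h1S⟩ hSb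
  choose F hF hFu using huS
  obtain ⟨φ, hφ⟩ := exists_tendstoLocallyUniformlyOn_of_norm_le_one (hyperfilter ℕ) hU
    (fun i => (hF i).diff) (fun i z hz => (mem_ball_zero_iff.1 ((hF i).mapsTo hz)).le)
  have hd : DifferentiableOn ℂ φ U := hφ.differentiableOn (Eventually.of_forall fun i => (hF i).diff) hU
  have hφ' := hφ.deriv (Eventually.of_forall fun i => (hF i).diff) hU
  have hle : ((hyperfilter ℕ : Ultrafilter ℕ) : Filter ℕ) ≤ atTop := by
    rw [← Nat.cofinite_eq_atTop]; exact hyperfilter_le_cofinite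
  have hsup : ‖deriv φ 0‖ = sSup S := by
    refine tendsto_nhds_unique (hφ'.tendsto_at h0).norm ((hu.mono_left hle).congr fun n => ?_)
    rw [← hFu]; rfl
  have hφ0 : deriv φ 0 ≠ 0 := by
    rw [← norm_pos_iff, hsup]
    exact one_pos.trans_le (le_csSup hSb h1S)
  have hφz : φ 0 = 0 := tendsto_nhds_unique (hφ.tendsto_at h0)
    (tendsto_const_nhds.congr fun n => ((hF n).map_zero).symm)
  have hle1 : ∀ z ∈ U, ‖φ z‖ ≤ 1 := fun z hz => le_of_tendsto (hφ.tendsto_at hz).norm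
    (Eventually.of_forall fun i => (mem_ball_zero_iff.1 ((hF i).mapsTo hz)).le)
  have hemb : IsDiscEmbedding U φ := by
    refine ⟨hd, injOn_of_tendstoLocallyUniformlyOn hU hpre (fun i => (hF i).diff)
      (fun i => (hF i).inj) hφ h0 hφ0, ?_, ?_, hφz⟩
    -- Hurwitz for the derivatives: a zero of φ' would force φ' to vanish identically.
    · intro z hz h
      exact hφ0 (eqOn_zero_of_tendstoLocallyUniformlyOn_of_ne_zero hU hpre
        (fun i => ((hF i).diff.analyticOnNhd hU).deriv.differentiableOn)
        (fun i => (hF i).deriv_ne) hφ' hz h h0)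
    · intro z hz
      rw [mem_ball_zero_iff]
      refine lt_of_le_of_ne (hle1 z hz) fun h => ?_
      have hmax : IsMaxOn (norm ∘ φ) U z := fun y hy => by
        simp only [mem_ofPred_eq, Function.comp, h]; exact hle1 y hy
      have := Complex.norm_eqOn_of_isPreconnected_of_isMaxOn hpre hU hd hz hmax h0
      simp [hφz, h] at this
  refine ⟨φ, hemb, subset_antisymm hemb.mapsTo.image_subset fun w hw => ?_⟩
  by_contra hwφ
  obtain ⟨K, hK, hlt⟩ := hemb.exists_larger hU hUc h0 (mem_ball_zero_iff.1 hw) hwφ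
  exact absurd (le_csSup hSb ⟨K, hK, rfl⟩) (by rw [← hsup]; exact not_le.2 hlt)

/-! ### Arguments along paths, and crossing of paths in the disk. -/

/-- (D x - D 0)/(2πi) is a continuous function with integer values; if it moved, its real part would
pass through ±1/2. -/
theorem eq_zero_value_of_exp_eq_const {D : ℝ → ℂ} (hD : Continuous D) {k : ℂ}
    (h : ∀ x, exp (D x) = k) (x : ℝ) : D x = D 0 := by
  by_contra hne
  have hint : ∀ t, ∃ n : ℤ, ((D t - D 0) / (2 * Real.pi * I)).re = n := by
    intro t
    obtain ⟨n, hn⟩ := Complex.exp_eq_exp_iff_exists_int.1 ((h t).trans (h 0).symm)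
    refine ⟨n, ?_⟩
    rw [hn, add_sub_cancel_left, mul_div_assoc, div_self Complex.two_pi_I_ne_zero]
    simp
  have hc : Continuous fun t => ((D t - D 0) / (2 * Real.pi * I)).re := by fun_prop
  have hx : ∃ n : ℤ, n ≠ 0 ∧ ((D x - D 0) / (2 * Real.pi * I)).re = n := by
    obtain ⟨n, hn⟩ := Complex.exp_eq_exp_iff_exists_int.1 ((h x).trans (h 0).symm)
    refine ⟨n, ?_, ?_⟩
    · rintro rfl
      exact hne (by simpa using hn)
    · rw [hn, add_sub_cancel_left, mul_div_assoc, div_self Complex.two_pi_I_ne_zero]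
      simp
  obtain ⟨n, hn0, hn⟩ := hx
  have h0 : ((D 0 - D 0) / (2 * Real.pi * I)).re = 0 := by simp
  rcases lt_or_gt_of_ne hn0 with hn1 | hn1
  · obtain ⟨t, ht⟩ := mem_range_of_exists_le_of_exists_ge hc (c := -1 / 2)
      ⟨x, by rw [hn]; have : (n : ℝ) ≤ -1 := by exact_mod_cast Int.le_sub_one_of_lt hn1
             linarith⟩ ⟨0, by rw [h0]; norm_num⟩
    obtain ⟨m, hm⟩ := hint t
    simp only at ht
    rw [ht] at hm
    have : (-1 : ℝ) = ((2 * m : ℤ) : ℝ) := by push_cast; linarith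
    have : (-1 : ℤ) = 2 * m := by exact_mod_cast this
    omega
  · obtain ⟨t, ht⟩ := mem_range_of_exists_le_of_exists_ge hc (c := 1 / 2)
      ⟨0, by rw [h0]; norm_num⟩ ⟨x, by rw [hn]; have : (1 : ℝ) ≤ n := by exact_mod_cast hn1
                                       linarith⟩
    obtain ⟨m, hm⟩ := hint t
    simp only at ht
    rw [ht] at hm
    have : (1 : ℝ) = ((2 * m : ℤ) : ℝ) := by push_cast; linarith
    have : (1 : ℤ) = 2 * m := by exact_mod_cast this
    omega

/-- In the right half-plane the principal logarithm is a continuous lift, and two lifts of one path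
differ by a constant. Hence increments of any lift can be read off from `arg`. -/
theorem im_sub_eq_arg_sub_of_exp_eq {L G : ℝ → ℂ} (hL : Continuous L) (hG : Continuous G) {k : ℂ}
    (hGre : ∀ x, 0 < (G x).re) (h : ∀ x, exp (L x) = k * G x) (x : ℝ) :
    (L x - L 0).im = arg (G x) - arg (G 0) := by
  have hc : Continuous fun x => L x - log (G x) :=
    hL.sub (hG.clog fun x => Or.inl (hGre x))
  have := eq_zero_value_of_exp_eq_const hc (k := k) (fun x => by
    have : G x ≠ 0 := fun h0 => by simpa [h0] using hGre x
    rw [exp_sub, h x, exp_log this, mul_div_cancel_right₀ _ this]) x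
  have h2 : L x - L 0 = log (G x) - log (G 0) := by linear_combination this
  rw [h2, sub_im, log_im, log_im]

theorem arg_one_sub_exp {t : ℝ} (h0 : 0 < t) (h1 : t < 2 * Real.pi) :
    arg (1 - exp (t * I)) = (t - Real.pi) / 2 := by
  have : 1 - exp (t * I) = ((2 * Real.sin (t / 2) : ℝ) : ℂ) *
      (cos (((t - Real.pi) / 2 : ℝ) : ℂ) + sin (((t - Real.pi) / 2 : ℝ) : ℂ) * I) := by
    rw [exp_mul_I, ← ofReal_cos, ← ofReal_sin, ← ofReal_cos, ← ofReal_sin]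
    have e1 : (t - Real.pi) / 2 = t / 2 - Real.pi / 2 := by ring
    rw [e1, Real.cos_sub_pi_div_two, Real.sin_sub_pi_div_two]
    have e2 : t = 2 * (t / 2) := by ring
    have h3 := Real.cos_sq_add_sin_sq (t / 2)
    apply Complex.ext
    · simp only [sub_re, one_re, add_re, mul_re, ofReal_re, ofReal_im, I_re, I_im, add_im, mul_im]
      rw [e2, Real.cos_two_mul, ← e2]
      nlinarith
    · simp only [sub_im, one_im, add_re, mul_re, ofReal_re, ofReal_im, I_re, I_im, add_im, mul_im]
      rw [e2, Real.sin_two_mul, ← e2]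
      ring
  rw [this, arg_mul_cos_add_sin_mul_I]
  · have := Real.sin_pos_of_pos_of_lt_pi (x := t / 2) (by linarith) (by linarith)
    positivity
  · constructor <;> linarith

theorem arg_one_sub_exp_neg {t : ℝ} (h0 : t < 0) (h1 : -(2 * Real.pi) < t) :
    arg (1 - exp (t * I)) = (t + Real.pi) / 2 := by
  have := arg_one_sub_exp (t := t + 2 * Real.pi) (by linarith) (by linarith)
  have h2 : exp (((t + 2 * Real.pi : ℝ) : ℂ) * I) = exp (t * I) := by
    push_cast
    rw [add_mul]
    exact exp_periodic _
  rw [h2] at this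
  rw [this]; ring

theorem one_sub_re_pos {w : ℂ} (hw : ‖w‖ ≤ 1) (h1 : w ≠ 1) : 0 < (1 - w).re := by
  rw [sub_re, one_re, sub_pos]
  refine lt_of_le_of_ne ((re_le_norm w).trans hw) fun h => h1 ?_
  have h2 : ‖w‖ = 1 := le_antisymm hw (h ▸ re_le_norm w)
  have h3 : w.re = ‖w‖ := by rw [h, h2]
  have := (Complex.re_eq_norm.1 h3)
  rw [eq_re_of_ofReal_le this, h, ofReal_one]

/-- Two paths in the closed unit disk which join alternating points of the circle intersect. -/
theorem exists_eq_of_alternating {P Q : ℝ → ℂ} (hP : Continuous P) (hQ : Continuous Q)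
    (hP1 : ∀ x, ‖P x‖ ≤ 1) (hQ1 : ∀ x, ‖Q x‖ ≤ 1) {s₁ s₂ s₃ s₄ : ℝ} (h12 : s₁ < s₂) (h23 : s₂ < s₃)
    (h34 : s₃ < s₄) (h41 : s₄ < s₁ + 2 * Real.pi) (e1 : P 0 = exp (s₁ * I))
    (e2 : Q 0 = exp (s₂ * I)) (e3 : P 1 = exp (s₃ * I)) (e4 : Q 1 = exp (s₄ * I)) :
    ∃ x y, P x = Q y := by
  by_contra! hne
  have hsc : IsSimplyConnected (univ : Set (ℝ × ℝ)) := by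
    have : ContractibleSpace (univ : Set (ℝ × ℝ)) :=
      (convex_univ).contractibleSpace ⟨0, mem_univ _⟩
    exact SimplyConnectedSpace.ofContractible _
  -- Without a crossing, P x - Q y never vanishes on the plane of pairs (x, y) and so has a
  -- continuous logarithm there.
  obtain ⟨L, hLc, hL⟩ := exists_continuousOn_eqOn_exp_comp hsc isOpen_univ
    (g := fun p : ℝ × ℝ => P p.1 - Q p.2) (by fun_prop)
    (by rintro ⟨p, -, hp⟩; exact hne _ _ (sub_eq_zero.1 hp))
  rw [continuousOn_univ] at hLc
  replace hL : ∀ x y, exp (L (x, y)) = P x - Q y := fun x y => hL (mem_univ (x, y))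
  have nm : ∀ s : ℝ, ‖exp (s * I)‖ = 1 := norm_exp_ofReal_mul_I
  -- On an edge of the unit square one of the two points is fixed on the circle. After division by
  -- it the difference has the form 1 - w with |w| ≤ 1 and w ≠ 1, so it stays in the right
  -- half-plane.
  have hor : ∀ y (s : ℝ), Q y = exp (s * I) → ((L (1, y) - L (0, y)).im =
      arg (1 - P 1 / exp (s * I)) - arg (1 - P 0 / exp (s * I))) := by
    intro y s hs
    refine im_sub_eq_arg_sub_of_exp_eq (L := fun x => L (x, y)) (k := -exp (s * I)) (by fun_prop)
      (G := fun x => 1 - P x / exp (s * I)) (by fun_prop) (fun x => one_sub_re_pos ?_ ?_) ?_ 1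
    · rw [norm_div, nm, div_one]; exact hP1 x
    · rw [Ne, div_eq_one_iff_eq (exp_ne_zero _), ← hs]; exact hne x y
    · intro x
      rw [hL, hs]
      field_simp [exp_ne_zero]
      ring
  have hve : ∀ x (s : ℝ), P x = exp (s * I) → ((L (x, 1) - L (x, 0)).im =
      arg (1 - Q 1 / exp (s * I)) - arg (1 - Q 0 / exp (s * I))) := by
    intro x s hs
    refine im_sub_eq_arg_sub_of_exp_eq (L := fun y => L (x, y)) (k := exp (s * I)) (by fun_prop)
      (G := fun y => 1 - Q y / exp (s * I)) (by fun_prop) (fun y => one_sub_re_pos ?_ ?_) ?_ 1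
    · rw [norm_div, nm, div_one]; exact hQ1 y
    · rw [Ne, div_eq_one_iff_eq (exp_ne_zero _), ← hs]; exact (hne x y).symm
    · intro y
      rw [hL, hs]
      field_simp [exp_ne_zero]
  have a1 := hor 0 s₂ e2
  have a2 := hve 1 s₃ e3
  have a3 := hor 1 s₄ e4
  have a4 := hve 0 s₁ e1
  have q : ∀ s t : ℝ, exp (s * I) / exp (t * I) = exp ((s - t : ℝ) * I) := by
    intro s t; rw [← exp_sub]; push_cast; ring_nf
  rw [e1, e3, q, q] at a1 a3
  rw [e2, e4, q, q] at a2 a4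
  have hpi := Real.pi_pos
  rw [arg_one_sub_exp (by linarith) (by linarith), arg_one_sub_exp_neg (by linarith) (by linarith)] at a1
  rw [arg_one_sub_exp (by linarith) (by linarith), arg_one_sub_exp_neg (by linarith) (by linarith)] at a2
  rw [arg_one_sub_exp_neg (by linarith) (by linarith), arg_one_sub_exp_neg (by linarith) (by linarith)] at a3
  rw [arg_one_sub_exp (by linarith) (by linarith), arg_one_sub_exp (by linarith) (by linarith)] at a4
  simp only [sub_im] at a1 a2 a3 a4
  -- Both `a1` + `a2` and `a3` + `a4` give Im(L(1,1) - L(0,0)), but the explicit values differ by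
  -- 2π.
  linarith

/-! ### Absence of alternation and antipodal extrema on the circle. -/

/-- The restriction of `u` to the unit circle changes between values above and below any level
at most twice. -/
def NoAlternation (u : ℂ → ℝ) : Prop :=
  ∀ s₁ s₂ s₃ s₄ c : ℝ, s₁ < s₂ → s₂ < s₃ → s₃ < s₄ → s₄ < s₁ + 2 * Real.pi →
    c < u (exp (s₁ * I)) → u (exp (s₂ * I)) < c → c < u (exp (s₃ * I)) → u (exp (s₄ * I)) < c → False

theorem exists_joinedIn_ball {S : Set ℂ} (hS : IsOpen S) {p : ℂ} (hp : ‖p‖ = 1) (hpS : p ∈ S) :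
    ∃ q ∈ ball (0 : ℂ) 1 ∩ S, JoinedIn (closedBall 0 1 ∩ S) p q := by
  obtain ⟨δ, hδ, hδS⟩ := Metric.isOpen_iff.1 hS p hpS
  have hcl : p ∈ closure (ball (0 : ℂ) 1) := by
    rw [closure_ball _ one_ne_zero, mem_closedBall_zero_iff, hp]
  obtain ⟨q, hq, hqd⟩ := Metric.mem_closure_iff.1 hcl δ hδ
  rw [dist_comm] at hqd
  refine ⟨q, ⟨hq, hδS hqd⟩, ?_⟩
  have hconv : Convex ℝ (closedBall (0 : ℂ) 1 ∩ ball p δ) := (convex_closedBall _ _).inter (convex_ball _ _)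
  have hp' : p ∈ closedBall (0 : ℂ) 1 ∩ ball p δ := ⟨by rw [mem_closedBall_zero_iff, hp], mem_ball_self hδ⟩
  exact ((hconv.isPathConnected ⟨p, hp'⟩).joinedIn p hp' q ⟨ball_subset_closedBall hq, hqd⟩).mono
    (inter_subset_inter_right _ hδS)

theorem joinedIn_circle {S : Set ℂ} (hS : IsOpen S)
    (h : ∀ x ∈ ball (0 : ℂ) 1 ∩ S, ∀ y ∈ ball (0 : ℂ) 1 ∩ S, JoinedIn (ball (0 : ℂ) 1 ∩ S) x y)
    {p q : ℂ} (hp : ‖p‖ = 1) (hq : ‖q‖ = 1) (hpS : p ∈ S) (hqS : q ∈ S) :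
    JoinedIn (closedBall 0 1 ∩ S) p q := by
  obtain ⟨p', hp', h1⟩ := exists_joinedIn_ball hS hp hpS
  obtain ⟨q', hq', h2⟩ := exists_joinedIn_ball hS hq hqS
  exact (h1.trans ((h p' hp' q' hq').mono (inter_subset_inter_left _ ball_subset_closedBall))).trans h2.symm

/-- An alternation would yield a path in {u > c} and a path in {u < c} joining alternating points of
the circle; they would have to meet. -/
theorem noAlternation_of_joinedIn {u : ℂ → ℝ} (hu : Continuous u)
    (h1 : ∀ c, ∀ x ∈ ball (0 : ℂ) 1 ∩ {z | c < u z}, ∀ y ∈ ball (0 : ℂ) 1 ∩ {z | c < u z},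
      JoinedIn (ball (0 : ℂ) 1 ∩ {z | c < u z}) x y)
    (h2 : ∀ c, ∀ x ∈ ball (0 : ℂ) 1 ∩ {z | u z < c}, ∀ y ∈ ball (0 : ℂ) 1 ∩ {z | u z < c},
      JoinedIn (ball (0 : ℂ) 1 ∩ {z | u z < c}) x y) : NoAlternation u := by
  intro s₁ s₂ s₃ s₄ c h12 h23 h34 h41 u1 u2 u3 u4
  obtain ⟨γ, hγ⟩ := joinedIn_circle (isOpen_lt continuous_const hu) (h1 c)
    (norm_exp_ofReal_mul_I s₁) (norm_exp_ofReal_mul_I s₃) u1 u3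
  obtain ⟨η, hη⟩ := joinedIn_circle (isOpen_lt hu continuous_const) (h2 c)
    (norm_exp_ofReal_mul_I s₂) (norm_exp_ofReal_mul_I s₄) u2 u4
  obtain ⟨x, y, hxy⟩ := exists_eq_of_alternating (P := γ.extend) (Q := η.extend)
    γ.continuous_extend η.continuous_extend
    (fun x => mem_closedBall_zero_iff.1 (hγ _).1) (fun x => mem_closedBall_zero_iff.1 (hη _).1)
    h12 h23 h34 h41 (by simp) (by simp) (by simp) (by simp)
  have l1 : c < u (γ.extend x) := (hγ _).2
  have l2 : u (η.extend y) < c := (hη _).2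
  rw [hxy] at l1
  exact lt_asymm l1 l2

theorem exists_angle {p q : ℂ} (hp : ‖p‖ = 1) (hq : ‖q‖ = 1) :
    ∃ s t : ℝ, 0 ≤ t ∧ t < 2 * Real.pi ∧ p = exp (s * I) ∧ q = exp ((s + t : ℝ) * I) := by
  have hpe : p = exp (arg p * I) := by
    conv_lhs => rw [← norm_mul_exp_arg_mul_I p, hp]
    simp
  have hqe : q = exp (arg q * I) := by
    conv_lhs => rw [← norm_mul_exp_arg_mul_I q, hq]
    simp
  have h1 := neg_pi_lt_arg p
  have h2 := arg_le_pi p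
  have h3 := neg_pi_lt_arg q
  have h4 := arg_le_pi q
  rcases le_or_gt (arg p) (arg q) with h | h
  · exact ⟨arg p, arg q - arg p, by linarith, by linarith, hpe, by rwa [add_sub_cancel]⟩
  · refine ⟨arg p, arg q - arg p + 2 * Real.pi, by linarith, by linarith, hpe, ?_⟩
    have : ((arg p + (arg q - arg p + 2 * Real.pi) : ℝ) : ℂ) * I = arg q * I + 2 * Real.pi * I := by
      push_cast; ring
    rw [this, exp_periodic, ← hqe]

theorem mul_conj_exp_im (s t : ℝ) :
    (exp ((s + t : ℝ) * I) * (starRingEnd ℂ) (exp (s * I))).im = Real.sin t := by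
  rw [← exp_conj, ← exp_add]
  have : ((s + t : ℝ) : ℂ) * I + (starRingEnd ℂ) (s * I) = t * I := by
    rw [map_mul, conj_ofReal, conj_I]; push_cast; ring
  rw [this, exp_ofReal_mul_I_im]

/-- The points of the unit circle at which `u` attains its maximum over the circle. -/
def circleArgmax (u : ℂ → ℝ) : Set ℂ := {ζ | ‖ζ‖ = 1 ∧ ∀ p, ‖p‖ = 1 → u p ≤ u ζ}

theorem circleArgmax_nonempty {u : ℂ → ℝ} (hu : Continuous u) : (circleArgmax u).Nonempty := by
  obtain ⟨ζ, hζ, h⟩ := (isCompact_sphere (0 : ℂ) 1).exists_isMaxOn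
    (NormedSpace.sphere_nonempty.2 zero_le_one) hu.continuousOn
  exact ⟨ζ, mem_sphere_zero_iff_norm.1 hζ, fun p hp => h (mem_sphere_zero_iff_norm.2 hp)⟩

/-- If neither arc between two maximum points consisted of maxima, each would contain a lower point,
and the four points would alternate about an intermediate level. -/
theorem NoAlternation.isPreconnected_circleArgmax {u : ℂ → ℝ} (h : NoAlternation u) :
    IsPreconnected (circleArgmax u) := by
  refine isPreconnected_of_forall_pair fun a ha b hb => ?_
  obtain ⟨s, t, ht0, ht1, rfl, rfl⟩ := exists_angle ha.1 hb.1
  have hc : ∀ x y : ℝ, IsPreconnected ((fun x : ℝ => exp (x * I)) '' Icc x y) := fun x y =>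
    isPreconnected_Icc.image _ (by fun_prop)
  have hper : exp ((s + 2 * Real.pi : ℝ) * I) = exp (s * I) := by
    push_cast; rw [add_mul]; exact exp_periodic _
  by_cases h1 : (fun x : ℝ => exp (x * I)) '' Icc s (s + t) ⊆ circleArgmax u
  · exact ⟨_, h1, ⟨s, ⟨le_rfl, by linarith⟩, rfl⟩, ⟨s + t, ⟨by linarith, le_rfl⟩, rfl⟩, hc _ _⟩
  by_cases h2 : (fun x : ℝ => exp (x * I)) '' Icc (s + t) (s + 2 * Real.pi) ⊆ circleArgmax u
  · exact ⟨_, h2, ⟨s + 2 * Real.pi, ⟨by linarith, le_rfl⟩, hper⟩,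
      ⟨s + t, ⟨le_rfl, by linarith⟩, rfl⟩, hc _ _⟩
  exfalso
  obtain ⟨_, ⟨x, hx, rfl⟩, hxM⟩ := not_subset.1 h1
  obtain ⟨_, ⟨y, hy, rfl⟩, hyM⟩ := not_subset.1 h2
  simp only at hxM hyM
  have hlt : ∀ x : ℝ, exp (x * I) ∉ circleArgmax u → u (exp (x * I)) < u (exp (s * I)) := by
    intro x hx
    by_contra! hle
    exact hx ⟨norm_exp_ofReal_mul_I x, fun p hp => (ha.2 p hp).trans hle⟩
  have hbe : u (exp ((s + t : ℝ) * I)) = u (exp (s * I)) :=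
    le_antisymm (ha.2 _ hb.1) (hb.2 _ ha.1)
  have x1 : s < x := lt_of_le_of_ne hx.1 fun e => hxM (e ▸ ha)
  have x2 : x < s + t := lt_of_le_of_ne hx.2 fun e => hxM (e ▸ hb)
  have y1 : s + t < y := lt_of_le_of_ne hy.1 fun e => hyM (e ▸ hb)
  have y2 : y < s + 2 * Real.pi := lt_of_le_of_ne hy.2 fun e => hyM (by rw [e, hper]; exact ha)
  obtain ⟨c, hc1, hc2⟩ := exists_between (max_lt (hlt x hxM) (hlt y hyM))
  exact h s x (s + t) y c x1 x2 y1 y2 hc2 ((le_max_left _ _).trans_lt hc1) (by rwa [hbe])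
    ((le_max_right _ _).trans_lt hc1)

/-- Closedness jointly in direction and point: projections of compact sets of triples (direction,
maximum, minimum) are then closed, which the connectedness arguments below need. -/
theorem isClosed_setOf_mem_circleArgmax {X : Type*} [TopologicalSpace X] {F : ℂ → ℂ}
    (hF : Continuous F) {a b : X → ℂ} (ha : Continuous a) (hb : Continuous b) :
    IsClosed {x | b x ∈ circleArgmax fun z => (a x * F z).re} := by
  have : {x | b x ∈ circleArgmax fun z => (a x * F z).re} =
      {x | ‖b x‖ = 1} ∩ ⋂ p : ℂ, ⋂ _ : ‖p‖ = 1, {x | (a x * F p).re ≤ (a x * F (b x)).re} := by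
    ext x
    simp [circleArgmax]
  rw [this]
  refine (isClosed_eq (by fun_prop) continuous_const).inter
    (isClosed_iInter fun p => isClosed_iInter fun _ => isClosed_le (by fun_prop) (by fun_prop))

/-- Two connectedness arguments. Over the circle of directions, one finds a ν having minima in both
cyclic positions relative to its maxima; over the connected set of maxima of that ν, one finds a
single ζ with minima on both closed sides. If -ζ were not a minimum, then ζ, a minimum, -ζ and
another minimum would alternate. -/
theorem exists_antipodal_extrema {F : ℂ → ℂ} (hF : Continuous F)
    (hA : ∀ ν : ℂ, ‖ν‖ = 1 → NoAlternation fun z => (ν * F z).re)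
    (hne : ∀ ν : ℂ, ‖ν‖ = 1 → ∃ p q : ℂ, ‖p‖ = 1 ∧ ‖q‖ = 1 ∧ (ν * F p).re ≠ (ν * F q).re) :
    ∃ ν ζ : ℂ, ‖ν‖ = 1 ∧ ‖ζ‖ = 1 ∧
      ∀ p : ℂ, ‖p‖ = 1 → (ν * F (-ζ)).re ≤ (ν * F p).re ∧ (ν * F p).re ≤ (ν * F ζ).re := by
  set M : ℂ → Set ℂ := fun ν => circleArgmax fun z => (ν * F z).re with hM
  have hmin : ∀ ν ζ : ℂ, ζ ∈ M (-ν) → ∀ p : ℂ, ‖p‖ = 1 → (ν * F ζ).re ≤ (ν * F p).re := by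
    intro ν ζ h p hp
    have := h.2 p hp
    simp only [neg_mul, neg_re] at this
    linarith
  have hdisj : ∀ ν ζ : ℂ, ‖ν‖ = 1 → ζ ∈ M ν → ζ ∈ M (-ν) → False := by
    intro ν ζ hν h1 h2
    obtain ⟨p, q, hp, hq, hpq⟩ := hne ν hν
    exact hpq (le_antisymm ((h1.2 p hp).trans (hmin ν ζ h2 q hq))
      ((h1.2 q hq).trans (hmin ν ζ h2 p hp)))
  have hMn : ∀ ν, (M ν).Nonempty := fun ν => circleArgmax_nonempty (by fun_prop)
  have hswap : ∀ a b : ℂ, (a * (starRingEnd ℂ) b).im = -(b * (starRingEnd ℂ) a).im := by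
    intro a b; simp; ring
  -- Directions for which some minimum lies on the closed half circle counterclockwise from some
  -- maximum. Replacing ν by -ν swaps maxima and minima, so `T` and its negative cover the circle.
  set T : Set ℂ := {ν | ‖ν‖ = 1 ∧ ∃ ζ ∈ M ν, ∃ ζ' ∈ M (-ν), 0 ≤ (ζ' * (starRingEnd ℂ) ζ).im} with hT
  have hTc : IsClosed T := by
    have hK : IsCompact ((sphere (0 : ℂ) 1 ×ˢ (sphere (0 : ℂ) 1 ×ˢ sphere (0 : ℂ) 1)) ∩
        ({x : ℂ × ℂ × ℂ | x.2.1 ∈ M x.1} ∩ ({x : ℂ × ℂ × ℂ | x.2.2 ∈ M (-x.1)} ∩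
          {x : ℂ × ℂ × ℂ | 0 ≤ (x.2.2 * (starRingEnd ℂ) x.2.1).im}))) := by
      refine ((isCompact_sphere _ _).prod ((isCompact_sphere _ _).prod (isCompact_sphere _ _))).inter_right ?_
      exact (isClosed_setOf_mem_circleArgmax hF (by fun_prop) (by fun_prop)).inter
        ((isClosed_setOf_mem_circleArgmax hF (by fun_prop) (by fun_prop)).inter
          (isClosed_le continuous_const (by fun_prop)))
    convert (hK.image continuous_fst).isClosed using 1
    ext ν
    constructor
    · rintro ⟨h1, ζ, hζ, ζ', hζ', h⟩
      exact ⟨(ν, ζ, ζ'), ⟨⟨by simpa using h1, by simpa using hζ.1, by simpa using hζ'.1⟩, hζ, hζ', h⟩, rfl⟩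
    · rintro ⟨⟨ν', ζ, ζ'⟩, ⟨⟨h1, -⟩, hζ, hζ', h⟩, rfl⟩
      exact ⟨by simpa using h1, ζ, hζ, ζ', hζ', h⟩
  have hcov : ∀ ν : ℂ, ‖ν‖ = 1 → ν ∈ T ∨ -ν ∈ T := by
    intro ν hν
    obtain ⟨ζ, hζ⟩ := hMn ν
    obtain ⟨ζ', hζ'⟩ := hMn (-ν)
    rcases le_total 0 (ζ' * (starRingEnd ℂ) ζ).im with h | h
    · exact Or.inl ⟨hν, ζ, hζ, ζ', hζ', h⟩
    · refine Or.inr ⟨by rwa [norm_neg], ζ', hζ', ζ, by rwa [neg_neg], ?_⟩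
      rw [hswap]; linarith
  obtain ⟨ν, hν, hνT, hνT'⟩ : (sphere (0 : ℂ) 1 ∩ (T ∩ (fun ν => -ν) ⁻¹' T)).Nonempty := by
    have hpre : IsPreconnected (sphere (0 : ℂ) 1) :=
      isPreconnected_sphere (by rw [Complex.rank_real_complex]; norm_num) 0 1
    refine isPreconnected_closed_iff.1 hpre T _ hTc (hTc.preimage continuous_neg)
      (fun ν hν => hcov ν (by simpa using hν)) ?_ ?_
    · rcases hcov 1 norm_one with h | h
      exacts [⟨1, by simp, h⟩, ⟨-1, by simp, h⟩]
    · rcases hcov 1 norm_one with h | h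
      exacts [⟨-1, by simp, by simpa using h⟩, ⟨1, by simp, h⟩]
  rw [mem_sphere_zero_iff_norm] at hν
  -- With ε = 1 and ε = -1 these are the maxima having a minimum on the counterclockwise,
  -- respectively clockwise, side.
  have hYc : ∀ ε : ℝ, IsClosed {ζ | ζ ∈ M ν ∧ ∃ ζ' ∈ M (-ν), 0 ≤ ε * (ζ' * (starRingEnd ℂ) ζ).im} := by
    intro ε
    have hK : IsCompact ((sphere (0 : ℂ) 1 ×ˢ sphere (0 : ℂ) 1) ∩
        ({x : ℂ × ℂ | x.1 ∈ M ν} ∩ ({x : ℂ × ℂ | x.2 ∈ M (-ν)} ∩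
          {x : ℂ × ℂ | 0 ≤ ε * (x.2 * (starRingEnd ℂ) x.1).im}))) := by
      refine ((isCompact_sphere _ _).prod (isCompact_sphere _ _)).inter_right ?_
      exact (isClosed_setOf_mem_circleArgmax hF continuous_const (by fun_prop)).inter
        ((isClosed_setOf_mem_circleArgmax hF continuous_const (by fun_prop)).inter
          (isClosed_le continuous_const (by fun_prop)))
    convert (hK.image continuous_fst).isClosed using 1
    ext ζ
    constructor
    · rintro ⟨hζ, ζ', hζ', h⟩
      exact ⟨(ζ, ζ'), ⟨⟨by simpa using hζ.1, by simpa using hζ'.1⟩, hζ, hζ', h⟩, rfl⟩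
    · rintro ⟨⟨ζ, ζ'⟩, ⟨-, hζ, hζ', h⟩, rfl⟩
      exact ⟨hζ, ζ', hζ', h⟩
  obtain ⟨-, ζ₁, hζ₁, ζ₁', hζ₁', h₁⟩ := hνT
  obtain ⟨-, ζ₂', hζ₂', ζ₂, hζ₂, h₂⟩ := hνT'
  rw [neg_neg] at hζ₂
  obtain ⟨ζ, hζ, ⟨-, ζ', hζ', h'⟩, ⟨-, ζ'', hζ'', h''⟩⟩ :=
    isPreconnected_closed_iff.1 (hA ν hν).isPreconnected_circleArgmax _ _ (hYc 1) (hYc (-1))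
      (fun ζ hζ => by
        obtain ⟨ζ', hζ'⟩ := hMn (-ν)
        rcases le_total 0 (ζ' * (starRingEnd ℂ) ζ).im with h | h
        · exact Or.inl ⟨hζ, ζ', hζ', by linarith⟩
        · exact Or.inr ⟨hζ, ζ', hζ', by linarith⟩)
      ⟨ζ₁, hζ₁, hζ₁, ζ₁', hζ₁', by linarith⟩
      ⟨ζ₂, hζ₂, hζ₂, ζ₂', hζ₂', by rw [hswap] at h₂; linarith⟩
  refine ⟨ν, ζ, hν, hζ.1, fun p hp => ⟨?_, hζ.2 p hp⟩⟩
  by_contra! hlt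
  have hneg : ∀ w ∈ M (-ν), w ≠ -ζ := by
    rintro w hw rfl
    exact absurd (hmin ν _ hw p hp) (not_le.2 hlt)
  have hnz : ∀ w ∈ M (-ν), w ≠ ζ := by
    rintro w hw rfl
    exact hdisj ν w hν hζ hw
  obtain ⟨s, t, ht0, ht1, rfl, rfl⟩ := exists_angle hζ.1 hζ'.1
  obtain ⟨s', t', ht0', ht1', hs, rfl⟩ := exists_angle hζ.1 hζ''.1
  have hss : exp ((s' + t' : ℝ) * I) = exp ((s + t' : ℝ) * I) := by
    push_cast; rw [add_mul, add_mul, exp_add, exp_add, hs]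
  rw [hss] at hζ'' h''
  rw [mul_conj_exp_im] at h' h''
  have hpi : exp ((s + Real.pi : ℝ) * I) = -exp (s * I) := by
    push_cast; rw [add_mul, exp_add, exp_pi_mul_I]; ring
  have t1 : 0 < t := lt_of_le_of_ne ht0 fun e => hnz _ hζ' (by rw [← e, add_zero])
  have t2 : t < Real.pi := by
    refine lt_of_le_of_ne ?_ fun e => hneg _ hζ' (by rw [e, hpi])
    by_contra! hgt
    have := Real.sin_neg_of_neg_of_neg_pi_lt (x := t - 2 * Real.pi) (by linarith) (by linarith)
    rw [Real.sin_sub_two_pi] at this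
    linarith
  have t3 : 0 < t' := lt_of_le_of_ne ht0' fun e => hnz _ hζ'' (by rw [← e, add_zero])
  have t4 : Real.pi < t' := by
    refine lt_of_le_of_ne ?_ fun e => hneg _ hζ'' (by rw [← e, hpi])
    by_contra! hgt
    have := Real.sin_pos_of_pos_of_lt_pi t3 hgt
    linarith
  -- The level separates the minimum from the value at -ζ. In order of angle, the points at s, s +
  -- t, s + π, s + t' are high, low, high, low.
  obtain ⟨c, hc1, hc2⟩ := exists_between hlt
  refine hA ν hν s (s + t) (s + Real.pi) (s + t') c (by linarith) (by linarith) (by linarith)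
    (by linarith) (hc2.trans_le (hζ.2 _ (by rw [norm_neg]; exact hζ.1)))
    ((hmin ν _ hζ' p hp).trans_lt hc1) (by rw [hpi]; exact hc2) ((hmin ν _ hζ'' p hp).trans_lt hc1)

/-! ### The hyperbolic flow and the infinitesimal inequality. -/

/-- The hyperbolic flow of the unit disk with the fixed points `-ζ` and `ζ`. -/
noncomputable def diskFlow (ζ : ℂ) (t : ℝ) (z : ℂ) : ℂ :=
  ζ * (((starRingEnd ℂ) ζ * z + t) / (1 + t * ((starRingEnd ℂ) ζ * z)))

theorem diskFlow_denom_ne_zero {w : ℂ} (hw : ‖w‖ ≤ 1) {t : ℝ} (ht : |t| < 1) :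
    1 + t * w ≠ 0 := by
  intro h
  have h1 : ‖(t : ℂ) * w‖ = 1 := by
    rw [← norm_neg, ← eq_neg_of_add_eq_zero_left h, norm_one]
  rw [norm_mul, norm_real, Real.norm_eq_abs] at h1
  nlinarith [norm_nonneg w, abs_nonneg t]

theorem normSq_diskFlow_aux (w : ℂ) (t : ℝ) :
    ‖1 + t * w‖ ^ 2 - ‖w + t‖ ^ 2 = (1 - t ^ 2) * (1 - ‖w‖ ^ 2) := by
  simp only [← Complex.normSq_eq_norm_sq, Complex.normSq_apply]
  simp
  ring

theorem norm_diskFlow_lt_one {ζ z : ℂ} (hζ : ‖ζ‖ = 1) (hz : ‖z‖ < 1) {t : ℝ} (ht : |t| < 1) :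
    ‖diskFlow ζ t z‖ < 1 := by
  have hw : ‖(starRingEnd ℂ) ζ * z‖ < 1 := by rwa [norm_mul, RCLike.norm_conj, hζ, one_mul]
  have hd := diskFlow_denom_ne_zero hw.le ht
  rw [diskFlow, norm_mul, hζ, one_mul, norm_div, div_lt_one (norm_pos_iff.2 hd)]
  apply lt_of_pow_lt_pow_left₀ 2 (norm_nonneg _)
  have := normSq_diskFlow_aux ((starRingEnd ℂ) ζ * z) t
  have h1 : t ^ 2 < 1 := (sq_lt_one_iff_abs_lt_one t).2 ht
  have h2 : ‖(starRingEnd ℂ) ζ * z‖ ^ 2 < 1 := by nlinarith [norm_nonneg ((starRingEnd ℂ) ζ * z)]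
  nlinarith

theorem differentiableAt_diskFlow {ζ z : ℂ} (hζ : ‖ζ‖ = 1) (hz : ‖z‖ ≤ 1) {t : ℝ} (ht : |t| < 1) :
    DifferentiableAt ℂ (diskFlow ζ t) z := by
  have hw : ‖(starRingEnd ℂ) ζ * z‖ ≤ 1 := by rwa [norm_mul, RCLike.norm_conj, hζ, one_mul]
  have hd := diskFlow_denom_ne_zero hw ht
  unfold diskFlow
  fun_prop (disch := assumption)

theorem diskFlow_zero {ζ : ℂ} (hζ : ‖ζ‖ = 1) (z : ℂ) : diskFlow ζ 0 z = z := by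
  have : ζ * (starRingEnd ℂ) ζ = 1 := by rw [mul_conj, normSq_eq_norm_sq, hζ]; simp
  simp [diskFlow, ← mul_assoc, this]

theorem hasDerivAt_diskFlow_time {ζ : ℂ} (hζ : ‖ζ‖ = 1) (z : ℂ) :
    HasDerivAt (fun t : ℝ => diskFlow ζ t z) (ζ - (starRingEnd ℂ) ζ * z ^ 2) 0 := by
  have h0 : HasDerivAt (fun t : ℝ => (t : ℂ)) 1 0 := Complex.ofRealCLM.hasDerivAt
  have h1 : HasDerivAt (fun t : ℝ => (starRingEnd ℂ) ζ * z + t) 1 0 := h0.const_add _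
  have h2 : HasDerivAt (fun t : ℝ => 1 + (t : ℂ) * ((starRingEnd ℂ) ζ * z))
      (1 * ((starRingEnd ℂ) ζ * z)) 0 := (h0.mul_const _).const_add _
  have h3 := (h1.div h2 (by simp)).const_mul ζ
  refine h3.congr_deriv ?_
  have : ζ * (starRingEnd ℂ) ζ = 1 := by rw [mul_conj, normSq_eq_norm_sq, hζ]; simp
  simp only [ofReal_zero, zero_mul, add_zero, one_pow, div_one, one_mul, mul_one]
  linear_combination -(starRingEnd ℂ) ζ * z ^ 2 * this

/-- The flow keeps the imaginary part positive and increases the real part, so a point of the open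
upper half circle moves towards 1 without leaving it. -/
theorem exists_angle_flow {θ t : ℝ} (h0 : 0 < θ) (h1 : θ < Real.pi) (ht0 : 0 < t) (ht1 : t < 1) :
    ∃ θ' : ℝ, 0 < θ' ∧ θ' < θ ∧
      (exp (θ * I) + t) / (1 + t * exp (θ * I)) = exp (θ' * I) := by
  set w := (exp (θ * I) + t) / (1 + t * exp (θ * I)) with hw
  have hn : ‖exp (θ * I)‖ = 1 := norm_exp_ofReal_mul_I θ
  have hd := diskFlow_denom_ne_zero hn.le (by rwa [abs_of_pos ht0])
  have hN : 0 < normSq (1 + t * exp (θ * I)) := normSq_pos.2 hd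
  have hw1 : ‖w‖ = 1 := by
    rw [hw, norm_div, div_eq_one_iff_eq (norm_ne_zero_iff.2 hd)]
    have := normSq_diskFlow_aux (exp (θ * I)) t
    rw [hn] at this
    have : ‖exp (θ * I) + t‖ ^ 2 = ‖1 + t * exp (θ * I)‖ ^ 2 := by linarith
    exact (sq_eq_sq₀ (norm_nonneg _) (norm_nonneg _)).1 this
  have hsin := Real.sin_pos_of_pos_of_lt_pi h0 h1
  have hre := exp_ofReal_mul_I_re θ
  have him := exp_ofReal_mul_I_im θ
  have hsc := Real.sin_sq_add_cos_sq θ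
  have hN' : normSq (1 + t * exp (θ * I)) = 1 + 2 * t * Real.cos θ + t ^ 2 := by
    rw [normSq_apply]
    simp only [add_re, one_re, mul_re, ofReal_re, ofReal_im, add_im, one_im, mul_im, hre, him]
    nlinarith
  have hwim : 0 < w.im := by
    rw [hw, div_im]
    simp only [add_re, one_re, mul_re, ofReal_re, ofReal_im, add_im, one_im, mul_im, hre, him]
    have : (Real.sin θ + 0) * (1 + (t * Real.cos θ - 0 * Real.sin θ)) / normSq (1 + t * exp (θ * I)) -
        (Real.cos θ + t) * (0 + (t * Real.sin θ + 0 * Real.cos θ)) / normSq (1 + t * exp (θ * I))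
        = Real.sin θ * (1 - t ^ 2) / normSq (1 + t * exp (θ * I)) := by ring
    rw [this]
    have : 0 < 1 - t ^ 2 := by nlinarith
    positivity
  have hwre : Real.cos θ < w.re := by
    rw [hw, div_re]
    simp only [add_re, one_re, mul_re, ofReal_re, ofReal_im, add_im, one_im, mul_im, hre, him]
    rw [← add_div, lt_div_iff₀ hN, hN']
    nlinarith [mul_pos ht0 (sq_pos_of_pos hsin)]
  have ha0 : 0 < arg w := lt_of_le_of_ne (arg_nonneg_iff.2 hwim.le) fun h => by
    have := (arg_eq_zero_iff.1 h.symm).2; linarith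
  refine ⟨arg w, ha0, ?_, ?_⟩
  · by_contra! hle
    have := Real.cos_le_cos_of_nonneg_of_le_pi h0.le (arg_le_pi w) hle
    rw [cos_arg (fun h => by rw [h] at hw1; simp at hw1), hw1, div_one] at this
    linarith
  · conv_lhs => rw [← norm_mul_exp_arg_mul_I w, hw1]
    simp

theorem diskFlow_exp (s θ t : ℝ) : diskFlow (exp (s * I)) t (exp ((s + θ : ℝ) * I)) =
    exp (s * I) * ((exp (θ * I) + t) / (1 + t * exp (θ * I))) := by
  have : (starRingEnd ℂ) (exp (s * I)) * exp ((s + θ : ℝ) * I) = exp (θ * I) := by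
    rw [← exp_conj, ← exp_add, map_mul, conj_ofReal, conj_I]; push_cast; ring_nf
  rw [diskFlow, this]

/-- With its extrema at ±ζ, u cannot decrease from -ζ to ζ along either half circle: a drop between
p and its image would combine with the maximum at ζ and the minimum at -ζ into an alternation. -/
theorem NoAlternation.le_diskFlow {u : ℂ → ℝ} (h : NoAlternation u) {ζ : ℂ} (hζ : ‖ζ‖ = 1)
    (hu : ∀ p : ℂ, ‖p‖ = 1 → u (-ζ) ≤ u p ∧ u p ≤ u ζ) {t : ℝ} (ht0 : 0 < t) (ht1 : t < 1)
    {p : ℂ} (hp : ‖p‖ = 1) : u p ≤ u (diskFlow ζ t p) := by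
  obtain ⟨s, θ, hθ0, hθ1, rfl, rfl⟩ := exists_angle hζ hp
  have hpi : exp ((s + Real.pi : ℝ) * I) = -exp (s * I) := by
    push_cast; rw [add_mul, exp_add, exp_pi_mul_I]; ring
  have hadd : ∀ x : ℝ, exp (s * I) * exp (x * I) = exp ((s + x : ℝ) * I) := by
    intro x; rw [← exp_add]; push_cast; ring_nf
  by_contra! hlt
  obtain ⟨c, hc1, hc2⟩ := exists_between hlt
  have hfix : ∀ a : ℂ, a ^ 2 = 1 → (1 + t * a ≠ 0) → (a + t) / (1 + t * a) = a := by
    intro a ha hne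
    rw [div_eq_iff hne]
    linear_combination -(t : ℂ) * ha
  have hne : ∀ a : ℂ, ‖a‖ ≤ 1 → 1 + t * a ≠ 0 := fun a ha =>
    diskFlow_denom_ne_zero ha (by rwa [abs_of_pos ht0])
  rcases hθ0.eq_or_lt with h0 | h0
  · rw [diskFlow_exp, ← h0, ofReal_zero, zero_mul, exp_zero, hfix 1 (by norm_num) (hne 1 (by simp)),
      mul_one, add_zero] at hlt
    exact lt_irrefl _ hlt
  rcases lt_trichotomy θ Real.pi with hθ | hθ | hθ
  · obtain ⟨θ', h1, h2, h3⟩ := exists_angle_flow h0 hθ ht0 ht1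
    rw [diskFlow_exp, h3, hadd] at hc1
    refine h s (s + θ') (s + θ) (s + Real.pi) c (by linarith) (by linarith) (by linarith)
      (by linarith [Real.pi_pos]) (hc2.trans_le (hu _ hp).2) hc1 hc2 ?_
    rw [hpi]
    exact (hu _ (norm_exp_ofReal_mul_I _)).1.trans_lt hc1
  · rw [diskFlow_exp, hθ, exp_pi_mul_I, hfix (-1) (by norm_num) (hne (-1) (by simp)), hpi,
      mul_neg_one] at hlt
    exact lt_irrefl _ hlt
  -- The lower half circle reduces to the upper one by conjugation, hence the angle 2π - θ. The
  -- alternating points are now p, its image, ζ, -ζ, with p taken one turn back.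
  · obtain ⟨θ', h1, h2, h3⟩ := exists_angle_flow (θ := 2 * Real.pi - θ) (by linarith) (by linarith) ht0 ht1
    have hconj : exp (((2 * Real.pi - θ : ℝ) : ℂ) * I) = (starRingEnd ℂ) (exp (θ * I)) := by
      rw [← exp_conj, map_mul, conj_ofReal, conj_I]
      have : ((2 * Real.pi - θ : ℝ) : ℂ) * I = θ * -I + 2 * Real.pi * I := by push_cast; ring
      rw [this, exp_periodic]
    have h4 : (exp (θ * I) + t) / (1 + t * exp (θ * I)) = exp ((-θ' : ℝ) * I) := by
      rw [hconj] at h3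
      have := congrArg (starRingEnd ℂ) h3
      rw [map_div₀, map_add, map_add, map_mul, conj_conj, conj_ofReal, map_one, ← exp_conj, map_mul,
        conj_ofReal, conj_I] at this
      rw [this]; push_cast; ring_nf
    rw [diskFlow_exp, h4, hadd] at hc1
    have hper : ∀ x : ℝ, exp ((x + 2 * Real.pi : ℝ) * I) = exp (x * I) := by
      intro x; push_cast; rw [add_mul]; exact exp_periodic _
    refine h (s + θ - 2 * Real.pi) (s - θ') s (s + Real.pi) c (by linarith) (by linarith)
      (by linarith [Real.pi_pos]) (by linarith) ?_ hc1 (hc2.trans_le (hu _ hp).2) ?_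
    · rw [← hper, sub_add_cancel]; exact hc2
    · rw [hpi]
      exact (hu _ (norm_exp_ofReal_mul_I _)).1.trans_lt hc1

theorem nonneg_of_nonneg_sphere {v : ℂ → ℝ} (hv : HarmonicContOnCl v (ball 0 1))
    (h : ∀ p : ℂ, ‖p‖ = 1 → 0 ≤ v p) {z : ℂ} (hz : z ∈ ball (0 : ℂ) 1) : 0 ≤ v z := by
  rw [← hv.circleAverage_poissonKernel_smul hz, Real.circleAverage]
  refine smul_nonneg (by positivity) (intervalIntegral.integral_nonneg Real.two_pi_pos.le fun x _ => ?_)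
  rw [Pi.smul_apply', smul_eq_mul]
  have hn : ‖circleMap 0 1 x‖ = 1 := by simp
  refine mul_nonneg ?_ (h _ hn)
  rw [poissonKernel_def]
  rw [mem_ball_zero_iff] at hz
  refine div_nonneg ?_ (sq_nonneg _)
  rw [sub_zero, sub_zero, hn]
  nlinarith [norm_nonneg z]

/-- Ψ = νH + conj ν G is holomorphic with the real part of νF. This real part increases along the
flow on the circle, so also inside by the Poisson integral, and its time derivative at 0 is the real
part of Ψ' times the generator ζ - conj ζ z². -/
theorem exists_re_mul_nonneg_of_noAlternation {F H G : ℂ → ℂ} (hF : Continuous F)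
    (hH : DifferentiableOn ℂ H (ball 0 1)) (hG : DifferentiableOn ℂ G (ball 0 1))
    (hFHG : ∀ z ∈ ball (0 : ℂ) 1, F z = H z + (starRingEnd ℂ) (G z))
    (hA : ∀ ν : ℂ, ‖ν‖ = 1 → NoAlternation fun z => (ν * F z).re)
    (hne : ∀ ν : ℂ, ‖ν‖ = 1 → ∃ p q : ℂ, ‖p‖ = 1 ∧ ‖q‖ = 1 ∧ (ν * F p).re ≠ (ν * F q).re) :
    ∃ ν ζ : ℂ, ‖ν‖ = 1 ∧ ‖ζ‖ = 1 ∧ ∀ z ∈ ball (0 : ℂ) 1,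
      0 ≤ ((ν * deriv H z + (starRingEnd ℂ) ν * deriv G z) * (ζ - (starRingEnd ℂ) ζ * z ^ 2)).re := by
  obtain ⟨ν, ζ, hν, hζ, hext⟩ := exists_antipodal_extrema hF hA hne
  refine ⟨ν, ζ, hν, hζ, fun z hz => ?_⟩
  set Ψ : ℂ → ℂ := fun z => ν * H z + (starRingEnd ℂ) ν * G z with hΨ
  have hΨd : DifferentiableOn ℂ Ψ (ball 0 1) := (hH.const_mul _).add (hG.const_mul _)
  have hΨu : ∀ z ∈ ball (0 : ℂ) 1, (Ψ z).re = (ν * F z).re := by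
    intro z hz
    rw [hFHG z hz]
    simp [hΨ]
    ring
  have hmono : ∀ t ∈ Ioo (0 : ℝ) 1, ∀ z ∈ ball (0 : ℂ) 1, (Ψ z).re ≤ (Ψ (diskFlow ζ t z)).re := by
    intro t ht z hz
    have ht' : |t| < 1 := by rw [abs_of_pos ht.1]; exact ht.2
    have hmaps : MapsTo (diskFlow ζ t) (ball 0 1) (ball 0 1) := fun w hw =>
      mem_ball_zero_iff.2 (norm_diskFlow_lt_one hζ (mem_ball_zero_iff.1 hw) ht')
    rw [hΨu z hz, hΨu _ (hmaps hz), ← sub_nonneg]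
    refine nonneg_of_nonneg_sphere (v := fun z => (ν * F (diskFlow ζ t z)).re - (ν * F z).re)
      (HarmonicContOnCl.mk_ball ?_ ?_) ?_ hz
    · have hd : DifferentiableOn ℂ (fun z => Ψ (diskFlow ζ t z) - Ψ z) (ball 0 1) :=
        (hΨd.comp (fun w hw => (differentiableAt_diskFlow hζ (mem_ball_zero_iff.1 hw).le
          ht').differentiableWithinAt) hmaps).sub hΨd
      intro w hw
      refine (harmonicAt_congr_nhds ?_).1 (hd.analyticAt (isOpen_ball.mem_nhds hw)).harmonicAt_re
      filter_upwards [isOpen_ball.mem_nhds hw] with x hx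
      rw [sub_re, hΨu x hx, hΨu _ (hmaps hx)]
    · have hc : ContinuousOn (diskFlow ζ t) (closedBall 0 1) := fun w hw =>
        (differentiableAt_diskFlow hζ (mem_closedBall_zero_iff.1 hw) ht').continuousAt.continuousWithinAt
      have h1 : Continuous fun z => (ν * F z).re := by fun_prop
      exact (h1.comp_continuousOn hc).sub h1.continuousOn
    · intro p hp
      exact sub_nonneg.2 ((hA ν hν).le_diskFlow hζ hext ht.1 ht.2 hp)
  have hder : HasDerivAt (fun t : ℝ => (Ψ (diskFlow ζ t z)).re)
      ((ν * deriv H z + (starRingEnd ℂ) ν * deriv G z) * (ζ - (starRingEnd ℂ) ζ * z ^ 2)).re 0 := by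
    have h1 : HasDerivAt Ψ (ν * deriv H z + (starRingEnd ℂ) ν * deriv G z) (diskFlow ζ 0 z) := by
      rw [diskFlow_zero hζ]
      exact ((hH.differentiableAt (isOpen_ball.mem_nhds hz)).hasDerivAt.const_mul _).add
        ((hG.differentiableAt (isOpen_ball.mem_nhds hz)).hasDerivAt.const_mul _)
    have h2 := h1.scomp (0 : ℝ) (hasDerivAt_diskFlow_time hζ z)
    have h3 := Complex.reCLM.hasFDerivAt.comp_hasDerivAt (0 : ℝ) h2
    refine h3.congr_deriv ?_
    simp only [smul_eq_mul, reCLM_apply]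
    rw [mul_comm]
  have hlim := hder.tendsto_slope_zero_right
  refine ge_of_tendsto hlim ?_
  filter_upwards [Ioo_mem_nhdsGT (zero_lt_one' ℝ)] with t ht
  rw [zero_add, diskFlow_zero hζ, smul_eq_mul]
  exact mul_nonneg (inv_nonneg.2 ht.1.le) (sub_nonneg.2 (hmono t ht z hz))

/-! ### The length-area principle and boundary limits. -/

-- The area formula: as a real linear map, multiplication by k' has determinant |k'|².
open MeasureTheory in
theorem lintegral_sq_enorm_deriv_eq {k : ℂ → ℂ} {B : Set ℂ} (hB : IsOpen B)
    (hk : DifferentiableOn ℂ k B) (hinj : InjOn k B) :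
    ∫⁻ z in B, ‖deriv k z‖ₑ ^ 2 = volume (k '' B) := by
  have := lintegral_image_eq_lintegral_abs_det_fderiv_mul volume hB.measurableSet
    (f' := fun z => ((ContinuousLinearMap.toSpanSingleton ℂ (deriv k z)).restrictScalars ℝ))
    (fun z hz => ((hk.differentiableAt (hB.mem_nhds hz)).hasDerivAt.hasFDerivAt.restrictScalars ℝ).hasFDerivWithinAt)
    hinj (fun _ => 1)
  rw [lintegral_one, Measure.restrict_apply_univ] at this
  rw [this]
  refine setLIntegral_congr_fun hB.measurableSet fun z _ => ?_
  simp only [mul_one]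
  have : ((ContinuousLinearMap.toSpanSingleton ℂ (deriv k z)).restrictScalars ℝ).det = ‖deriv k z‖ ^ 2 := by
    simp [ContinuousLinearMap.det, LinearMap.det_restrictScalars, Algebra.norm_complex_eq,
      normSq_eq_norm_sq]
  rw [this, abs_of_nonneg (by positivity), ENNReal.ofReal_pow (norm_nonneg _), ofReal_norm]

/-- Stands in for the Cauchy–Schwarz inequality in the length-area estimate, with `s` tuned to the
radius. -/
theorem two_mul_le_enorm_sq_add (s : ℝ) (hs : 0 ≤ s) (x : ℂ) :
    ENNReal.ofReal (2 * s) * ‖x‖ₑ ≤ ‖x‖ₑ ^ 2 + ENNReal.ofReal (s ^ 2) := by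
  rw [← ofReal_norm, ← ENNReal.ofReal_mul (by positivity), ← ENNReal.ofReal_pow (norm_nonneg _),
    ← ENNReal.ofReal_add (by positivity) (by positivity)]
  exact ENNReal.ofReal_le_ofReal (by nlinarith [sq_nonneg (‖x‖ - s)])

open MeasureTheory in
theorem lintegral_ofReal_mul_inv_eq_top {c : ℝ} (hc : 0 < c) :
    ∫⁻ r in Ioo (0 : ℝ) (1 / 2), ENNReal.ofReal (c * r⁻¹) = ⊤ := by
  by_contra hne
  have h1 : IntegrableOn (fun r : ℝ => c * r⁻¹) (Ioo 0 (1 / 2)) := by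
    refine ⟨by fun_prop, ?_⟩
    rw [HasFiniteIntegral]
    refine lt_of_le_of_lt (le_of_eq ?_) (lt_top_iff_ne_top.2 hne)
    refine setLIntegral_congr_fun measurableSet_Ioo fun r hr => ?_
    have : 0 ≤ c * r⁻¹ := mul_nonneg hc.le (inv_nonneg.2 hr.1.le)
    exact Real.enorm_of_nonneg this
  have h2 : IntegrableOn (fun r : ℝ => r⁻¹) (Ioo 0 (1 / 2)) := by
    have := h1.const_mul c⁻¹
    refine this.congr (Eventually.of_forall fun r => ?_)
    simp only
    rw [← mul_assoc, inv_mul_cancel₀ hc.ne', one_mul]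
  have h3 : IntervalIntegrable (fun r : ℝ => r⁻¹) volume 0 (1 / 2) :=
    (intervalIntegrable_iff_integrableOn_Ioo_of_le (by norm_num)).2 h2
  rw [intervalIntegrable_inv_iff] at h3
  norm_num at h3

open MeasureTheory in
/-- The length-area principle for circular arcs around the origin. -/
theorem exists_lintegral_arc_le {k : ℂ → ℂ} {B : Set ℂ} (hB : IsOpen B)
    (hk : DifferentiableOn ℂ k B) (hinj : InjOn k B) (hvol : volume (k '' B) ≠ ⊤) {ε : ℝ} (hε : 0 < ε) :
    ∃ ρ ∈ Ioo (0 : ℝ) (1 / 2), ∫⁻ θ in Ioo (-Real.pi) Real.pi,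
      ENNReal.ofReal ρ * ‖B.indicator (deriv k) (Complex.polarCoord.symm (ρ, θ))‖ₑ ≤ ENNReal.ofReal ε := by
  by_contra! hcon
  set a : ℂ → ℂ := B.indicator (deriv k) with ha
  have ham : Measurable a := (measurable_deriv k).indicator hB.measurableSet
  have hpm : Measurable fun p : ℝ × ℝ => Complex.polarCoord.symm p := by
    simp only [Complex.polarCoord_symm_apply]
    fun_prop
  have hπ := Real.pi_pos
  have key : ∀ ρ ∈ Ioo (0 : ℝ) (1 / 2), ENNReal.ofReal (ε ^ 2 / (2 * Real.pi) * ρ⁻¹) ≤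
      ∫⁻ θ in Ioo (-Real.pi) Real.pi, ENNReal.ofReal ρ * ‖a (Complex.polarCoord.symm (ρ, θ))‖ₑ ^ 2 := by
    intro ρ hρ
    have hρ0 := hρ.1
    set A : ℝ → ℂ := fun θ => a (Complex.polarCoord.symm (ρ, θ)) with hA
    have hAm : Measurable A := ham.comp (hpm.comp (by fun_prop))
    -- The mean of |k'| over the full circle of radius ρ when the image length is exactly ε. With
    -- this value the inequality 2s|x| ≤ |x|² + s² gives the optimal lower bound ε²/(2πρ).
    set s : ℝ := ε / (2 * Real.pi * ρ) with hs
    have hs0 : 0 < s := by positivity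
    have h1 : ∫⁻ θ in Ioo (-Real.pi) Real.pi, ENNReal.ofReal (2 * s) * ‖A θ‖ₑ ≤
        ∫⁻ θ in Ioo (-Real.pi) Real.pi, (‖A θ‖ₑ ^ 2 + ENNReal.ofReal (s ^ 2)) :=
      lintegral_mono fun θ => two_mul_le_enorm_sq_add s hs0.le _
    rw [lintegral_add_right _ measurable_const, lintegral_const, Measure.restrict_apply_univ,
      Real.volume_Ioo, lintegral_const_mul _ hAm.enorm, ← ENNReal.ofReal_mul (by positivity)] at h1
    have h2 := (hcon ρ hρ).le
    rw [lintegral_const_mul _ hAm.enorm] at h2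
    have h3 : ENNReal.ofReal (ε / ρ) ≤ ∫⁻ θ in Ioo (-Real.pi) Real.pi, ‖A θ‖ₑ := by
      rw [ENNReal.ofReal_div_of_pos hρ0]
      exact ENNReal.div_le_of_le_mul' h2
    set x : ℝ := ε ^ 2 / (2 * Real.pi * ρ ^ 2) with hx
    have h4 : ENNReal.ofReal x + ENNReal.ofReal x ≤
        (∫⁻ θ in Ioo (-Real.pi) Real.pi, ‖A θ‖ₑ ^ 2) + ENNReal.ofReal x := by
      calc ENNReal.ofReal x + ENNReal.ofReal x = ENNReal.ofReal (2 * s) * ENNReal.ofReal (ε / ρ) := by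
            rw [← ENNReal.ofReal_add (by positivity) (by positivity), ← ENNReal.ofReal_mul (by positivity)]
            congr 1
            rw [hx, hs]
            field_simp
            ring
        _ ≤ ENNReal.ofReal (2 * s) * ∫⁻ θ in Ioo (-Real.pi) Real.pi, ‖A θ‖ₑ := by gcongr
        _ ≤ _ := h1
        _ = _ := by
            congr 2
            rw [hx, hs]
            field_simp
            ring
    have h5 := (ENNReal.add_le_add_iff_right ENNReal.ofReal_ne_top).1 h4
    rw [lintegral_const_mul _ (hAm.enorm.pow_const 2)]
    calc _ = ENNReal.ofReal ρ * ENNReal.ofReal x := by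
          rw [← ENNReal.ofReal_mul hρ0.le]
          congr 1
          rw [hx]
          field_simp
      _ ≤ _ := by gcongr
  have hfin : ∫⁻ p in Complex.polarCoord.target,
      ENNReal.ofReal p.1 * ‖a (Complex.polarCoord.symm p)‖ₑ ^ 2 = volume (k '' B) := by
    have := Complex.lintegral_comp_polarCoord_symm fun z => ‖a z‖ₑ ^ 2
    simp only [smul_eq_mul] at this
    rw [Complex.polarCoord_target, ← polarCoord_target, this, ← lintegral_sq_enorm_deriv_eq hB hk hinj,
      ← lintegral_indicator hB.measurableSet]
    congr 1
    ext z
    by_cases hz : z ∈ B <;> simp [ha, hz]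
  have hprod : ∫⁻ r in Ioi (0 : ℝ), ∫⁻ θ in Ioo (-Real.pi) Real.pi,
      ENNReal.ofReal r * ‖a (Complex.polarCoord.symm (r, θ))‖ₑ ^ 2 = volume (k '' B) := by
    rw [← hfin, Complex.polarCoord_target, Measure.volume_eq_prod, ← Measure.prod_restrict,
      lintegral_prod]
    exact ((measurable_fst.ennreal_ofReal).mul ((ham.comp hpm).enorm.pow_const 2)).aemeasurable
  -- If every arc had image longer than ε, the area would dominate the divergent integral of
  -- ε²/(2πρ) near ρ = 0.
  refine hvol (top_le_iff.1 ?_)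
  rw [← hprod, ← lintegral_ofReal_mul_inv_eq_top (c := ε ^ 2 / (2 * Real.pi)) (by positivity)]
  calc _ ≤ ∫⁻ r in Ioo (0 : ℝ) (1 / 2), ∫⁻ θ in Ioo (-Real.pi) Real.pi,
        ENNReal.ofReal r * ‖a (Complex.polarCoord.symm (r, θ))‖ₑ ^ 2 :=
      setLIntegral_mono' measurableSet_Ioo key
    _ ≤ _ := lintegral_mono_set Ioo_subset_Ioi_self

/-- Shows that a circle around 0 meets the disk |z - 1| < 1 in a single arc, symmetric about angle
0. -/
theorem norm_polar_sub_one_lt_iff {ρ θ : ℝ} (hρ : 0 < ρ) :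
    Complex.polarCoord.symm (ρ, θ) ∈ ball (1 : ℂ) 1 ↔ ρ / 2 < Real.cos θ := by
  rw [mem_ball, dist_eq_norm, ← abs_of_nonneg (norm_nonneg _), ← sq_lt_one_iff_abs_lt_one,
    ← normSq_eq_norm_sq, normSq_apply, Complex.polarCoord_symm_apply]
  have h := Real.sin_sq_add_cos_sq θ
  have e : (((ρ : ℂ) * (Real.cos θ + Real.sin θ * I) - 1).re * ((ρ : ℂ) * (Real.cos θ + Real.sin θ * I) - 1).re
      + ((ρ : ℂ) * (Real.cos θ + Real.sin θ * I) - 1).im * ((ρ : ℂ) * (Real.cos θ + Real.sin θ * I) - 1).im)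
      = ρ ^ 2 - 2 * ρ * Real.cos θ + 1 := by
    simp only [sub_re, mul_re, ofReal_re, add_re, I_re, mul_zero, ofReal_im, I_im, mul_one, sub_im,
      mul_im, add_im, one_re, one_im]
    linear_combination ρ ^ 2 * h
  simp only at e ⊢
  rw [e]
  constructor <;> intro h' <;> nlinarith

open MeasureTheory in
/-- Oscillation along a circular arc around the origin is bounded by the length. -/
theorem norm_sub_le_of_lintegral_arc_le {k H : ℂ → ℂ} {C ε ρ : ℝ} (hC : 0 ≤ C) (hε : 0 ≤ ε)
    (hρ : ρ ∈ Ioo (0 : ℝ) (1 / 2)) (hH : DifferentiableOn ℂ H (ball 1 1))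
    (hHk : ∀ z ∈ ball (1 : ℂ) 1, ‖deriv H z‖ ≤ C * ‖deriv k z‖)
    (hint : ∫⁻ θ in Ioo (-Real.pi) Real.pi, ENNReal.ofReal ρ *
      ‖(ball (1 : ℂ) 1).indicator (deriv k) (Complex.polarCoord.symm (ρ, θ))‖ₑ ≤ ENNReal.ofReal ε)
    {z₁ z₂ : ℂ} (h₁ : z₁ ∈ ball (1 : ℂ) 1) (h₂ : z₂ ∈ ball (1 : ℂ) 1) (n₁ : ‖z₁‖ = ρ) (n₂ : ‖z₂‖ = ρ) :
    ‖H z₁ - H z₂‖ ≤ C * ε := by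
  wlog hle : arg z₂ ≤ arg z₁ generalizing z₁ z₂
  · rw [norm_sub_rev]
    exact this h₂ h₁ n₂ n₁ (le_of_not_ge hle)
  have hpol : ∀ z : ℂ, ‖z‖ = ρ → z = Complex.polarCoord.symm (ρ, arg z) := by
    intro z hz
    rw [Complex.polarCoord_symm_apply, ← hz]
    exact (norm_mul_cos_add_sin_mul_I z).symm.trans (by simp)
  set P : ℝ → ℂ := fun θ => Complex.polarCoord.symm (ρ, θ) with hP
  have hP' : ∀ θ, P θ = ρ * exp (θ * I) := by
    intro θ; simp only [hP, Complex.polarCoord_symm_apply, exp_mul_I, ofReal_cos, ofReal_sin]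
  have hd : ∀ θ, HasDerivAt P (P θ * I) θ := by
    intro θ
    have h0 : HasDerivAt (fun t : ℝ => (t : ℂ) * I) (1 * I) θ := Complex.ofRealCLM.hasDerivAt.mul_const I
    have := h0.cexp.const_mul (ρ : ℂ)
    have e : P = fun θ : ℝ => (ρ : ℂ) * exp (θ * I) := funext hP'
    rw [e]
    refine this.congr_deriv ?_
    ring
  have hc1 : ρ / 2 < Real.cos (arg z₁) := by
    rw [← norm_polar_sub_one_lt_iff hρ.1, ← hpol z₁ n₁]; exact h₁
  have hc2 : ρ / 2 < Real.cos (arg z₂) := by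
    rw [← norm_polar_sub_one_lt_iff hρ.1, ← hpol z₂ n₂]; exact h₂
  -- Monotonicity of cosine away from 0: on the arc, cos θ is at least the cosine at the endpoint on
  -- the same side of 0.
  have hmem : ∀ θ ∈ Icc (arg z₂) (arg z₁), P θ ∈ ball (1 : ℂ) 1 := by
    intro θ hθ
    rw [norm_polar_sub_one_lt_iff hρ.1]
    rcases le_total 0 θ with h | h
    · exact hc1.trans_le (Real.cos_le_cos_of_nonneg_of_le_pi h (arg_le_pi _) hθ.2)
    · rw [← Real.cos_neg θ]
      rw [← Real.cos_neg] at hc2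
      exact hc2.trans_le (Real.cos_le_cos_of_nonneg_of_le_pi (by linarith)
        (by linarith [neg_pi_lt_arg z₂]) (by linarith [hθ.1]))
  have hPn : ∀ θ, ‖P θ‖ = ρ := by
    intro θ; rw [hP', norm_mul, norm_exp_ofReal_mul_I, mul_one, norm_real, Real.norm_of_nonneg hρ.1.le]
  have hHc : ContinuousOn (deriv H) (ball 1 1) :=
    (hH.analyticOnNhd isOpen_ball).deriv.continuousOn
  have hPc : Continuous P := continuous_iff_continuousAt.2 fun θ => (hd θ).continuousAt
  have hcont : ContinuousOn (fun θ => P θ * I * deriv H (P θ)) (uIcc (arg z₂) (arg z₁)) := by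
    rw [uIcc_of_le hle]
    exact (hPc.continuousOn.mul continuousOn_const).mul (hHc.comp hPc.continuousOn hmem)
  have hftc := intervalIntegral.integral_eq_sub_of_hasDerivAt (a := arg z₂) (b := arg z₁)
    (f := fun θ => H (P θ)) (f' := fun θ => P θ * I * deriv H (P θ))
    (fun θ hθ => by
      rw [uIcc_of_le hle] at hθ
      have h1 := (hH.differentiableAt (isOpen_ball.mem_nhds (hmem θ hθ))).hasDerivAt
      exact h1.scomp θ (hd θ)) hcont.intervalIntegrable
  rw [show P (arg z₁) = z₁ from (hpol z₁ n₁).symm, show P (arg z₂) = z₂ from (hpol z₂ n₂).symm,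
    intervalIntegral.integral_of_le hle] at hftc
  rw [← hftc]
  have hle2 : ‖∫ θ in Ioc (arg z₂) (arg z₁), P θ * I * deriv H (P θ)‖ₑ ≤ ENNReal.ofReal (C * ε) := by
    calc _ ≤ ∫⁻ θ in Ioc (arg z₂) (arg z₁), ‖P θ * I * deriv H (P θ)‖ₑ := enorm_integral_le_lintegral_enorm _
      _ ≤ ∫⁻ θ in Ioc (arg z₂) (arg z₁), ENNReal.ofReal C * (ENNReal.ofReal ρ *
          ‖(ball (1 : ℂ) 1).indicator (deriv k) (P θ)‖ₑ) := by
        refine setLIntegral_mono' measurableSet_Ioc fun θ hθ => ?_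
        have hm := hmem θ (Ioc_subset_Icc_self hθ)
        rw [indicator_of_mem hm, ← ofReal_norm, ← ofReal_norm, ← ENNReal.ofReal_mul hρ.1.le,
          ← ENNReal.ofReal_mul hC]
        refine ENNReal.ofReal_le_ofReal ?_
        rw [norm_mul, norm_mul, norm_I, mul_one, hPn]
        nlinarith [hHk _ hm, hρ.1]
      _ = ENNReal.ofReal C * ∫⁻ θ in Ioc (arg z₂) (arg z₁), (ENNReal.ofReal ρ *
          ‖(ball (1 : ℂ) 1).indicator (deriv k) (P θ)‖ₑ) :=
        lintegral_const_mul' _ _ ENNReal.ofReal_ne_top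
      _ ≤ ENNReal.ofReal C * ∫⁻ θ in Ioo (-Real.pi) Real.pi, (ENNReal.ofReal ρ *
          ‖(ball (1 : ℂ) 1).indicator (deriv k) (P θ)‖ₑ) := by
        gcongr
        intro θ hθ
        refine ⟨(neg_pi_lt_arg z₂).trans hθ.1, hθ.2.trans_lt (lt_of_le_of_ne (arg_le_pi _) fun h => ?_)⟩
        rw [h, Real.cos_pi] at hc1
        linarith [hρ.1]
      _ ≤ ENNReal.ofReal C * ENNReal.ofReal ε := by gcongr
      _ = _ := (ENNReal.ofReal_mul hC).symm
  rw [← ofReal_norm] at hle2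
  exact (ENNReal.ofReal_le_ofReal_iff (by positivity)).1 hle2

/-- The substitution z = ζ(1 - w) moves the boundary point ζ to the origin, where polar coordinates
apply. -/
theorem one_sub_mul_mem_ball_iff {ζ : ℂ} (hζ : ‖ζ‖ = 1) {w : ℂ} :
    ζ * (1 - w) ∈ ball (0 : ℂ) 1 ↔ w ∈ ball (1 : ℂ) 1 := by
  rw [mem_ball_zero_iff, norm_mul, hζ, one_mul, mem_ball', dist_eq_norm]

theorem hasDerivAt_comp_one_sub_mul {ζ : ℂ} (hζ : ‖ζ‖ = 1) {H : ℂ → ℂ}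
    (hH : DifferentiableOn ℂ H (ball 0 1)) {w : ℂ} (hw : w ∈ ball (1 : ℂ) 1) :
    HasDerivAt (fun w => H (ζ * (1 - w))) (deriv H (ζ * (1 - w)) * (ζ * -1)) w := by
  have h1 : HasDerivAt (fun w => ζ * (1 - w)) (ζ * -1) w := ((hasDerivAt_id w).const_sub 1).const_mul ζ
  exact (hH.differentiableAt (isOpen_ball.mem_nhds ((one_sub_mul_mem_ball_iff hζ).2 hw))).hasDerivAt.comp w h1

/-- The radius depends on φ alone, not on H, so one arc serves the analytic and the co-analytic part
at once. -/
theorem exists_small_oscillation {φ : ℂ → ℂ} (hφ : DifferentiableOn ℂ φ (ball 0 1))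
    (hinj : InjOn φ (ball 0 1)) (hφb : MapsTo φ (ball 0 1) (ball 0 1)) {C : ℝ} (hC : 0 ≤ C)
    {ζ : ℂ} (hζ : ‖ζ‖ = 1) {ε : ℝ} (hε : 0 < ε) :
    ∃ ρ ∈ Ioo (0 : ℝ) (1 / 2), ∀ H : ℂ → ℂ, DifferentiableOn ℂ H (ball 0 1) →
      (∀ z ∈ ball (0 : ℂ) 1, ‖deriv H z‖ ≤ C * ‖deriv φ z‖) →
      ∀ z₁ ∈ ball (0 : ℂ) 1, ∀ z₂ ∈ ball (0 : ℂ) 1, dist z₁ ζ = ρ → dist z₂ ζ = ρ →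
        ‖H z₁ - H z₂‖ ≤ C * ε := by
  have hζ0 : ζ ≠ 0 := fun h => by simp [h] at hζ
  have hζ1 : ζ * -1 ≠ 0 := mul_ne_zero hζ0 (by norm_num)
  obtain ⟨ρ, hρ, hint⟩ := exists_lintegral_arc_le (k := fun w => φ (ζ * (1 - w))) isOpen_ball
    (fun w hw => (hasDerivAt_comp_one_sub_mul hζ hφ hw).differentiableAt.differentiableWithinAt)
    (fun x hx y hy h => by
      have := hinj ((one_sub_mul_mem_ball_iff hζ).2 hx) ((one_sub_mul_mem_ball_iff hζ).2 hy) h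
      have := mul_left_cancel₀ hζ0 this
      linear_combination -this)
    (ne_of_lt (lt_of_le_of_lt (MeasureTheory.measure_mono (t := ball (0 : ℂ) 1) (by
      rintro _ ⟨w, hw, rfl⟩
      exact hφb ((one_sub_mul_mem_ball_iff hζ).2 hw))) MeasureTheory.measure_ball_lt_top)) hε
  refine ⟨ρ, hρ, fun H hH hHφ z₁ hz₁ z₂ hz₂ d₁ d₂ => ?_⟩
  have hback : ∀ z : ℂ, ζ * (1 - (1 - z / ζ)) = z := fun z => by field_simp; ring
  have hmem : ∀ z ∈ ball (0 : ℂ) 1, 1 - z / ζ ∈ ball (1 : ℂ) 1 := fun z hz => by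
    rw [← one_sub_mul_mem_ball_iff hζ, hback]; exact hz
  have hnorm : ∀ z : ℂ, ‖1 - z / ζ‖ = dist z ζ := fun z => by
    have : ‖ζ * (1 - z / ζ)‖ = ‖1 - z / ζ‖ := by rw [norm_mul, hζ, one_mul]
    rw [← this, dist_eq_norm, norm_sub_rev]
    congr 1
    field_simp
  have := norm_sub_le_of_lintegral_arc_le (H := fun w => H (ζ * (1 - w))) hC hε.le hρ
    (fun w hw => (hasDerivAt_comp_one_sub_mul hζ hH hw).differentiableAt.differentiableWithinAt)
    (fun w hw => by
      rw [(hasDerivAt_comp_one_sub_mul hζ hH hw).deriv, (hasDerivAt_comp_one_sub_mul hζ hφ hw).deriv,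
        norm_mul, norm_mul (deriv φ _), ← mul_assoc]
      exact mul_le_mul_of_nonneg_right (hHφ _ ((one_sub_mul_mem_ball_iff hζ).2 hw)) (norm_nonneg (ζ * -1)))
    hint (hmem z₁ hz₁) (hmem z₂ hz₂) ((hnorm z₁).trans d₁) ((hnorm z₂).trans d₂)
  simpa only [hback] using this

/-- If all segments from `w` to points near `0` come close to `p`, then `w` is close to `p`. -/
theorem norm_sub_le_of_segments {w p : ℂ} {η d B : ℝ} (hη : 0 ≤ η) (hd : 0 < d) (hw : ‖w‖ ≤ B)
    (h : ∀ q ∈ ball (0 : ℂ) d, ∃ t ∈ Icc (0 : ℝ) 1, ‖w + t * (q - w) - p‖ ≤ η) :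
    ‖w - p‖ ≤ η * (1 + 4 / d * (B + d)) := by
  have hB : 0 ≤ B := (norm_nonneg w).trans hw
  rcases eq_or_ne w 0 with rfl | hw0
  · obtain ⟨t, -, ht⟩ := h 0 (mem_ball_self hd)
    simp only [sub_zero, mul_zero, add_zero] at ht
    refine ht.trans ?_
    have : 0 ≤ η * (4 / d * (B + d)) := by positivity
    nlinarith
  have hwn : 0 < ‖w‖ := norm_pos_iff.2 hw0
  -- A target orthogonal to w. The point near p on the way to q and the one on the way to 0 are
  -- within 2η of each other, and their component along q is t₁ q. Hence t₁ ≤ 4η/d: the segment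
  -- comes near p close to its start w.
  set q : ℂ := ((d / 2 / ‖w‖ : ℝ) : ℂ) * (I * w) with hq
  have hqn : ‖q‖ = d / 2 := by
    rw [hq, norm_mul, norm_mul, norm_I, one_mul, norm_real, Real.norm_of_nonneg (by positivity)]
    field_simp
  obtain ⟨t₁, ht₁, e₁⟩ := h q (by rw [mem_ball_zero_iff, hqn]; linarith)
  obtain ⟨t₂, ht₂, e₂⟩ := h 0 (mem_ball_self hd)
  have hD : ‖((t₂ - t₁ : ℝ) : ℂ) * w + t₁ * q‖ ≤ 2 * η := by
    have : ((t₂ - t₁ : ℝ) : ℂ) * w + t₁ * q = (w + t₁ * (q - w) - p) - (w + t₂ * (0 - w) - p) := by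
      push_cast; ring
    rw [this]
    exact (norm_sub_le _ _).trans (by linarith)
  have hsq : ‖((t₂ - t₁ : ℝ) : ℂ) * w + t₁ * q‖ ^ 2 = (t₂ - t₁) ^ 2 * ‖w‖ ^ 2 + t₁ ^ 2 * ‖q‖ ^ 2 := by
    rw [hq]
    simp only [← Complex.normSq_eq_norm_sq, Complex.normSq_apply]
    simp only [add_re, mul_re, ofReal_re, ofReal_im, add_im, mul_im, I_re, I_im]
    ring
  have ht1 : t₁ * ‖q‖ ≤ 2 * η := by
    have h1 : (t₁ * ‖q‖) ^ 2 ≤ (2 * η) ^ 2 := by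
      calc (t₁ * ‖q‖) ^ 2 ≤ ‖((t₂ - t₁ : ℝ) : ℂ) * w + t₁ * q‖ ^ 2 := by
            rw [hsq]; nlinarith [mul_nonneg (sq_nonneg (t₂ - t₁)) (sq_nonneg ‖w‖)]
        _ ≤ _ := by gcongr
    exact le_of_sq_le_sq h1 (by positivity)
  have ht1' : t₁ ≤ 4 * η / d := by
    rw [le_div_iff₀ hd]
    rw [hqn] at ht1
    linarith
  have hqw : ‖q - w‖ ≤ B + d := (norm_sub_le _ _).trans (by rw [hqn]; linarith)
  calc ‖w - p‖ = ‖(w + t₁ * (q - w) - p) - t₁ * (q - w)‖ := by congr 1; ring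
    _ ≤ ‖w + t₁ * (q - w) - p‖ + ‖(t₁ : ℂ) * (q - w)‖ := norm_sub_le _ _
    _ ≤ η + 4 * η / d * (B + d) := by
        rw [norm_mul, norm_real, Real.norm_of_nonneg ht₁.1]
        gcongr
    _ = _ := by ring

/-- A harmonic homeomorphism of the disk onto a bounded convex domain whose derivative is controlled
by that of a bounded univalent function has limits at the boundary. -/
theorem exists_tendsto_boundary {F H G φ K : ℂ → ℂ} {Ω : Set ℂ} {C B : ℝ} (hC : 0 ≤ C)
    (hφ : DifferentiableOn ℂ φ (ball 0 1)) (hinj : InjOn φ (ball 0 1))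
    (hφb : MapsTo φ (ball 0 1) (ball 0 1))
    (hH : DifferentiableOn ℂ H (ball 0 1)) (hG : DifferentiableOn ℂ G (ball 0 1))
    (hHφ : ∀ z ∈ ball (0 : ℂ) 1, ‖deriv H z‖ ≤ C * ‖deriv φ z‖)
    (hGφ : ∀ z ∈ ball (0 : ℂ) 1, ‖deriv G z‖ ≤ C * ‖deriv φ z‖)
    (hF : ∀ z ∈ ball (0 : ℂ) 1, F z = H z + (starRingEnd ℂ) (G z))
    (hΩ : Convex ℝ Ω) (hΩo : IsOpen Ω) (h0 : (0 : ℂ) ∈ Ω) (hB : ∀ w ∈ Ω, ‖w‖ ≤ B)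
    (hFΩ : MapsTo F (ball 0 1) Ω) (hK : ContinuousOn K Ω) (hKm : MapsTo K Ω (ball 0 1))
    (hFK : ∀ w ∈ Ω, F (K w) = w) (hKF : ∀ z ∈ ball (0 : ℂ) 1, K (F z) = z) (hF0 : F 0 = 0)
    {ζ : ℂ} (hζ : ‖ζ‖ = 1) : ∃ y, Tendsto F (𝓝[ball 0 1] ζ) (𝓝 y) := by
  have hB0 : 0 ≤ B := (norm_nonneg _).trans (hB 0 h0)
  have hK0 : K 0 = 0 := by have := hKF 0 (mem_ball_self one_pos); rwa [hF0] at this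
  obtain ⟨d, hd, hdΩ, hdK⟩ : ∃ d > 0, ball (0 : ℂ) d ⊆ Ω ∧ ∀ q ∈ ball (0 : ℂ) d, ‖K q‖ < 1 / 2 := by
    have hc := hK.continuousAt (hΩo.mem_nhds h0)
    have hc' : ∀ᶠ q in 𝓝 (0 : ℂ), ‖K q‖ < 1 / 2 := by
      have := hc.norm.tendsto.eventually_lt_const (u := 1 / 2) (by rw [hK0]; norm_num)
      exact this
    obtain ⟨d, hd, h⟩ := Metric.mem_nhds_iff.1 (inter_mem (hΩo.mem_nhds h0) hc')
    exact ⟨d, hd, fun q hq => (h hq).1, fun q hq => (h hq).2⟩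
  have hcl : ζ ∈ closure (ball (0 : ℂ) 1) := by
    rw [closure_ball _ one_ne_zero, mem_closedBall_zero_iff, hζ]
  have : (𝓝[ball 0 1] ζ).NeBot := mem_closure_iff_nhdsWithin_neBot.1 hcl
  refine CompleteSpace.complete (f := map F (𝓝[ball 0 1] ζ)) (Metric.cauchy_iff.2 ⟨inferInstance, fun ε hε => ?_⟩)
  set A : ℝ := 1 + 4 / d * (B + d) with hA
  have hA1 : 1 ≤ A := by rw [hA, le_add_iff_nonneg_right]; positivity
  -- The tolerance makes η A < ε/2, where η is the oscillation of H and G together and A the factor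
  -- lost in `norm_sub_le_of_segments`; the 2C + 1 avoids division by zero.
  obtain ⟨ρ, hρ, hosc⟩ := exists_small_oscillation hφ hinj hφb hC hζ
    (ε := ε / (4 * A * (2 * C + 1))) (by positivity)
  set η : ℝ := 2 * (C * (ε / (4 * A * (2 * C + 1)))) with hη
  have hη0 : 0 ≤ η := by positivity
  have hηA : η * A < ε / 2 := by
    rw [hη]
    have : 2 * (C * (ε / (4 * A * (2 * C + 1)))) * A = (2 * C / (2 * C + 1)) * (ε / 4) := by
      field_simp
    rw [this]
    have h1 : 2 * C / (2 * C + 1) ≤ 1 := by rw [div_le_one (by positivity)]; linarith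
    nlinarith
  set p : ℂ := F (ζ * (1 - ρ)) with hp
  have harc : ∀ z₁ ∈ ball (0 : ℂ) 1, ∀ z₂ ∈ ball (0 : ℂ) 1, dist z₁ ζ = ρ → dist z₂ ζ = ρ →
      ‖F z₁ - F z₂‖ ≤ η := by
    intro z₁ h₁ z₂ h₂ d₁ d₂
    have e1 := hosc H hH hHφ z₁ h₁ z₂ h₂ d₁ d₂
    have e2 := hosc G hG hGφ z₁ h₁ z₂ h₂ d₁ d₂
    have : F z₁ - F z₂ = (H z₁ - H z₂) + (starRingEnd ℂ) (G z₁ - G z₂) := by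
      rw [hF _ h₁, hF _ h₂, map_sub]; ring
    rw [this]
    refine (norm_add_le _ _).trans ?_
    rw [RCLike.norm_conj]
    linarith
  have hpm : ζ * (1 - ρ) ∈ ball (0 : ℂ) 1 := by
    rw [mem_ball_zero_iff, norm_mul, hζ, one_mul, ← ofReal_one, ← ofReal_sub, norm_real,
      Real.norm_of_nonneg (by linarith [hρ.2])]
    linarith [hρ.1]
  have hpd : dist (ζ * (1 - ρ)) ζ = ρ := by
    have : ζ * (1 - ρ) - ζ = -(ζ * ρ) := by ring
    rw [dist_eq_norm, this, norm_neg, norm_mul, hζ, one_mul, norm_real, Real.norm_of_nonneg hρ.1.le]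
  -- Convexity enters here. The segment from F z to a point q near 0 stays in Ω, and K pulls it back
  -- to a path from z to K q, where |K q| < 1/2. Since ρ < 1/2, this path crosses the arc |· - ζ| =
  -- ρ, on which F is within η of p.
  have hclose : ∀ z ∈ ball (0 : ℂ) 1 ∩ ball ζ ρ, ‖F z - p‖ ≤ η * A := by
    rintro z ⟨hz, hzζ⟩
    refine norm_sub_le_of_segments hη0 hd (hB _ (hFΩ hz)) fun q hq => ?_
    have hseg : ∀ t ∈ Icc (0 : ℝ) 1, F z + t * (q - F z) ∈ Ω := by
      intro t ht
      have := hΩ.add_smul_sub_mem (hFΩ hz) (hdΩ hq) ht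
      rwa [real_smul] at this
    have hcont : ContinuousOn (fun t : ℝ => dist (K (F z + t * (q - F z))) ζ) (Icc 0 1) := by
      have : Continuous fun t : ℝ => F z + t * (q - F z) := by fun_prop
      exact continuous_dist.comp_continuousOn ((hK.comp this.continuousOn hseg).prodMk continuousOn_const)
    have hiv := intermediate_value_Icc zero_le_one hcont
    obtain ⟨t, ht, hte⟩ := hiv (show ρ ∈ Icc _ _ from ⟨by
      simp only [ofReal_zero, zero_mul, add_zero, hKF z hz]
      exact (mem_ball.1 hzζ).le, by
      simp only [ofReal_one, one_mul, add_sub_cancel]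
      have h1 := hdK q hq
      have h2 : ‖ζ‖ ≤ ‖K q‖ + dist (K q) ζ := by
        rw [dist_comm, dist_eq_norm]; exact norm_le_norm_add_norm_sub' ζ (K q)
      rw [hζ] at h2
      linarith [hρ.2]⟩)
    refine ⟨t, ht, ?_⟩
    have := harc _ (hKm (hseg t ht)) _ hpm hte hpd
    rwa [hFK _ (hseg t ht)] at this
  refine ⟨F '' (ball 0 1 ∩ ball ζ ρ), image_mem_map (inter_mem self_mem_nhdsWithin
    (mem_nhdsWithin_of_mem_nhds (ball_mem_nhds ζ hρ.1))), ?_⟩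
  rintro _ ⟨x, hx, rfl⟩ _ ⟨y, hy, rfl⟩
  have e1 := hclose x hx
  have e2 := hclose y hy
  rw [dist_eq_norm]
  calc ‖F x - F y‖ = ‖(F x - p) - (F y - p)‖ := by congr 1; ring
    _ ≤ ‖F x - p‖ + ‖F y - p‖ := norm_sub_le _ _
    _ < ε := by linarith

/-! ### The positivity condition for convex harmonic maps. -/

theorem isOpen_image_of_map_nhds_eq {X Y : Type*} [TopologicalSpace X] [TopologicalSpace Y]
    {f : X → Y} {D : Set X} (hD : IsOpen D) (hm : ∀ z ∈ D, map f (𝓝 z) = 𝓝 (f z)) :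
    IsOpen (f '' D) := by
  rw [isOpen_iff_mem_nhds]
  rintro _ ⟨z, hz, rfl⟩
  rw [← hm z hz]
  exact image_mem_map (hD.mem_nhds hz)

theorem continuousAt_leftInverse_of_map_nhds_eq {X Y : Type*} [TopologicalSpace X] [TopologicalSpace Y]
    {f : X → Y} {K : Y → X} {D : Set X} (hD : IsOpen D) (hm : ∀ z ∈ D, map f (𝓝 z) = 𝓝 (f z))
    (hKf : ∀ z ∈ D, K (f z) = z) {z : X} (hz : z ∈ D) : ContinuousAt K (f z) := by
  rw [ContinuousAt, ← hm z hz, tendsto_map'_iff, hKf z hz]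
  exact tendsto_id.congr' (Filter.eventually_of_mem (hD.mem_nhds hz) fun x hx => (hKf x hx).symm)

/-- A vector v in the kernel of the real differential satisfies |v h'| = |v g'|, so |g'| < |h'|
forces v = 0 and the inverse function theorem applies. -/
theorem map_nhds_eq_of_norm_deriv_lt {h g : ℂ → ℂ} {z : ℂ} (hh : AnalyticAt ℂ h z)
    (hg : AnalyticAt ℂ g z) (hlt : ‖deriv g z‖ < ‖deriv h z‖) :
    map (fun z => h z + (starRingEnd ℂ) (g z)) (𝓝 z) = 𝓝 (h z + (starRingEnd ℂ) (g z)) := by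
  have h1 := hh.hasStrictDerivAt.hasStrictFDerivAt.restrictScalars ℝ
  have h2 := hg.hasStrictDerivAt.hasStrictFDerivAt.restrictScalars ℝ
  have h3 := h1.add ((conjCLE : ℂ →L[ℝ] ℂ).hasStrictFDerivAt.comp z h2)
  refine h3.map_nhds_eq_of_surj (LinearMap.range_eq_top.2 ?_)
  refine LinearMap.surjective_of_injective ?_
  rw [← LinearMap.ker_eq_bot, LinearMap.ker_eq_bot']
  intro v hv
  have hv' : v * deriv h z + (starRingEnd ℂ) (v * deriv g z) = 0 := by simpa using hv
  by_contra hv0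
  have : ‖v * deriv h z‖ = ‖v * deriv g z‖ := by
    rw [eq_neg_of_add_eq_zero_left hv', norm_neg, RCLike.norm_conj]
  rw [norm_mul, norm_mul] at this
  exact hlt.ne' (mul_left_cancel₀ (norm_ne_zero_iff.2 hv0) this)

/-- The inverse of a disk embedding onto the unit disk. -/
theorem IsDiscEmbedding.exists_inverse {U : Set ℂ} {E : ℂ → ℂ} (hU : IsOpen U) (h0 : (0 : ℂ) ∈ U)
    (hE : IsDiscEmbedding U E) (hs : E '' U = ball 0 1) :
    ∃ φ : ℂ → ℂ, DifferentiableOn ℂ φ (ball 0 1) ∧ MapsTo φ (ball 0 1) U ∧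
      (∀ w ∈ ball (0 : ℂ) 1, E (φ w) = w) ∧ (∀ z ∈ U, φ (E z) = z) ∧ φ 0 = 0 ∧
      deriv φ 0 = (deriv E 0)⁻¹ := by
  set φ := Function.invFunOn E U with hφ
  have hφE : ∀ z ∈ U, φ (E z) = z := fun z hz => hE.inj.leftInvOn_invFunOn hz
  have hsur : ∀ w ∈ ball (0 : ℂ) 1, ∃ z ∈ U, E z = w := fun w hw => by rwa [← hs] at hw
  have hmaps : MapsTo φ (ball 0 1) U := by
    intro w hw
    obtain ⟨z, hz, rfl⟩ := hsur w hw
    rwa [hφE z hz]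
  have hEφ : ∀ w ∈ ball (0 : ℂ) 1, E (φ w) = w := by
    intro w hw
    obtain ⟨z, hz, rfl⟩ := hsur w hw
    rw [hφE z hz]
  have hder : ∀ z ∈ U, HasStrictDerivAt E (deriv E z) z := fun z hz =>
    (hE.diff.analyticAt (hU.mem_nhds hz)).hasStrictDerivAt
  have hd : ∀ z ∈ U, HasDerivAt φ (deriv E z)⁻¹ (E z) := by
    intro z hz
    have hc : ContinuousAt φ (E z) := continuousAt_leftInverse_of_map_nhds_eq hU
      (fun z hz => (hder z hz).map_nhds_eq (hE.deriv_ne z hz)) hφE hz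
    refine HasDerivAt.of_local_left_inverse hc ?_ (hE.deriv_ne z hz)
      (Filter.eventually_of_mem (isOpen_ball.mem_nhds (hE.mapsTo hz)) hEφ)
    rw [hφE z hz]
    exact (hder z hz).hasDerivAt
  refine ⟨φ, fun w hw => ?_, hmaps, hEφ, hφE, ?_, ?_⟩
  · obtain ⟨z, hz, rfl⟩ := hsur w hw
    exact (hd z hz).differentiableAt.differentiableWithinAt
  · conv_lhs => rw [← hE.map_zero]
    exact hφE 0 h0
  · have := hd 0 h0
    rw [hE.map_zero] at this
    exact this.deriv

theorem isSimplyConnected_of_convex_image {U Ω : Set ℂ} {f K : ℂ → ℂ} (hΩ : Convex ℝ Ω)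
    (hne : Ω.Nonempty) (hf : ContinuousOn f U) (hK : ContinuousOn K Ω) (hfm : MapsTo f U Ω)
    (hKm : MapsTo K Ω U) (hKf : ∀ z ∈ U, K (f z) = z) (hfK : ∀ w ∈ Ω, f (K w) = w) :
    IsSimplyConnected U := by
  have : ContractibleSpace Ω := hΩ.contractibleSpace hne
  have : SimplyConnectedSpace Ω := SimplyConnectedSpace.ofContractible _
  let e : U ≃ₜ Ω :=
    { toFun := hfm.restrict f U Ω
      invFun := hKm.restrict K Ω U
      left_inv := fun z => Subtype.ext (hKf z z.2)
      right_inv := fun w => Subtype.ext (hfK w w.2)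
      continuous_toFun := hf.mapsToRestrict hfm
      continuous_invFun := hK.mapsToRestrict hKm }
  exact e.toHomotopyEquiv.simplyConnectedSpace

/-- The positivity condition, for a harmonic homeomorphism of the disk onto a bounded convex domain
which extends continuously to the closed disk. -/
theorem exists_re_mul_nonneg_of_boundary_limits {F H G K : ℂ → ℂ} {Ω : Set ℂ}
    (hH : DifferentiableOn ℂ H (ball 0 1)) (hG : DifferentiableOn ℂ G (ball 0 1))
    (hF : ∀ z ∈ ball (0 : ℂ) 1, F z = H z + (starRingEnd ℂ) (G z))
    (hΩ : Convex ℝ Ω) (hΩo : IsOpen Ω) (h0 : (0 : ℂ) ∈ Ω)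
    (hFΩ : MapsTo F (ball 0 1) Ω) (hK : ContinuousOn K Ω) (hKm : MapsTo K Ω (ball 0 1))
    (hFK : ∀ w ∈ Ω, F (K w) = w) (hKF : ∀ z ∈ ball (0 : ℂ) 1, K (F z) = z)
    (hlim : ∀ ζ : ℂ, ‖ζ‖ = 1 → ∃ y, Tendsto F (𝓝[ball 0 1] ζ) (𝓝 y)) :
    ∃ ν ζ : ℂ, ‖ν‖ = 1 ∧ ‖ζ‖ = 1 ∧ ∀ z ∈ ball (0 : ℂ) 1,
      0 ≤ ((ν * deriv H z + (starRingEnd ℂ) ν * deriv G z) * (ζ - (starRingEnd ℂ) ζ * z ^ 2)).re := by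
  have hFc : ContinuousOn F (ball 0 1) :=
    (hH.continuousOn.add (continuous_conj.comp_continuousOn hG.continuousOn)).congr hF
  obtain ⟨F', hF'⟩ : ∃ F' : C(ℂ, ℂ), ∀ z ∈ ball (0 : ℂ) 1, F' z = F z := by
    -- Boundary limits extend F to the closed disk, and Tietze extends it to the plane, so that the
    -- circle lemmas can assume global continuity.
    have hc : ContinuousOn (extendFrom (ball 0 1) F) (closedBall 0 1) := by
      refine continuousOn_extendFrom (by rw [closure_ball _ one_ne_zero]) fun z hz => ?_
      rcases (mem_closedBall_zero_iff.1 hz).eq_or_lt with h | h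
      · exact hlim z h
      · exact ⟨F z, hFc z (mem_ball_zero_iff.2 h)⟩
    obtain ⟨F', hF'⟩ := ContinuousMap.exists_restrict_eq (isClosed_closedBall (x := (0 : ℂ)) (ε := 1))
      ⟨_, hc.domRestrict⟩
    refine ⟨F', fun z hz => ?_⟩
    have := congrArg (fun k => k ⟨z, ball_subset_closedBall hz⟩) hF'
    exact this.trans (extendFrom_extends hFc z hz)
  -- Convex pieces of Ω, here its intersections with half-planes, pull back under K to
  -- path-connected subsets of the disk.
  have hjoin : ∀ Q : Set ℂ, Convex ℝ Q → Q ⊆ Ω → ∀ S : Set ℂ, (∀ z ∈ ball (0 : ℂ) 1, z ∈ S ↔ F z ∈ Q) →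
      ∀ x ∈ ball (0 : ℂ) 1 ∩ S, ∀ y ∈ ball (0 : ℂ) 1 ∩ S, JoinedIn (ball (0 : ℂ) 1 ∩ S) x y := by
    intro Q hQ hQΩ S hS x hx y hy
    have hxQ := (hS x hx.1).1 hx.2
    have hyQ := (hS y hy.1).1 hy.2
    have := ((hQ.isPathConnected ⟨_, hxQ⟩).joinedIn _ hxQ _ hyQ).map_continuousOn (hK.mono hQΩ)
    rw [hKF x hx.1, hKF y hy.1] at this
    refine this.mono ?_
    rintro _ ⟨w, hw, rfl⟩
    have hm := hKm (hQΩ hw)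
    exact ⟨hm, (hS _ hm).2 (by rwa [hFK w (hQΩ hw)])⟩
  have hlin : ∀ ν : ℂ, IsLinearMap ℝ fun w : ℂ => (ν * w).re := fun ν =>
    ⟨fun x y => by simp; ring, fun c x => by simp; ring⟩
  have hu : ∀ ν : ℂ, Continuous fun z => (ν * F' z).re := fun ν => by fun_prop
  refine exists_re_mul_nonneg_of_noAlternation (F := F') F'.continuous hH hG
    (fun z hz => (hF' z hz).trans (hF z hz)) ?_ ?_
  · intro ν _
    refine noAlternation_of_joinedIn (hu ν) (fun c => ?_) fun c => ?_
    · refine hjoin (Ω ∩ {w | c < (ν * w).re}) (hΩ.inter (convex_halfSpace_gt (hlin ν) c))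
        inter_subset_left _ fun z hz => ?_
      simp only [mem_ofPred_eq, mem_inter_iff, hFΩ hz, true_and, hF' z hz]
    · refine hjoin (Ω ∩ {w | (ν * w).re < c}) (hΩ.inter (convex_halfSpace_lt (hlin ν) c))
        inter_subset_left _ fun z hz => ?_
      simp only [mem_ofPred_eq, mem_inter_iff, hFΩ hz, true_and, hF' z hz]
  · intro ν hν
    -- If Re(νF) were constant on the circle, it would be constant in the disk; but Ω contains both
    -- 0 and a small positive multiple of conj ν.
    by_contra! hcon
    have hconst : ∀ p : ℂ, ‖p‖ = 1 → (ν * F' p).re = (ν * F' 1).re := fun p hp =>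
      hcon p 1 hp norm_one
    have hharm : ∀ μ : ℂ, HarmonicContOnCl (fun z => (μ * F' z).re) (ball 0 1) := by
      intro μ
      refine HarmonicContOnCl.mk_ball ?_ (by fun_prop)
      have hd : DifferentiableOn ℂ (fun z => μ * H z + (starRingEnd ℂ) μ * G z) (ball 0 1) :=
        (hH.const_mul _).add (hG.const_mul _)
      intro w hw
      refine (harmonicAt_congr_nhds ?_).1 (hd.analyticAt (isOpen_ball.mem_nhds hw)).harmonicAt_re
      filter_upwards [isOpen_ball.mem_nhds hw] with x hx
      rw [hF' x hx, hF x hx]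
      simp
      ring
    have hall : ∀ z ∈ ball (0 : ℂ) 1, (ν * F z).re = (ν * F' 1).re := by
      intro z hz
      have e1 := nonneg_of_nonneg_sphere ((hharm ν).sub_const (ν * F' 1).re)
        (fun p hp => by simp only [Pi.sub_apply, hconst p hp, sub_self, le_refl]) hz
      have e2 := nonneg_of_nonneg_sphere ((hharm ν).const_sub (ν * F' 1).re)
        (fun p hp => by simp only [Pi.sub_apply, hconst p hp, sub_self, le_refl]) hz
      simp only [Pi.sub_apply, hF' z hz] at e1 e2
      linarith
    obtain ⟨d, hd, hdΩ⟩ := Metric.isOpen_iff.1 hΩo 0 h0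
    have hw : ((d / 2 : ℝ) : ℂ) * (starRingEnd ℂ) ν ∈ Ω := hdΩ (by
      rw [mem_ball_zero_iff, norm_mul, RCLike.norm_conj, hν, norm_real, Real.norm_of_nonneg (by linarith)]
      linarith)
    have e1 := hall _ (hKm hw)
    have e2 := hall _ (hKm h0)
    rw [hFK _ hw] at e1
    rw [hFK _ h0, ← e1, mul_left_comm, mul_conj, normSq_eq_norm_sq, hν] at e2
    simp at e2
    linarith

/-- A compact subset of an open convex set lies in the interior of a polygon inside that set. -/
theorem exists_finset_subset_interior_convexHull {S O : Set ℂ} (hS : IsCompact S) (hO : IsOpen O)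
    (hc : Convex ℝ O) (hSO : S ⊆ O) :
    ∃ t : Finset ℂ, S ⊆ interior (convexHull ℝ (t : Set ℂ)) ∧ convexHull ℝ (t : Set ℂ) ⊆ O := by
  classical
  have hpt : ∀ x ∈ S, ∃ t : Finset ℂ, x ∈ interior (convexHull ℝ (t : Set ℂ)) ∧
      convexHull ℝ (t : Set ℂ) ⊆ O := by
    intro x hx
    obtain ⟨t, h1, h2⟩ := (convex_singleton (𝕜 := ℝ) x).exists_subset_interior_convexHull_finset_of_isCompact
      isCompact_singleton (by rw [nhdsSet_singleton]; exact hO.mem_nhds (hSO hx))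
    exact ⟨t, h1 rfl, h2⟩
  choose! T hT1 hT2 using hpt
  obtain ⟨u, huS, hu⟩ := hS.elim_nhds_subcover (fun x => interior (convexHull ℝ (T x : Set ℂ)))
    fun x hx => isOpen_interior.mem_nhds (hT1 x hx)
  refine ⟨u.biUnion T, fun z hz => ?_, convexHull_min (fun z hz => ?_) hc⟩
  · obtain ⟨x, hx, hzx⟩ := mem_iUnion₂.1 (hu hz)
    refine interior_mono (convexHull_mono fun y hy => ?_) hzx
    exact Finset.mem_coe.2 (Finset.mem_biUnion.2 ⟨x, hx, hy⟩)
  · obtain ⟨x, hx, hzx⟩ := Finset.mem_biUnion.1 (Finset.mem_coe.1 hz)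
    exact hT2 x (huS x hx) (subset_convexHull ℝ _ hzx)

/-- Approximation of a convex harmonic map by convex harmonic maps onto bounded domains. -/
theorem exists_approx_re_mul_nonneg {h g : ℂ → ℂ} (hh : DifferentiableOn ℂ h (ball 0 1))
    (hg : DifferentiableOn ℂ g (ball 0 1)) (hlt : ∀ z ∈ ball (0 : ℂ) 1, ‖deriv g z‖ < ‖deriv h z‖)
    (hinj : InjOn (fun z => h z + (starRingEnd ℂ) (g z)) (ball 0 1))
    (hconv : Convex ℝ ((fun z => h z + (starRingEnd ℂ) (g z)) '' ball 0 1))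
    (hzero : h 0 + (starRingEnd ℂ) (g 0) = 0) {ρ : ℝ} (hρ0 : 0 < ρ) (hρ1 : ρ < 1) :
    ∃ φ : ℂ → ℂ, ∃ ν ζ : ℂ, DifferentiableOn ℂ φ (ball 0 1) ∧ MapsTo φ (ball 0 1) (ball 0 1) ∧
      φ 0 = 0 ∧ ρ ≤ ‖deriv φ 0‖ ∧ ‖ν‖ = 1 ∧ ‖ζ‖ = 1 ∧ ∀ z ∈ ball (0 : ℂ) 1,
      0 ≤ ((ν * deriv h (φ z) + (starRingEnd ℂ) ν * deriv g (φ z)) * deriv φ z *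
        (ζ - (starRingEnd ℂ) ζ * z ^ 2)).re := by
  set f : ℂ → ℂ := fun z => h z + (starRingEnd ℂ) (g z) with hf
  have hm : ∀ z ∈ ball (0 : ℂ) 1, map f (𝓝 z) = 𝓝 (f z) := fun z hz =>
    map_nhds_eq_of_norm_deriv_lt (hh.analyticAt (isOpen_ball.mem_nhds hz))
      (hg.analyticAt (isOpen_ball.mem_nhds hz)) (hlt z hz)
  have hfc : ContinuousOn f (ball 0 1) :=
    hh.continuousOn.add (continuous_conj.comp_continuousOn hg.continuousOn)
  have hO : IsOpen (f '' ball 0 1) := isOpen_image_of_map_nhds_eq isOpen_ball hm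
  set K := Function.invFunOn f (ball 0 1) with hK
  have hKf : ∀ z ∈ ball (0 : ℂ) 1, K (f z) = z := fun z hz => hinj.leftInvOn_invFunOn hz
  have hKm : MapsTo K (f '' ball 0 1) (ball 0 1) := by
    rintro _ ⟨z, hz, rfl⟩
    rwa [hKf z hz]
  have hfK : ∀ w ∈ f '' ball 0 1, f (K w) = w := by
    rintro _ ⟨z, hz, rfl⟩
    rw [hKf z hz]
  have hKc : ContinuousOn K (f '' ball 0 1) := by
    rintro _ ⟨z, hz, rfl⟩
    exact (continuousAt_leftInverse_of_map_nhds_eq isOpen_ball hm hKf hz).continuousWithinAt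
  have hsub : closedBall (0 : ℂ) ρ ⊆ ball 0 1 := closedBall_subset_ball hρ1
  -- The polygon contains the image of |z| ≤ ρ, which will make |φ'(0)| ≥ ρ, and it is a compact
  -- subset of the image, which will bound h' and g' along φ.
  obtain ⟨t, ht1, ht2⟩ := exists_finset_subset_interior_convexHull
    ((isCompact_closedBall (0 : ℂ) ρ).image_of_continuousOn (hfc.mono hsub)) hO hconv
    (image_mono hsub)
  set T := convexHull ℝ (t : Set ℂ) with hT
  have hTc : IsCompact T := t.finite_toSet.isCompact_convexHull ℝ
  set Ω := interior T with hΩ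
  have hΩT : Ω ⊆ T := interior_subset
  have hΩD : Ω ⊆ f '' ball 0 1 := hΩT.trans ht2
  have hΩconv : Convex ℝ Ω := (convex_convexHull ℝ _).interior
  have hΩo : IsOpen Ω := isOpen_interior
  have hf0 : f 0 = 0 := hzero
  have h0Ω : (0 : ℂ) ∈ Ω := ht1 ⟨0, mem_closedBall_self hρ0.le, hf0⟩
  set U := ball (0 : ℂ) 1 ∩ f ⁻¹' Ω with hU
  have hUo : IsOpen U := hfc.isOpen_inter_preimage isOpen_ball hΩo
  have hUb : U ⊆ ball 0 1 := inter_subset_left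
  have hKU : MapsTo K Ω U := fun w hw => ⟨hKm (hΩD hw), by
    rw [mem_preimage, hfK w (hΩD hw)]; exact hw⟩
  have hfU : MapsTo f U Ω := fun z hz => hz.2
  have h0U : (0 : ℂ) ∈ U := ⟨mem_ball_self one_pos, by rw [mem_preimage, hf0]; exact h0Ω⟩
  have hρU : ball (0 : ℂ) ρ ⊆ U := fun z hz =>
    ⟨hsub (ball_subset_closedBall hz), ht1 ⟨z, ball_subset_closedBall hz, rfl⟩⟩
  have hUsc : IsSimplyConnected U := isSimplyConnected_of_convex_image hΩconv ⟨0, h0Ω⟩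
    (hfc.mono hUb) (hKc.mono hΩD) hfU hKU (fun z hz => hKf z hz.1) (fun w hw => hfK w (hΩD hw))
  obtain ⟨E, hE, hEs⟩ := exists_isDiscEmbedding_surjOn hUo hUsc h0U hUb
  obtain ⟨φ, hφd, hφm, hEφ, hφE, hφ0, hφ'⟩ := hE.exists_inverse hUo h0U hEs
  have hφb : MapsTo φ (ball 0 1) (ball 0 1) := fun z hz => hUb (hφm hz)
  have hφinj : InjOn φ (ball 0 1) := fun x hx y hy hxy => by rw [← hEφ x hx, hxy, hEφ y hy]
  have hρφ : ρ ≤ ‖deriv φ 0‖ := by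
    -- Schwarz lemma for E on the disk of radius ρ: |E'(0)| ≤ 1/ρ, and φ inverts E.
    have h1 := norm_deriv_le_div_of_mapsTo_ball (hE.diff.mono hρU) (fun z hz => by
      rw [hE.map_zero]
      exact ball_subset_closedBall (hE.mapsTo (hρU hz))) hρ0
    rw [hφ', norm_inv, le_inv_comm₀ hρ0 (norm_pos_iff.2 (hE.deriv_ne 0 h0U)), ← one_div]
    exact h1
  have hφat : ∀ z ∈ ball (0 : ℂ) 1, HasDerivAt φ (deriv φ z) z := fun z hz =>
    (hφd.differentiableAt (isOpen_ball.mem_nhds hz)).hasDerivAt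
  have hcomp : ∀ k : ℂ → ℂ, DifferentiableOn ℂ k (ball 0 1) → ∀ z ∈ ball (0 : ℂ) 1,
      HasDerivAt (fun z => k (φ z)) (deriv k (φ z) * deriv φ z) z := fun k hk z hz =>
    (hk.differentiableAt (isOpen_ball.mem_nhds (hφb hz))).hasDerivAt.comp z (hφat z hz)
  have hbound : ∀ k : ℂ → ℂ, DifferentiableOn ℂ k (ball 0 1) → ∃ C : ℝ, ∀ z ∈ ball (0 : ℂ) 1,
      ‖deriv k (φ z)‖ ≤ C := by
    intro k hk
    have hKT : IsCompact (K '' T) := hTc.image_of_continuousOn (hKc.mono ht2)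
    have hKTb : K '' T ⊆ ball 0 1 := by
      rintro _ ⟨w, hw, rfl⟩
      exact hKm (ht2 hw)
    obtain ⟨C, hC⟩ := hKT.exists_bound_of_continuousOn
      ((hk.analyticOnNhd isOpen_ball).deriv.continuousOn.mono hKTb)
    refine ⟨C, fun z hz => hC _ ⟨f (φ z), hΩT (hφm hz).2, hKf _ (hφb hz)⟩⟩
  obtain ⟨C₁, hC₁⟩ := hbound h hh
  obtain ⟨C₂, hC₂⟩ := hbound g hg
  obtain ⟨B, hB⟩ := hTc.isBounded.exists_norm_le
  have hdH : DifferentiableOn ℂ (fun z => h (φ z)) (ball 0 1) := fun z hz =>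
    (hcomp h hh z hz).differentiableAt.differentiableWithinAt
  have hdG : DifferentiableOn ℂ (fun z => g (φ z)) (ball 0 1) := fun z hz =>
    (hcomp g hg z hz).differentiableAt.differentiableWithinAt
  have hFΩ : MapsTo (fun z => f (φ z)) (ball 0 1) Ω := fun z hz => (hφm hz).2
  have hKc' : ContinuousOn (fun w => E (K w)) Ω := hE.diff.continuousOn.comp (hKc.mono hΩD) hKU
  have hKm' : MapsTo (fun w => E (K w)) Ω (ball 0 1) := fun w hw => hE.mapsTo (hKU hw)
  have hFK' : ∀ w ∈ Ω, f (φ (E (K w))) = w := fun w hw => by rw [hφE _ (hKU hw), hfK w (hΩD hw)]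
  have hKF' : ∀ z ∈ ball (0 : ℂ) 1, E (K (f (φ z))) = z := fun z hz => by
    rw [hKf _ (hφb hz), hEφ z hz]
  obtain ⟨ν, ζ, hν, hζ, hpos⟩ := exists_re_mul_nonneg_of_boundary_limits (F := fun z => f (φ z))
    hdH hdG (fun z _ => rfl) hΩconv hΩo h0Ω hFΩ hKc' hKm' hFK' hKF' fun ζ hζ =>
      exists_tendsto_boundary (C := max (max C₁ C₂) 0) (B := B) (le_max_right _ _) hφd hφinj hφb hdH hdG
        (fun z hz => by
          rw [(hcomp h hh z hz).deriv, norm_mul]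
          exact mul_le_mul_of_nonneg_right ((hC₁ z hz).trans ((le_max_left _ _).trans (le_max_left _ _)))
            (norm_nonneg _))
        (fun z hz => by
          rw [(hcomp g hg z hz).deriv, norm_mul]
          exact mul_le_mul_of_nonneg_right ((hC₂ z hz).trans ((le_max_right _ _).trans (le_max_left _ _)))
            (norm_nonneg _))
        (fun z _ => rfl) hΩconv hΩo h0Ω (fun w hw => hB w (hΩT hw)) hFΩ hKc' hKm' hFK' hKF'
        (by simp only [hφ0]; exact hf0) hζ
  refine ⟨φ, ν, ζ, hφd, hφb, hφ0, hρφ, hν, hζ, fun z hz => ?_⟩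
  have := hpos z hz
  rw [(hcomp h hh z hz).deriv, (hcomp g hg z hz).deriv] at this
  convert this using 2
  ring

/-- A convex harmonic map satisfies the positivity condition with antipodal points `±ζ`. -/
theorem exists_re_mul_nonneg_of_convex {h g : ℂ → ℂ} (hh : DifferentiableOn ℂ h (ball 0 1))
    (hg : DifferentiableOn ℂ g (ball 0 1)) (hlt : ∀ z ∈ ball (0 : ℂ) 1, ‖deriv g z‖ < ‖deriv h z‖)
    (hinj : InjOn (fun z => h z + (starRingEnd ℂ) (g z)) (ball 0 1))
    (hconv : Convex ℝ ((fun z => h z + (starRingEnd ℂ) (g z)) '' ball 0 1))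
    (hzero : h 0 + (starRingEnd ℂ) (g 0) = 0) :
    ∃ ν ζ : ℂ, ‖ν‖ = 1 ∧ ‖ζ‖ = 1 ∧ ∀ z ∈ ball (0 : ℂ) 1,
      0 ≤ ((ν * deriv h z + (starRingEnd ℂ) ν * deriv g z) * (ζ - (starRingEnd ℂ) ζ * z ^ 2)).re := by
  set ρ : ℕ → ℝ := fun n => 1 - 1 / ((n : ℝ) + 2) with hρ
  have hρ0 : ∀ n, 0 < ρ n := fun n => by
    rw [hρ]; simp only; rw [sub_pos, div_lt_one (by positivity)]
    have : (0 : ℝ) ≤ n := n.cast_nonneg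
    linarith
  have hρ1 : ∀ n, ρ n < 1 := fun n => by
    rw [hρ]; simp only; rw [sub_lt_self_iff]; positivity
  have hle : ((hyperfilter ℕ : Ultrafilter ℕ) : Filter ℕ) ≤ atTop := by
    rw [← Nat.cofinite_eq_atTop]; exact hyperfilter_le_cofinite
  have hρlim : Tendsto ρ (hyperfilter ℕ) (𝓝 1) := by
    have h1 : Tendsto (fun n : ℕ => 1 / (((n + 1 : ℕ) : ℝ) + 1)) atTop (𝓝 0) :=
      tendsto_one_div_add_atTop_nhds_zero_nat.comp (tendsto_add_atTop_nat 1)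
    have h2 := (h1.const_sub 1).mono_left hle
    rw [sub_zero] at h2
    refine h2.congr fun n => ?_
    simp only [hρ]
    push_cast
    ring
  choose φ ν ζ hφd hφm hφ0 hφρ hν hζ hpos using fun n =>
    exists_approx_re_mul_nonneg hh hg hlt hinj hconv hzero (hρ0 n) (hρ1 n)
  obtain ⟨Φ, hΦ⟩ := exists_tendstoLocallyUniformlyOn_of_norm_le_one (hyperfilter ℕ) isOpen_ball hφd
    (fun i z hz => (mem_ball_zero_iff.1 (hφm i hz)).le)
  have hΦ' := hΦ.deriv (Eventually.of_forall hφd) isOpen_ball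
  have hΦd := hΦ.differentiableOn (Eventually.of_forall hφd) isOpen_ball
  have m0 : (0 : ℂ) ∈ ball (0 : ℂ) 1 := mem_ball_self one_pos
  have hΦ0 : Φ 0 = 0 := tendsto_nhds_unique (hΦ.tendsto_at m0)
    (tendsto_const_nhds.congr fun n => (hφ0 n).symm)
  have hΦm : MapsTo Φ (ball 0 1) (closedBall 0 1) := fun z hz => by
    rw [mem_closedBall_zero_iff]
    exact le_of_tendsto (hΦ.tendsto_at hz).norm
      (Eventually.of_forall fun i => (mem_ball_zero_iff.1 (hφm i hz)).le)
  set c := deriv Φ 0 with hc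
  -- The Schwarz lemma and the lower bounds ρ n → 1 meet; equality in the Schwarz lemma then makes
  -- the limit of the Riemann maps the rotation by c.
  have hc1 : ‖c‖ = 1 := by
    apply le_antisymm
    · have := norm_deriv_le_div_of_mapsTo_ball hΦd (by rwa [hΦ0]) one_pos
      simpa using this
    · exact le_of_tendsto_of_tendsto hρlim (hΦ'.tendsto_at m0).norm (Eventually.of_forall hφρ)
  have hΦc : ∀ z ∈ ball (0 : ℂ) 1, Φ z = c * z := by
    have haff := affine_of_mapsTo_ball_of_norm_dslope_eq_div hΦd (by rwa [hΦ0]) m0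
      (by rw [dslope_same, ← hc, hc1]; norm_num)
    intro z hz
    have := haff hz
    simp only [hΦ0, dslope_same, sub_zero, smul_eq_mul, zero_add] at this
    rw [this, mul_comm]
  have hΦc' : ∀ z ∈ ball (0 : ℂ) 1, deriv Φ z = c := by
    intro z hz
    have : Φ =ᶠ[𝓝 z] fun z => c * z := Filter.eventually_of_mem (isOpen_ball.mem_nhds hz) hΦc
    rw [this.deriv_eq]
    simp
  have hsph : ∀ a : ℕ → ℂ, (∀ n, ‖a n‖ = 1) → ∃ b : ℂ, ‖b‖ = 1 ∧ Tendsto a (hyperfilter ℕ) (𝓝 b) := by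
    intro a ha
    obtain ⟨b, hb, hab⟩ := (isCompact_sphere (0 : ℂ) 1).ultrafilter_le_nhds ((hyperfilter ℕ).map a) (by
      rw [le_principal_iff]
      exact Filter.mem_map.2 (Filter.univ_mem' fun i => by simpa using ha i))
    exact ⟨b, by simpa using hb, hab⟩
  obtain ⟨ν', hν', hνlim⟩ := hsph ν hν
  obtain ⟨ζ', hζ', hζlim⟩ := hsph ζ hζ
  -- The limiting rotation turns the endpoint ζ' into cζ'; accordingly the approximate inequalities
  -- are used at w = conj c · z.
  refine ⟨ν', c * ζ', hν', by rw [norm_mul, hc1, hζ', one_mul], fun z hz => ?_⟩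
  have hcc : c * (starRingEnd ℂ) c = 1 := by rw [mul_conj, normSq_eq_norm_sq, hc1]; simp
  set w := (starRingEnd ℂ) c * z with hw
  have hcw : c * w = z := by rw [hw, ← mul_assoc, hcc, one_mul]
  have hwm : w ∈ ball (0 : ℂ) 1 := by
    rw [mem_ball_zero_iff, hw, norm_mul, RCLike.norm_conj, hc1, one_mul]
    exact mem_ball_zero_iff.1 hz
  have hφlim : Tendsto (fun n => φ n w) (hyperfilter ℕ) (𝓝 z) := by
    have := hΦ.tendsto_at hwm
    rwa [hΦc w hwm, hcw] at this
  have hφ'lim : Tendsto (fun n => deriv (φ n) w) (hyperfilter ℕ) (𝓝 c) := by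
    have := hΦ'.tendsto_at hwm
    rwa [hΦc' w hwm] at this
  have hk : ∀ k : ℂ → ℂ, DifferentiableOn ℂ k (ball 0 1) →
      Tendsto (fun n => deriv k (φ n w)) (hyperfilter ℕ) (𝓝 (deriv k z)) := fun k hk =>
    ((hk.analyticOnNhd isOpen_ball).deriv z hz).continuousAt.tendsto.comp hφlim
  have hlim : Tendsto (fun n => ((ν n * deriv h (φ n w) + (starRingEnd ℂ) (ν n) * deriv g (φ n w)) *
      deriv (φ n) w * (ζ n - (starRingEnd ℂ) (ζ n) * w ^ 2)).re) (hyperfilter ℕ)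
      (𝓝 ((ν' * deriv h z + (starRingEnd ℂ) ν' * deriv g z) * c *
        (ζ' - (starRingEnd ℂ) ζ' * w ^ 2)).re) := by
    have hconj : ∀ {a : ℕ → ℂ} {b : ℂ}, Tendsto a (hyperfilter ℕ) (𝓝 b) →
        Tendsto (fun n => (starRingEnd ℂ) (a n)) (hyperfilter ℕ) (𝓝 ((starRingEnd ℂ) b)) := fun h =>
      (continuous_conj.tendsto _).comp h
    exact (continuous_re.tendsto _).comp ((((hνlim.mul (hk h hh)).add ((hconj hνlim).mul (hk g hg))).mul
      hφ'lim).mul (hζlim.sub ((hconj hζlim).mul_const _)))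
  have := ge_of_tendsto hlim (Eventually.of_forall fun n => hpos n w hwm)
  have e : (ν' * deriv h z + (starRingEnd ℂ) ν' * deriv g z) *
      (c * ζ' - (starRingEnd ℂ) (c * ζ') * z ^ 2) =
      (ν' * deriv h z + (starRingEnd ℂ) ν' * deriv g z) * c * (ζ' - (starRingEnd ℂ) ζ' * w ^ 2) := by
    rw [map_mul, ← hcw]
    linear_combination (ν' * deriv h (c * w) + (starRingEnd ℂ) ν' * deriv g (c * w)) *
      (-(starRingEnd ℂ) ζ' * c * w ^ 2) * hcc
  rwa [e]

/-! ### Power series in the unit disk and Carathéodory's bound. -/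

/-- `F` is the sum of the power series with coefficients `c` in the unit disk. -/
def HasCoeffs (F : ℂ → ℂ) (c : ℕ → ℂ) : Prop :=
  ∀ z ∈ ball (0 : ℂ) 1, HasSum (fun n => c n * z ^ n) (F z)

namespace HasCoeffs

variable {F G : ℂ → ℂ} {c d : ℕ → ℂ}

theorem summable_norm (h : HasCoeffs F c) {r : ℝ} (hr0 : 0 ≤ r) (hr1 : r < 1) :
    Summable fun n => ‖c n‖ * r ^ n := by
  have h1 : ((r : ℝ) : ℂ) ∈ ball (0 : ℂ) 1 := by
    rw [mem_ball_zero_iff, Complex.norm_real, Real.norm_eq_abs, abs_of_nonneg hr0]; exact hr1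
  refine (h _ h1).summable.norm.congr fun n => ?_
  rw [norm_mul, norm_pow, Complex.norm_real, Real.norm_eq_abs, abs_of_nonneg hr0]

theorem of_summable (h : ∀ r : ℝ, 0 ≤ r → r < 1 → Summable fun n => ‖c n‖ * r ^ n) :
    HasCoeffs (fun z => ∑' n, c n * z ^ n) c := by
  intro z hz
  have := h ‖z‖ (norm_nonneg _) (mem_ball_zero_iff.1 hz)
  refine (Summable.of_norm (this.congr fun n => ?_)).hasSum
  rw [norm_mul, norm_pow]

theorem hasFPowerSeriesOnBall (h : HasCoeffs F c) :
    HasFPowerSeriesOnBall F (FormalMultilinearSeries.ofScalars ℂ c) 0 1 where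
  r_le := by
    refine ENNReal.le_of_forall_nnreal_lt fun r hr => ?_
    have hr' : (r : ℝ) < 1 := by exact_mod_cast hr
    refine FormalMultilinearSeries.le_radius_of_summable _ ?_
    simpa [FormalMultilinearSeries.ofScalars_norm] using h.summable_norm r.2 hr'
  r_pos := by simp
  hasSum := by
    intro y hy
    have hy1 : y ∈ ball (0 : ℂ) 1 := by
      rw [← ENNReal.coe_one, Metric.eball_coe] at hy
      simpa using hy
    simpa [FormalMultilinearSeries.ofScalars_apply_eq, mul_comm] using h y hy1

theorem differentiableOn (h : HasCoeffs F c) : DifferentiableOn ℂ F (ball 0 1) := by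
  have := h.hasFPowerSeriesOnBall.differentiableOn
  rwa [← ENNReal.coe_one, Metric.eball_coe, NNReal.coe_one] at this

theorem apply_zero (h : HasCoeffs F c) : F 0 = c 0 := by
  have h0 := h 0 (mem_ball_self one_pos)
  refine h0.unique ?_
  simpa using hasSum_single (f := fun n => c n * (0 : ℂ) ^ n) 0 (fun n hn => by simp [hn])

theorem sub (h : HasCoeffs F c) (h' : HasCoeffs G d) :
    HasCoeffs (fun z => F z - G z) (fun n => c n - d n) := fun z hz => by
  simpa only [sub_mul] using (h z hz).sub (h' z hz)

theorem add (h : HasCoeffs F c) (h' : HasCoeffs G d) :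
    HasCoeffs (fun z => F z + G z) (fun n => c n + d n) := fun z hz => by
  simpa only [add_mul] using (h z hz).add (h' z hz)

theorem const_mul (h : HasCoeffs F c) (k : ℂ) :
    HasCoeffs (fun z => k * F z) (fun n => k * c n) := fun z hz => by
  simpa only [mul_assoc] using (h z hz).mul_left k

theorem congr (h : HasCoeffs F c) (hFG : ∀ z ∈ ball (0 : ℂ) 1, F z = G z) : HasCoeffs G c :=
  fun z hz => hFG z hz ▸ h z hz

theorem one : HasCoeffs (fun _ => 1) (fun n => if n = 0 then 1 else 0) := fun z _ => by
  convert hasSum_single (f := fun n => (if n = 0 then (1 : ℂ) else 0) * z ^ n) 0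
    (fun n hn => by simp [hn]) using 1
  simp

theorem unique (h : HasCoeffs F c) (h' : HasCoeffs F d) : c = d := by
  have hs := h.sub h'
  funext n
  rcases eq_or_ne n 0 with rfl | hn
  · rw [← h.apply_zero, h'.apply_zero]
  · exact sub_eq_zero.1 (HarmonicMapping.coeff_eq_zero hs (C := 0) (fun z _ => sub_self _) n hn)

theorem taylor (hF : DifferentiableOn ℂ F (ball 0 1)) :
    HasCoeffs F (fun n => (n.factorial : ℂ)⁻¹ * iteratedDeriv n F 0) := fun z hz => by
  have := Complex.hasSum_taylorSeries_on_ball hF hz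
  convert! this using 2 with n
  simp only [smul_eq_mul, sub_zero]
  ring

theorem deriv (h : HasCoeffs F c) : HasCoeffs (deriv F) (fun n => (n + 1) * c (n + 1)) := by
  have hd : DifferentiableOn ℂ (_root_.deriv F) (ball 0 1) :=
    (h.differentiableOn.analyticOnNhd isOpen_ball).deriv.differentiableOn
  convert taylor hd using 2 with n
  rw [h.unique (taylor h.differentiableOn)]
  simp only
  rw [iteratedDeriv_succ', Nat.factorial_succ]
  have : (n.factorial : ℂ) ≠ 0 := by exact_mod_cast n.factorial_ne_zero
  have : (n : ℂ) + 1 ≠ 0 := by exact_mod_cast n.succ_ne_zero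
  push_cast
  field_simp

theorem mul (h : HasCoeffs F c) (h' : HasCoeffs G d) :
    HasCoeffs (fun z => F z * G z)
      (fun n => ∑ k ∈ Finset.range (n + 1), c k * d (n - k)) := fun z hz => by
  have s1 := (h z hz).summable.norm
  have s2 := (h' z hz).summable.norm
  have e := tsum_mul_tsum_eq_tsum_sum_range_of_summable_norm s1 s2
  have s := (summable_norm_sum_mul_range_of_summable_norm s1 s2).of_norm.hasSum
  rw [← e, (h z hz).tsum_eq, (h' z hz).tsum_eq] at s
  refine (congrArg (fun u : ℕ → ℂ => HasSum u _) (funext fun n => ?_)).mpr s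
  rw [Finset.sum_mul]
  refine Finset.sum_congr rfl fun k hk => ?_
  rw [← Nat.add_sub_of_le (Nat.lt_succ_iff.1 (Finset.mem_range.1 hk)), pow_add,
    Nat.add_sub_cancel_left]
  ring

theorem mul_sq (h : HasCoeffs F c) :
    HasCoeffs (fun z => z ^ 2 * F z) (fun n => if n < 2 then 0 else c (n - 2)) := fun z hz => by
  have := (h z hz).mul_left (z ^ 2)
  rw [← hasSum_nat_add_iff' 2]
  have e : z ^ 2 * F z - ∑ i ∈ Finset.range 2, (if i < 2 then 0 else c (i - 2)) * z ^ i =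
      z ^ 2 * F z := by simp [Finset.sum_range_succ]
  rw [e]
  refine (congrArg (fun u : ℕ → ℂ => HasSum u _) (funext fun n => ?_)).mpr this
  simp only
  rw [if_neg (by omega), Nat.add_sub_cancel]
  ring

/-- Orthogonality of exponentials on the circle: at most one term of the sum is nonzero. -/
theorem integral_mul_exp (h : HasCoeffs F c) {r : ℝ} (hr0 : 0 ≤ r) (hr1 : r < 1) (m : ℤ) :
    HasSum (fun n : ℕ => c n * r ^ n * (if (n : ℤ) + m = 0 then ((2 * Real.pi : ℝ) : ℂ) else 0))
      (∫ θ in (0 : ℝ)..2 * Real.pi, F (r * exp (θ * I)) * exp (m * θ * I)) := by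
  have hmem : ∀ θ : ℝ, (r : ℂ) * exp (θ * I) ∈ ball (0 : ℂ) 1 := fun θ => by
    rw [mem_ball_zero_iff, norm_mul, norm_exp_ofReal_mul_I, Complex.norm_real, Real.norm_eq_abs,
      abs_of_nonneg hr0, mul_one]
    exact hr1
  have hint := intervalIntegral.hasSum_integral_of_dominated_convergence
    (F := fun (n : ℕ) (θ : ℝ) => c n * (r * exp (θ * I)) ^ n * exp (m * θ * I))
    (f := fun θ : ℝ => F (r * exp (θ * I)) * exp (m * θ * I)) (a := 0) (b := 2 * Real.pi)
    (μ := MeasureTheory.volume) (fun n _ => ‖c n‖ * r ^ n)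
    (fun n => (by fun_prop : Continuous fun θ : ℝ =>
      c n * (r * exp (θ * I)) ^ n * exp (m * θ * I)).aestronglyMeasurable)
    (fun n => Eventually.of_forall fun θ _ => by
      have : ‖exp ((m : ℂ) * θ * I)‖ = 1 := by
        rw [← ofReal_intCast, ← ofReal_mul, norm_exp_ofReal_mul_I]
      rw [norm_mul, norm_mul, norm_pow, norm_mul, norm_exp_ofReal_mul_I, Complex.norm_real,
        Real.norm_eq_abs, abs_of_nonneg hr0, mul_one, this, mul_one])
    (Eventually.of_forall fun θ _ => h.summable_norm hr0 hr1)
    (by simp)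
    (Eventually.of_forall fun θ _ => (h _ (hmem θ)).mul_right _)
  refine (congrArg (fun u : ℕ → ℂ => HasSum u _) (funext fun n => ?_)).mpr hint
  have e : ∀ θ : ℝ, c n * (r * exp (θ * I)) ^ n * exp (m * θ * I) =
      c n * r ^ n * exp ((((n : ℤ) + m : ℤ) * I) * θ) := fun θ => by
    rw [mul_pow, ← Complex.exp_nat_mul, ← mul_assoc, mul_assoc, ← Complex.exp_add]
    congr 2
    push_cast
    ring
  rw [intervalIntegral.integral_congr fun θ _ => e θ, intervalIntegral.integral_const_mul]
  congr 1
  split_ifs with h0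
  · simp [h0]
  · rw [integral_exp_mul_complex (mul_ne_zero (by exact_mod_cast h0) I_ne_zero)]
    have : exp (((n : ℤ) + m : ℤ) * I * ((2 * Real.pi : ℝ) : ℂ)) = 1 := by
      rw [← Complex.exp_int_mul_two_pi_mul_I ((n : ℤ) + m)]
      congr 1
      push_cast
      ring
    rw [this]
    simp

end HasCoeffs

/-- Carathéodory's coefficient bound for functions with nonnegative real part. -/
theorem HasCoeffs.norm_le_of_re_nonneg {P : ℂ → ℂ} {p : ℕ → ℂ} (h : HasCoeffs P p)
    (hre : ∀ z ∈ ball (0 : ℂ) 1, 0 ≤ (P z).re) {k : ℕ} (hk : k ≠ 0) : ‖p k‖ ≤ 2 * (p 0).re := by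
  have key : ∀ r : ℝ, 0 ≤ r → r < 1 → ‖p k‖ * r ^ k ≤ 2 * (p 0).re := by
    intro r hr0 hr1
    have hmem : ∀ θ : ℝ, (r : ℂ) * exp (θ * I) ∈ ball (0 : ℂ) 1 := fun θ => by
      rw [mem_ball_zero_iff, norm_mul, norm_exp_ofReal_mul_I, Complex.norm_real, Real.norm_eq_abs,
        abs_of_nonneg hr0, mul_one]
      exact hr1
    have hc : Continuous fun θ : ℝ => P (r * exp (θ * I)) :=
      h.differentiableOn.continuousOn.comp_continuous (by fun_prop) hmem
    have i1 : (∫ θ in (0 : ℝ)..2 * Real.pi, P (r * exp (θ * I)) * exp ((-(k : ℤ) : ℤ) * θ * I)) =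
        p k * r ^ k * (2 * Real.pi : ℝ) := by
      refine (h.integral_mul_exp hr0 hr1 _).unique ?_
      convert hasSum_single k ?_ using 1
      · simp
      · intro n hn
        rw [if_neg, mul_zero]
        omega
    have i2 : (∫ θ in (0 : ℝ)..2 * Real.pi, P (r * exp (θ * I)) * exp (((k : ℤ) : ℤ) * θ * I)) =
        0 := by
      refine (h.integral_mul_exp hr0 hr1 _).unique ?_
      convert hasSum_zero using 2 with n
      rw [if_neg, mul_zero]
      omega
    have i0 : (∫ θ in (0 : ℝ)..2 * Real.pi, P (r * exp (θ * I))) =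
        p 0 * (2 * Real.pi : ℝ) := by
      have := h.integral_mul_exp hr0 hr1 0
      simp only [Int.cast_zero, zero_mul, Complex.exp_zero, mul_one, add_zero] at this
      refine this.unique ?_
      convert hasSum_single 0 ?_ using 1
      · simp
      · intro n hn
        rw [if_neg, mul_zero]
        omega
    -- The conjugate of P contributes nothing at frequency -k. It can therefore be added to P, so
    -- that p k becomes a Fourier coefficient of 2 Re P ≥ 0, bounded by its mean.
    have i3 : (∫ θ in (0 : ℝ)..2 * Real.pi,
        (starRingEnd ℂ) (P (r * exp (θ * I))) * exp ((-(k : ℤ) : ℤ) * θ * I)) = 0 := by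
      rw [← map_zero (starRingEnd ℂ), ← i2]
      refine Eq.trans ?_ (conjCLE.toContinuousLinearMap.intervalIntegral_comp_comm
        ((hc.mul (by fun_prop)).intervalIntegrable _ _))
      refine intervalIntegral.integral_congr fun θ _ => ?_
      simp [← Complex.exp_conj]
    have i4 : (∫ θ in (0 : ℝ)..2 * Real.pi,
        ((2 * (P (r * exp (θ * I))).re : ℝ) : ℂ) * exp ((-(k : ℤ) : ℤ) * θ * I)) =
        p k * r ^ k * (2 * Real.pi : ℝ) := by
      rw [← i1, ← add_zero (intervalIntegral (fun θ : ℝ => P (r * exp (θ * I)) *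
        exp ((-(k : ℤ) : ℤ) * θ * I)) _ _ _), ← i3, ← intervalIntegral.integral_add]
      · refine intervalIntegral.integral_congr fun θ _ => ?_
        rw [← add_mul, add_conj]
      · exact (hc.mul (by fun_prop)).intervalIntegrable _ _
      · exact ((continuous_conj.comp hc).mul (by fun_prop)).intervalIntegrable _ _
    have i5 : ‖p k * r ^ k * (2 * Real.pi : ℝ)‖ ≤
        ∫ θ in (0 : ℝ)..2 * Real.pi, 2 * (P (r * exp (θ * I))).re := by
      rw [← i4]
      refine intervalIntegral.norm_integral_le_of_norm_le Real.two_pi_pos.le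
        (Eventually.of_forall fun θ _ => ?_) ?_
      · have : ‖exp ((-(k : ℤ) : ℤ) * (θ : ℂ) * I)‖ = 1 := by
          rw [← ofReal_intCast, ← ofReal_mul, norm_exp_ofReal_mul_I]
        rw [norm_mul, this, mul_one, Complex.norm_real, Real.norm_eq_abs,
          abs_of_nonneg (mul_nonneg zero_le_two (hre _ (hmem θ)))]
      · exact (continuous_const.mul (continuous_re.comp hc)).intervalIntegrable _ _
    have i6 : (∫ θ in (0 : ℝ)..2 * Real.pi, 2 * (P (r * exp (θ * I))).re) =
        2 * (p 0).re * (2 * Real.pi) := by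
      rw [intervalIntegral.integral_const_mul]
      have := congrArg Complex.re i0
      rw [re_mul_ofReal] at this
      rw [mul_assoc, ← this]
      congr 1
      exact (reCLM.intervalIntegral_comp_comm (hc.intervalIntegrable _ _))
    rw [i6, norm_mul, norm_mul, norm_pow, Complex.norm_real, Complex.norm_real, Real.norm_eq_abs,
      Real.norm_eq_abs, abs_of_nonneg hr0, abs_of_pos Real.two_pi_pos] at i5
    exact le_of_mul_le_mul_right i5 Real.two_pi_pos
  have ht : Tendsto (fun r : ℝ => ‖p k‖ * r ^ k) (𝓝[<] 1) (𝓝 (‖p k‖ * 1 ^ k)) :=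
    ((continuous_const.mul (continuous_id.pow k)).tendsto 1).mono_left nhdsWithin_le_nhds
  rw [one_pow, mul_one] at ht
  refine le_of_tendsto ht ?_
  filter_upwards [Ioo_mem_nhdsLT (zero_lt_one (α := ℝ))] with r hr
  exact key r hr.1.le hr.2

/-! ### Coefficient bounds for convex harmonic maps. -/

/-- If `(1 - κ z²) Q(z)` has nonnegative real part, `‖κ‖ = 1` and `‖Q(0)‖ = 1`, then the
coefficients of `Q` are dominated by those of `(1 - z)⁻²`. -/
theorem HasCoeffs.norm_le_of_re_mul_nonneg {Q : ℂ → ℂ} {q : ℕ → ℂ} (h : HasCoeffs Q q) {η κ : ℂ}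
    (hη : ‖η‖ = 1) (hκ : ‖κ‖ = 1) (hq : ‖q 0‖ = 1)
    (hre : ∀ z ∈ ball (0 : ℂ) 1, 0 ≤ (η * (Q z - κ * (z ^ 2 * Q z))).re) (n : ℕ) :
    ‖q n‖ ≤ n + 1 := by
  have hP := (h.sub (h.mul_sq.const_mul κ)).const_mul η
  -- Carathéodory gives |q n - κ q (n-2)| ≤ 2, so the bound grows by 2 for every two indices,
  -- starting from |q 0| = 1 and |q 1| ≤ 2.
  have hb : ∀ n, n ≠ 0 → ‖q n - κ * (if n < 2 then 0 else q (n - 2))‖ ≤ 2 := fun n hn => by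
    have := hP.norm_le_of_re_nonneg hre hn
    rw [norm_mul, hη, one_mul] at this
    refine this.trans ?_
    have h1 := re_le_norm (η * (q 0 - κ * (if 0 < 2 then 0 else q (0 - 2))))
    rw [norm_mul, hη, one_mul, if_pos zero_lt_two, mul_zero, sub_zero, hq] at h1
    rw [if_pos zero_lt_two, mul_zero, sub_zero]
    linarith
  induction n using Nat.strong_induction_on with
  | _ n ih =>
    match n, ih with
    | 0, _ => simp [hq]
    | 1, _ =>
      have := hb 1 one_ne_zero
      rw [if_pos one_lt_two, mul_zero, sub_zero] at this
      norm_num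
      exact this
    | n + 2, ih =>
      have h1 := hb (n + 2) (by omega)
      rw [if_neg (by omega), Nat.add_sub_cancel] at h1
      have h2 := ih n (by omega)
      have h3 := norm_add_le (q (n + 2) - κ * q n) (κ * q n)
      rw [sub_add_cancel, norm_mul, hκ, one_mul] at h3
      push_cast
      linarith

theorem norm_cauchyProduct_le {c d : ℕ → ℂ} {A B : ℕ → ℝ} (hc : ∀ n, ‖c n‖ ≤ A n)
    (hd : ∀ n, ‖d n‖ ≤ B n) (n : ℕ) :
    ‖∑ k ∈ Finset.range (n + 1), c k * d (n - k)‖ ≤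
      ∑ k ∈ Finset.range (n + 1), A k * B (n - k) := by
  refine (norm_sum_le _ _).trans (Finset.sum_le_sum fun k _ => ?_)
  rw [norm_mul]
  exact mul_le_mul (hc k) (hd _) (norm_nonneg _) ((norm_nonneg _).trans (hc k))

theorem sum_range_add_one (n : ℕ) :
    ∑ k ∈ Finset.range n, ((k : ℝ) + 1) = n * (n + 1) / 2 := by
  induction n with
  | zero => simp
  | succ n ih => rw [Finset.sum_range_succ, ih]; push_cast; ring

/-- Coefficient bounds for convex harmonic maps. -/
theorem norm_coeff_le_of_convex {h g : ℂ → ℂ} {a b : ℕ → ℂ} (hh : HasCoeffs h a)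
    (hg : HasCoeffs g b) (ha0 : a 0 = 0) (hb0 : b 0 = 0) (ha1 : a 1 = 1) (hb1 : b 1 = 0)
    (hlt : ∀ z ∈ ball (0 : ℂ) 1, ‖deriv g z‖ < ‖deriv h z‖)
    (hinj : InjOn (fun z => h z + (starRingEnd ℂ) (g z)) (ball 0 1))
    (hconv : Convex ℝ ((fun z => h z + (starRingEnd ℂ) (g z)) '' ball 0 1)) (n : ℕ) :
    ‖a (n + 1)‖ ≤ (n + 2) / 2 ∧ ‖b (n + 1)‖ ≤ n / 2 := by
  obtain ⟨ν, ζ, hν, hζ, hpos⟩ := exists_re_mul_nonneg_of_convex hh.differentiableOn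
    hg.differentiableOn hlt hinj hconv (by rw [hh.apply_zero, hg.apply_zero, ha0, hb0]; simp)
  have hν0 : ν ≠ 0 := norm_ne_zero_iff.1 (by rw [hν]; exact one_ne_zero)
  have hζ0 : ζ ≠ 0 := norm_ne_zero_iff.1 (by rw [hζ]; exact one_ne_zero)
  -- Factors ν out of ν h' + conj ν g', leaving h' + ε g', whose value at 0 is 1.
  set ε := (starRingEnd ℂ) ν / ν with hε
  have hε1 : ‖ε‖ = 1 := by rw [hε, norm_div, RCLike.norm_conj, div_self (by rw [hν]; exact one_ne_zero)]
  have hε0 : ε ≠ 0 := norm_ne_zero_iff.1 (by rw [hε1]; exact one_ne_zero)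
  have hQ := hh.deriv.add (hg.deriv.const_mul ε)
  have hQn := hQ.norm_le_of_re_mul_nonneg (η := ν * ζ) (κ := (starRingEnd ℂ) ζ / ζ)
    (by rw [norm_mul, hν, hζ, one_mul])
    (by rw [norm_div, RCLike.norm_conj, div_self (by rw [hζ]; exact one_ne_zero)])
    (by simp [ha1, hb1]) (fun z hz => by
      convert hpos z hz using 2
      rw [hε]
      field_simp)
  have hQ0 : ∀ z ∈ ball (0 : ℂ) 1, deriv h z + ε * deriv g z ≠ 0 := fun z hz h0 => by
    have h1 := hlt z hz
    rw [eq_neg_of_add_eq_zero_left h0, norm_neg, norm_mul, hε1, one_mul] at h1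
    exact lt_irrefl _ h1
  set K : ℂ → ℂ := fun z => (deriv h z - ε * deriv g z) / (deriv h z + ε * deriv g z) with hK
  have hKd : DifferentiableOn ℂ K (ball 0 1) :=
    (hh.deriv.sub (hg.deriv.const_mul ε)).differentiableOn.div hQ.differentiableOn hQ0
  have hKre : ∀ z ∈ ball (0 : ℂ) 1, 0 ≤ (K z).re := fun z hz => by
    rw [hK]
    simp only
    rw [div_re, ← add_div]
    refine div_nonneg ?_ (normSq_nonneg _)
    have h1 : normSq (ε * deriv g z) < normSq (deriv h z) := by
      rw [normSq_eq_norm_sq, normSq_eq_norm_sq, norm_mul, hε1, one_mul]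
      exact pow_lt_pow_left₀ (hlt z hz) (norm_nonneg _) two_ne_zero
    rw [normSq_apply, normSq_apply] at h1
    simp only [sub_re, add_re, sub_im, add_im]
    nlinarith
  obtain ⟨k, hk⟩ : ∃ k, HasCoeffs K k := ⟨_, HasCoeffs.taylor hKd⟩
  have hk0 : k 0 = 1 := by
    rw [← hk.apply_zero, hK]
    simp only
    rw [hg.deriv.apply_zero, hh.deriv.apply_zero]
    simp [ha1, hb1]
  have hkn : ∀ n, n ≠ 0 → ‖k n‖ ≤ 2 := fun n hn => by
    have := hk.norm_le_of_re_nonneg hKre hn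
    rw [hk0, one_re, mul_one] at this
    exact this
  have hp := (HasCoeffs.one.add hk).const_mul (1 / 2)
  have hm := (HasCoeffs.one.sub hk).const_mul (1 / 2 * ε⁻¹)
  have hpb : ∀ n, ‖(1 / 2 : ℂ) * ((if n = 0 then 1 else 0) + k n)‖ ≤ (fun _ => (1 : ℝ)) n := by
    intro n
    rcases eq_or_ne n 0 with rfl | hn
    · rw [hk0]; norm_num
    · have := hkn n hn
      rw [if_neg hn, zero_add, norm_mul]
      norm_num
      linarith
  -- Since K(0) = 1, the constant term of 1 - K vanishes. The Cauchy product for g' thus loses its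
  -- last summand, which is why b gets n/2 where a gets (n + 2)/2.
  have hmb : ∀ n, ‖(1 / 2 * ε⁻¹ : ℂ) * ((if n = 0 then 1 else 0) - k n)‖ ≤
      (fun n => if n = 0 then (0 : ℝ) else 1) n := by
    intro n
    rcases eq_or_ne n 0 with rfl | hn
    · rw [hk0]; norm_num
    · have := hkn n hn
      rw [if_neg hn, zero_sub, norm_mul, norm_mul, norm_inv, hε1, norm_neg]
      simp only [if_neg hn]
      norm_num
      linarith
  have e1 := hh.deriv.unique ((hQ.mul hp).congr fun z hz => by
    have := hQ0 z hz
    rw [hK]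
    field_simp
    ring)
  have e2 := hg.deriv.unique ((hQ.mul hm).congr fun z hz => by
    have := hQ0 z hz
    rw [hK]
    field_simp
    ring)
  have b1 := norm_cauchyProduct_le hQn hpb n
  have b2 := norm_cauchyProduct_le hQn hmb n
  rw [← congrFun e1 n] at b1
  rw [← congrFun e2 n] at b2
  have hn : ‖((n : ℂ) + 1)‖ = n + 1 := by
    rw [← Nat.cast_one, ← Nat.cast_add, Complex.norm_natCast]; push_cast; ring
  rw [norm_mul, hn] at b1 b2
  have hn0 : (0 : ℝ) < n + 1 := by positivity
  constructor
  · simp only [mul_one] at b1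
    rw [sum_range_add_one] at b1
    refine le_of_mul_le_mul_left (b1.trans_eq ?_) hn0
    push_cast
    ring
  · have e3 : ∑ k ∈ Finset.range (n + 1), ((k : ℝ) + 1) * (if n - k = 0 then (0 : ℝ) else 1) =
        n * (n + 1) / 2 := by
      rw [Finset.sum_range_succ, Nat.sub_self, if_pos rfl, mul_zero, add_zero, ← sum_range_add_one]
      refine Finset.sum_congr rfl fun k hk => ?_
      rw [if_neg (by have := Finset.mem_range.1 hk; omega), mul_one]
    simp only [e3] at b2
    refine le_of_mul_le_mul_left (b2.trans_eq ?_) hn0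
    ring

open HarmonicMapping

theorem IsExpansion.exists_hasCoeffs {f : ℂ → ℂ} {a b : ℕ → ℂ} (h : IsExpansion f a b) :
    ∃ H G : ℂ → ℂ, HasCoeffs H a ∧ HasCoeffs G b ∧
      ∀ z ∈ ball (0 : ℂ) 1, f z = H z + (starRingEnd ℂ) (G z) := by
  obtain ⟨-, h⟩ := h
  choose! H G hH hG e using h
  exact ⟨H, G, hH, hG, e⟩

theorem dz_dzbar_eq {f H G : ℂ → ℂ} {z H' G' : ℂ} (hH : HasDerivAt H H' z) (hG : HasDerivAt G G' z)
    (hf : f =ᶠ[𝓝 z] fun w => H w + (starRingEnd ℂ) (G w)) :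
    dz f z = H' ∧ dzbar f z = (starRingEnd ℂ) G' := by
  have eH := hH.hasFDerivAt.restrictScalars ℝ
  have eG := hG.hasFDerivAt.restrictScalars ℝ
  have e := (eH.add (conjCLE.hasFDerivAt.comp z eG)).congr_of_eventuallyEq
    (f₁ := f) (hf.trans (Eventually.of_forall fun w => by simp))
  rw [dz, dzbar, e.fderiv]
  constructor <;> · apply Complex.ext <;> simp <;> ring

/-- Coefficient bounds in the class of convex harmonic maps. -/
theorem HarmonicMapping.IsConvexHarmonic.coeffs_bound {f : ℂ → ℂ} (hf : IsConvexHarmonic f) :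
    (coeffs f).1 0 = 0 ∧ (coeffs f).2 0 = 0 ∧ (coeffs f).1 1 = 1 ∧
      ∀ n : ℕ, ‖(coeffs f).1 (n + 1)‖ ≤ (n + 2) / 2 ∧ ‖(coeffs f).2 (n + 1)‖ ≤ n / 2 := by
  have hs := coeffs_spec hf.harmonic
  obtain ⟨H, G, hH, hG, e⟩ := IsExpansion.exists_hasCoeffs hs
  have m0 : (0 : ℂ) ∈ ball (0 : ℂ) 1 := mem_ball_self one_pos
  have hd : ∀ z ∈ ball (0 : ℂ) 1, dz f z = deriv H z ∧ dzbar f z = (starRingEnd ℂ) (deriv G z) :=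
    fun z hz => dz_dzbar_eq (hH.differentiableOn.differentiableAt (isOpen_ball.mem_nhds hz)).hasDerivAt
      (hG.differentiableOn.differentiableAt (isOpen_ball.mem_nhds hz)).hasDerivAt
      (eventually_of_mem (isOpen_ball.mem_nhds hz) e)
  have hb0 : (coeffs f).2 0 = 0 := hs.1
  have ha0 : (coeffs f).1 0 = 0 := by
    have := e 0 m0
    rw [hf.map_zero, hH.apply_zero, hG.apply_zero, hb0, _root_.map_zero, add_zero] at this
    exact this.symm
  have ha1 : (coeffs f).1 1 = 1 := by
    have := (hd 0 m0).1
    rw [hf.dz_zero, hH.deriv.apply_zero] at this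
    simpa using this.symm
  have hb1 : (coeffs f).2 1 = 0 := by
    have := (hd 0 m0).2
    rw [hf.dzbar_zero, hG.deriv.apply_zero] at this
    simpa using this.symm
  have eOn : EqOn (fun z => H z + (starRingEnd ℂ) (G z)) f (ball 0 1) := fun z hz => (e z hz).symm
  refine ⟨ha0, hb0, ha1, norm_coeff_le_of_convex hH hG ha0 hb0 ha1 hb1 (fun z hz => ?_)
    (hf.univalent.congr eOn.symm) (by rw [eOn.image_eq]; exact hf.convex_image)⟩
  have := hf.sensePreserving z hz
  rwa [(hd z hz).1, (hd z hz).2, RCLike.norm_conj] at this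

/-! ### The coefficient criterion for full starlikeness. -/

theorem norm_natCast_add_one (n : ℕ) : ‖((n : ℂ) + 1)‖ = n + 1 := by
  rw [← Nat.cast_one, ← Nat.cast_add, Complex.norm_natCast, Nat.cast_add, Nat.cast_one]

namespace HasCoeffs

variable {F : ℂ → ℂ} {c : ℕ → ℂ}

theorem norm_le_tsum (h : HasCoeffs F c) {r : ℝ} (hr1 : r < 1) {z : ℂ} (hz : ‖z‖ ≤ r) :
    ‖F z‖ ≤ ∑' n, ‖c n‖ * r ^ n := by
  have hr0 : 0 ≤ r := (norm_nonneg z).trans hz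
  have hzb : z ∈ ball (0 : ℂ) 1 := mem_ball_zero_iff.2 (hz.trans_lt hr1)
  refine (h z hzb).norm_le_of_bounded (h.summable_norm hr0 hr1).hasSum fun n => ?_
  rw [norm_mul, norm_pow]
  gcongr

theorem exists_tail (h : HasCoeffs F c) (h0 : c 0 = 0) :
    ∃ F₁ : ℂ → ℂ, HasCoeffs F₁ (fun n => c (n + 1)) ∧ ∀ z ∈ ball (0 : ℂ) 1, F z = z * F₁ z := by
  have hs : HasCoeffs (fun z => ∑' n, c (n + 1) * z ^ n) (fun n => c (n + 1)) := by
    refine of_summable fun r hr0 hr1 => ?_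
    have hd := h.deriv.summable_norm hr0 hr1
    refine hd.of_nonneg_of_le (fun n => by positivity) fun n => ?_
    gcongr
    rw [norm_mul]
    refine le_mul_of_one_le_left (norm_nonneg _) ?_
    rw [norm_natCast_add_one]
    linarith [n.cast_nonneg (α := ℝ)]
  refine ⟨_, hs, fun z hz => ?_⟩
  have h1 := (hasSum_nat_add_iff' 1).2 (h z hz)
  rw [Finset.sum_range_one, h0, zero_mul, sub_zero] at h1
  refine h1.unique ((congrArg (fun u : ℕ → ℂ => HasSum u _) (funext fun n => ?_)).mpr
    ((hs z hz).mul_left z))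
  ring

end HasCoeffs

/-- The coefficient condition for starlikeness of order `α` on the circle `|z| = r` of the
harmonic map `H + conj G`. -/
structure StarlikeSeries (α r : ℝ) (H G : ℂ → ℂ) (A B : ℕ → ℂ) : Prop where
  hH : HasCoeffs H A
  hG : HasCoeffs G B
  A_zero : A 0 = 0
  A_one : A 1 = 1
  B_zero : B 0 = 0
  B_one : B 1 = 0
  nonneg_order : 0 ≤ α
  order_lt_one : α < 1
  radius_pos : 0 < r
  radius_lt_one : r < 1
  tsum_lt : ∑' n : ℕ, ((n + 1 - α) * ‖A (n + 1)‖ + (n + 1 + α) * ‖B (n + 1)‖) * r ^ n < 2 * (1 - α)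

namespace StarlikeSeries

variable {α r : ℝ} {H G : ℂ → ℂ} {A B : ℕ → ℂ}

theorem summable (h : StarlikeSeries α r H G A B) :
    Summable fun n : ℕ => ((n + 1 - α) * ‖A (n + 1)‖ + (n + 1 + α) * ‖B (n + 1)‖) * r ^ n := by
  have hr0 := h.radius_pos
  have h0 := h.nonneg_order
  have h1 := h.order_lt_one
  have s1 := (h.hH.deriv.summable_norm h.radius_pos.le h.radius_lt_one)
  have s2 := (h.hG.deriv.summable_norm h.radius_pos.le h.radius_lt_one).mul_left 2
  refine (s1.add s2).of_nonneg_of_le (fun n => ?_) fun n => ?_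
  · have : (0 : ℝ) ≤ n := n.cast_nonneg
    have : (0 : ℝ) ≤ n + 1 - α := by linarith
    positivity
  · have : (0 : ℝ) ≤ n := n.cast_nonneg
    rw [norm_mul, norm_mul, norm_natCast_add_one, add_mul, ← mul_assoc, ← mul_assoc]
    have e1 : (n + 1 - α) * ‖A (n + 1)‖ ≤ (n + 1) * ‖A (n + 1)‖ := by gcongr; linarith
    have e2 : (n + 1 + α) * ‖B (n + 1)‖ ≤ 2 * (n + 1) * ‖B (n + 1)‖ := by gcongr; linarith
    have e3 : 0 ≤ r ^ n := by positivity
    nlinarith [mul_le_mul_of_nonneg_right e1 e3, mul_le_mul_of_nonneg_right e2 e3]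

/-- As A 1 = 1 and B 1 = 0, the term n = 0 equals 1 - α; removing it halves the available bound 2(1
- α). -/
theorem tsum_lt_of_le (h : StarlikeSeries α r H G A B) {u : ℕ → ℝ} (hu : Summable u)
    (hle : ∀ n : ℕ, u n ≤ ((n + 1 - α) * ‖A (n + 1)‖ + (n + 1 + α) * ‖B (n + 1)‖) * r ^ n -
      if n = 0 then (1 - α) else 0) : ∑' n, u n < 1 - α := by
  have hs : HasSum (fun n : ℕ => if n = 0 then (1 - α) else 0) (1 - α) := by
    convert hasSum_single (f := fun n : ℕ => if n = 0 then (1 - α) else 0) 0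
      (fun n hn => by simp [hn]) using 1
    simp
  have h1 := hu.tsum_le_tsum hle (h.summable.sub hs.summable)
  rw [h.summable.tsum_sub hs.summable, hs.tsum_eq] at h1
  have := h.tsum_lt
  linarith

/-- Bounds for the derivatives on the closed disk. -/
theorem exists_deriv_bound (h : StarlikeSeries α r H G A B) :
    ∃ C₁ C₂ : ℝ, C₁ + C₂ < 1 ∧ ∀ z : ℂ, ‖z‖ ≤ r → ‖deriv H z - 1‖ ≤ C₁ ∧ ‖deriv G z‖ ≤ C₂ := by
  have hα := h.order_lt_one
  have hα0 := h.nonneg_order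
  have hr0 := h.radius_pos
  have h1 := h.hH.deriv.sub HasCoeffs.one
  have h2 := h.hG.deriv
  have s1 := h1.summable_norm h.radius_pos.le h.radius_lt_one
  have s2 := h2.summable_norm h.radius_pos.le h.radius_lt_one
  refine ⟨_, _, ?_, fun z hz => ⟨h1.norm_le_tsum h.radius_lt_one hz,
    h2.norm_le_tsum h.radius_lt_one hz⟩⟩
  rw [← s1.tsum_add s2]
  have h3 := h.tsum_lt_of_le ((s1.add s2).mul_left (1 - α)) fun n => ?_
  · rw [tsum_mul_left] at h3
    nlinarith
  · rcases eq_or_ne n 0 with rfl | hn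
    · simp [h.A_one, h.B_one]
    · rw [if_neg hn, if_neg hn, sub_zero, sub_zero, norm_mul, norm_mul, norm_natCast_add_one, ← add_mul, ← mul_assoc]
      have : (0 : ℝ) ≤ n := n.cast_nonneg
      have e1 : (1 - α) * ((n + 1) * ‖A (n + 1)‖) ≤ (n + 1 - α) * ‖A (n + 1)‖ := by
        rw [← mul_assoc]; gcongr; nlinarith
      have e2 : (1 - α) * ((n + 1) * ‖B (n + 1)‖) ≤ (n + 1 + α) * ‖B (n + 1)‖ := by
        rw [← mul_assoc]; gcongr; nlinarith
      gcongr
      linarith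

theorem hasDerivAt_left (h : StarlikeSeries α r H G A B) {z : ℂ} (hz : ‖z‖ < 1) :
    HasDerivAt H (deriv H z) z :=
  (h.hH.differentiableOn.differentiableAt (isOpen_ball.mem_nhds (mem_ball_zero_iff.2 hz))).hasDerivAt

theorem hasDerivAt_right (h : StarlikeSeries α r H G A B) {z : ℂ} (hz : ‖z‖ < 1) :
    HasDerivAt G (deriv G z) z :=
  (h.hG.differentiableOn.differentiableAt (isOpen_ball.mem_nhds (mem_ball_zero_iff.2 hz))).hasDerivAt

/-- On the closed disk the map differs from the identity by a contraction. -/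
theorem exists_contraction (h : StarlikeSeries α r H G A B) :
    ∃ q : ℝ, q < 1 ∧ ∀ z w : ℂ, ‖z‖ ≤ r → ‖w‖ ≤ r →
      ‖(H z + (starRingEnd ℂ) (G z)) - (H w + (starRingEnd ℂ) (G w)) - (z - w)‖ ≤ q * ‖z - w‖ := by
  obtain ⟨C₁, C₂, hC, hb⟩ := h.exists_deriv_bound
  refine ⟨C₁ + C₂, hC, fun z w hz hw => ?_⟩
  have hr1 := h.radius_lt_one
  have hmem : ∀ z : ℂ, z ∈ closedBall (0 : ℂ) r → ‖z‖ ≤ r := fun z hz => mem_closedBall_zero_iff.1 hz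
  have hd : ∀ x ∈ closedBall (0 : ℂ) r, HasDerivAt (fun z => H z - z) (deriv H x - 1) x := fun x hx =>
    (h.hasDerivAt_left ((hmem x hx).trans_lt hr1)).sub (hasDerivAt_id x)
  have b1 := (convex_closedBall (0 : ℂ) r).norm_image_sub_le_of_norm_hasDerivWithin_le
    (fun x hx => (hd x hx).hasDerivWithinAt) (fun x hx => (hb x (hmem x hx)).1)
    (mem_closedBall_zero_iff.2 hw) (mem_closedBall_zero_iff.2 hz)
  have b2 := (convex_closedBall (0 : ℂ) r).norm_image_sub_le_of_norm_hasDerivWithin_le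
    (fun x hx => (h.hasDerivAt_right ((hmem x hx).trans_lt hr1)).hasDerivWithinAt)
    (fun x hx => (hb x (hmem x hx)).2)
    (mem_closedBall_zero_iff.2 hw) (mem_closedBall_zero_iff.2 hz)
  have e : (H z + (starRingEnd ℂ) (G z)) - (H w + (starRingEnd ℂ) (G w)) - (z - w) =
      (H z - z - (H w - w)) + (starRingEnd ℂ) (G z - G w) := by
    rw [map_sub]; ring
  rw [e, add_mul]
  refine (norm_add_le _ _).trans (add_le_add b1 ?_)
  rwa [RCLike.norm_conj]

/-- A map differing from the identity by a strict contraction cannot identify two points. -/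
theorem injOn (h : StarlikeSeries α r H G A B) :
    InjOn (fun z => H z + (starRingEnd ℂ) (G z)) (closedBall 0 r) := by
  obtain ⟨q, hq, hc⟩ := h.exists_contraction
  intro z hz w hw hzw
  have := hc z w (mem_closedBall_zero_iff.1 hz) (mem_closedBall_zero_iff.1 hw)
  simp only at hzw
  rw [hzw, sub_self, zero_sub, norm_neg] at this
  by_contra hne
  have : 0 < ‖z - w‖ := norm_pos_iff.2 (sub_ne_zero.2 hne)
  nlinarith

theorem map_zero (h : StarlikeSeries α r H G A B) : H 0 + (starRingEnd ℂ) (G 0) = 0 := by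
  rw [h.hH.apply_zero, h.hG.apply_zero, h.A_zero, h.B_zero, _root_.map_zero, add_zero]

theorem norm_sub_lt (h : StarlikeSeries α r H G A B) {z : ℂ} (hz : ‖z‖ ≤ r) (hz0 : z ≠ 0) :
    ‖H z + (starRingEnd ℂ) (G z) - z‖ < ‖z‖ := by
  obtain ⟨q, hq, hc⟩ := h.exists_contraction
  have := hc z 0 hz (by rw [norm_zero]; exact h.radius_pos.le)
  rw [h.map_zero, sub_zero, sub_zero] at this
  have : 0 < ‖z‖ := norm_pos_iff.2 hz0
  nlinarith

theorem norm_deriv_lt (h : StarlikeSeries α r H G A B) {z : ℂ} (hz : ‖z‖ ≤ r) :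
    ‖deriv G z‖ < ‖deriv H z‖ := by
  obtain ⟨C₁, C₂, hC, hb⟩ := h.exists_deriv_bound
  obtain ⟨b1, b2⟩ := hb z hz
  have := norm_sub_norm_le (1 : ℂ) (1 - deriv H z)
  rw [sub_sub_cancel, norm_one, norm_sub_rev] at this
  linarith

/-- The pointwise form of starlikeness of order `α`. -/
theorem lt_re_div (h : StarlikeSeries α r H G A B) {z : ℂ} (hz : ‖z‖ ≤ r) (hz0 : z ≠ 0) :
    α < ((z * deriv H z - (starRingEnd ℂ) (z * deriv G z)) /
      (H z + (starRingEnd ℂ) (G z))).re := by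
  have hα := h.order_lt_one
  have hα0 := h.nonneg_order
  have hr0 := h.radius_pos
  have hr1 := h.radius_lt_one
  have hzb : z ∈ ball (0 : ℂ) 1 := mem_ball_zero_iff.2 (hz.trans_lt hr1)
  obtain ⟨H₁, hH₁, eH⟩ := h.hH.exists_tail h.A_zero
  obtain ⟨G₁, hG₁, eG⟩ := h.hG.exists_tail h.B_zero
  set X := z * deriv H z - (starRingEnd ℂ) (z * deriv G z) with hX
  set F := H z + (starRingEnd ℂ) (G z) with hF
  have c1 := h.hH.deriv.sub hH₁
  have c2 := h.hG.deriv.add hG₁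
  have c3 := (h.hH.deriv.add (hH₁.const_mul (1 - 2 * α))).sub (HasCoeffs.one.const_mul (2 - 2 * α))
  have c4 := h.hG.deriv.sub (hG₁.const_mul (1 - 2 * α))
  have s1 := c1.summable_norm hr0.le hr1
  have s2 := c2.summable_norm hr0.le hr1
  have s3 := c3.summable_norm hr0.le hr1
  have s4 := c4.summable_norm hr0.le hr1
  have b1 := c1.norm_le_tsum hr1 hz
  have b2 := c2.norm_le_tsum hr1 hz
  have b3 := c3.norm_le_tsum hr1 hz
  have b4 := c4.norm_le_tsum hr1 hz
  -- The weights pair up to the hypothesis: n + (n + 2 - 2α) = 2(n + 1 - α) on A and (n + 2) + (n +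
  -- 2α) = 2(n + 1 + α) on B.
  have key := h.tsum_lt_of_le ((((s1.add s2).add s3).add s4).mul_left (1 / 2)) fun n => by
    have hn' : (0 : ℝ) ≤ n := n.cast_nonneg
    have e1 : ‖((n : ℂ) + 1) * A (n + 1) - A (n + 1)‖ = n * ‖A (n + 1)‖ := by
      rw [add_mul, one_mul, add_sub_cancel_right, norm_mul, Complex.norm_natCast]
    have e2 : ‖((n : ℂ) + 1) * B (n + 1) + B (n + 1)‖ = (n + 2) * ‖B (n + 1)‖ := by
      have : ((n : ℂ) + 1) * B (n + 1) + B (n + 1) = ((n + 2 : ℝ) : ℂ) * B (n + 1) := by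
        push_cast; ring
      rw [this, norm_mul, Complex.norm_real, Real.norm_of_nonneg (by linarith)]
    have e4 : ‖((n : ℂ) + 1) * B (n + 1) - (1 - 2 * α) * B (n + 1)‖ = (n + 2 * α) * ‖B (n + 1)‖ := by
      have : ((n : ℂ) + 1) * B (n + 1) - (1 - 2 * α) * B (n + 1) =
          ((n + 2 * α : ℝ) : ℂ) * B (n + 1) := by
        push_cast; ring
      rw [this, norm_mul, Complex.norm_real, Real.norm_of_nonneg (by linarith)]
    have e3 : ‖((n : ℂ) + 1) * A (n + 1) + (1 - 2 * α) * A (n + 1) -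
        (2 - 2 * α) * (if n = 0 then 1 else 0)‖ * r ^ n =
        (n + 2 - 2 * α) * ‖A (n + 1)‖ * r ^ n - if n = 0 then (2 - 2 * α) else 0 := by
      rcases eq_or_ne n 0 with rfl | hn
      · simp [h.A_one]
        ring_nf
      · have : ((n : ℂ) + 1) * A (n + 1) + (1 - 2 * α) * A (n + 1) -
            (2 - 2 * α) * (if n = 0 then 1 else 0) = ((n + 2 - 2 * α : ℝ) : ℂ) * A (n + 1) := by
          rw [if_neg hn]; push_cast; ring
        rw [this, norm_mul, Complex.norm_real, Real.norm_of_nonneg (by linarith), if_neg hn, sub_zero]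
    rw [e1, e2, e3, e4]
    split_ifs
    · linarith
    · linarith
  rw [tsum_mul_left, ((s1.add s2).add s3).tsum_add s4, (s1.add s2).tsum_add s3, s1.tsum_add s2] at key
  have hz' : 0 < ‖z‖ := norm_pos_iff.2 hz0
  have n1 : ‖X - F‖ ≤ ‖z‖ * (‖deriv H z - H₁ z‖ + ‖deriv G z + G₁ z‖) := by
    have : X - F = z * (deriv H z - H₁ z) - (starRingEnd ℂ) (z * (deriv G z + G₁ z)) := by
      rw [hX, hF, eH z hzb, eG z hzb, mul_add z, map_add]; ring
    rw [this]
    refine (norm_sub_le _ _).trans_eq ?_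
    rw [RCLike.norm_conj, norm_mul, norm_mul, ← mul_add]
  have n2 : ‖z‖ * (2 - 2 * α) - ‖X + (1 - 2 * α) * F‖ ≤
      ‖z‖ * (‖deriv H z + (1 - 2 * α) * H₁ z - (2 - 2 * α) * 1‖ +
        ‖deriv G z - (1 - 2 * α) * G₁ z‖) := by
    have e : z * (2 - 2 * α) - (X + (1 - 2 * α) * F) =
        -(z * (deriv H z + (1 - 2 * α) * H₁ z - (2 - 2 * α) * 1)) +
          (starRingEnd ℂ) (z * (deriv G z - (1 - 2 * α) * G₁ z)) := by
      rw [hX, hF, eH z hzb, eG z hzb]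
      simp only [map_mul, map_sub, map_one, map_ofNat, conj_ofReal]
      ring
    have e' : ‖z * (2 - 2 * α)‖ = ‖z‖ * (2 - 2 * α) := by
      have : (2 - 2 * α : ℂ) = ((2 - 2 * α : ℝ) : ℂ) := by push_cast; ring
      rw [norm_mul, this, Complex.norm_real, Real.norm_of_nonneg (by linarith)]
    rw [← e']
    refine (norm_sub_norm_le _ _).trans ?_
    rw [e]
    refine (norm_add_le _ _).trans_eq ?_
    rw [RCLike.norm_conj, norm_neg, norm_mul, norm_mul, ← mul_add]
  -- It says that X/F is closer to 1 than to 2α - 1; the perpendicular bisector of these two points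
  -- is the line Re = α.
  have hlt : ‖X - F‖ < ‖X + (1 - 2 * α) * F‖ := by nlinarith
  have hF0 : F ≠ 0 := fun h0 => by
    rw [h0] at hlt
    simp at hlt
  set Y := X / F with hY
  have hXY : X = Y * F := by rw [hY]; field_simp
  have h2 : ‖Y - 1‖ < ‖Y + (1 - 2 * α)‖ := by
    have a1 : X - F = (Y - 1) * F := by rw [hXY]; ring
    have a2 : X + (1 - 2 * α) * F = (Y + (1 - 2 * α)) * F := by rw [hXY]; ring
    rw [a1, a2, norm_mul, norm_mul] at hlt
    exact lt_of_mul_lt_mul_right hlt (norm_nonneg _)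
  have h3 := pow_lt_pow_left₀ h2 (norm_nonneg _) two_ne_zero
  rw [← normSq_eq_norm_sq, ← normSq_eq_norm_sq, normSq_apply, normSq_apply] at h3
  simp at h3
  nlinarith

end StarlikeSeries

theorem exists_smul_mem_frontier {Ω : Set ℂ} (hΩ : IsOpen Ω) {w : ℂ} {p q : ℝ}
    (hp : p • w ∈ Ω) (hq : q • w ∉ Ω) : ∃ s ∈ uIcc p q, s • w ∈ frontier Ω := by
  by_cases hqc : q • w ∈ closure Ω
  · exact ⟨q, right_mem_uIcc, by rw [hΩ.frontier_eq]; exact ⟨hqc, hq⟩⟩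
  by_contra! hne
  have hc : Continuous fun s : ℝ => s • w := by fun_prop
  obtain ⟨s, -, h1, h2⟩ := (isPreconnected_uIcc (a := p) (b := q))
    ((fun s : ℝ => s • w) ⁻¹' Ω) ((fun s : ℝ => s • w) ⁻¹' (closure Ω)ᶜ) (hΩ.preimage hc)
    (isClosed_closure.isOpen_compl.preimage hc)
    (fun s hs => by
      by_cases h : s • w ∈ Ω
      · exact Or.inl h
      · refine Or.inr fun h' => hne s hs ?_
        rw [hΩ.frontier_eq]
        exact ⟨h', h⟩)
    ⟨p, left_mem_uIcc, hp⟩ ⟨q, right_mem_uIcc, hqc⟩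
  exact h2 (subset_closure h1)

/-- A bounded open set containing the origin whose frontier meets each ray from the origin at most
once is star convex. -/
theorem starConvex_of_frontier {Ω : Set ℂ} (hΩ : IsOpen Ω) (hb : Bornology.IsBounded Ω)
    (h0 : (0 : ℂ) ∈ Ω)
    (hf : ∀ w : ℂ, ∀ s t : ℝ, 0 < s → s < t → s • w ∈ frontier Ω → t • w ∈ frontier Ω → False) :
    StarConvex ℝ 0 Ω := by
  rw [starConvex_zero_iff]
  intro w hw t ht0 ht1
  by_contra htw
  have hw0 : w ≠ 0 := fun h => htw (by rw [h, smul_zero]; exact h0)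
  have ht0' : t ≠ 0 := fun h => htw (by rw [h, zero_smul]; exact h0)
  obtain ⟨s, hs, hsf⟩ := exists_smul_mem_frontier hΩ (w := w) (p := 0) (q := t)
    (by rwa [zero_smul]) htw
  rw [uIcc_of_le ht0] at hs
  obtain ⟨M, hM⟩ := hb.exists_norm_le
  set u := max 1 ((M + 1) / ‖w‖) with hu
  have hwn : 0 < ‖w‖ := norm_pos_iff.2 hw0
  have huw : u • w ∉ Ω := fun h => by
    have h1 := hM _ h
    rw [norm_smul, Real.norm_of_nonneg (zero_le_one.trans (le_max_left _ _))] at h1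
    have h2 : (M + 1) / ‖w‖ * ‖w‖ ≤ u * ‖w‖ := by gcongr; exact le_max_right _ _
    rw [div_mul_cancel₀ _ hwn.ne'] at h2
    linarith
  -- If t w left Ω, the ray through w would meet the frontier once at parameter at most t and again
  -- beyond w, since Ω is bounded.
  obtain ⟨v, hv, hvf⟩ := exists_smul_mem_frontier hΩ (w := w) (p := 1) (q := u)
    (by rwa [one_smul]) huw
  rw [uIcc_of_le (le_max_left _ _)] at hv
  have hnot : ∀ x ∈ frontier Ω, x ∉ Ω := fun x hx => by
    rw [hΩ.frontier_eq] at hx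
    exact hx.2
  have hs0 : s ≠ 0 := fun h => hnot _ hsf (by rw [h, zero_smul]; exact h0)
  have hv1 : v ≠ 1 := fun h => hnot _ hvf (by rwa [h, one_smul])
  exact hf w s v (lt_of_le_of_ne hs.1 hs0.symm)
    ((hs.2.trans ht1).trans_lt (lt_of_le_of_ne hv.1 hv1.symm)) hsf hvf

namespace StarlikeSeries

variable {α r : ℝ} {H G : ℂ → ℂ} {A B : ℕ → ℂ}

theorem norm_circle (hr : 0 < r) (θ : ℝ) : ‖(r : ℂ) * exp (θ * I)‖ = r := by
  rw [norm_mul, norm_exp_ofReal_mul_I, Complex.norm_real, Real.norm_of_nonneg hr.le, mul_one]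

theorem apply_ne_zero (h : StarlikeSeries α r H G A B) {z : ℂ} (hz : ‖z‖ ≤ r) (hz0 : z ≠ 0) :
    H z + (starRingEnd ℂ) (G z) ≠ 0 := fun e => by
  have := h.norm_sub_lt hz hz0
  rw [e, zero_sub, norm_neg] at this
  exact lt_irrefl _ this

/-- A branch of the argument along the image of the circle. -/
theorem exists_arg (h : StarlikeSeries α r H G A B) :
    ∃ φ : ℝ → ℝ, Differentiable ℝ φ ∧ (∀ θ, φ (θ + 2 * Real.pi) = φ θ + 2 * Real.pi) ∧
      (∀ θ : ℝ, H (r * exp (θ * I)) + (starRingEnd ℂ) (G (r * exp (θ * I))) =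
        (‖H (r * exp (θ * I)) + (starRingEnd ℂ) (G (r * exp (θ * I)))‖ : ℂ) * exp (φ θ * I)) ∧
      ∀ θ, α < deriv φ θ := by
  have hr0 := h.radius_pos
  have hr1 := h.radius_lt_one
  set e : ℝ → ℂ := fun θ => r * exp (θ * I) with he
  set γ : ℝ → ℂ := fun θ => H (e θ) + (starRingEnd ℂ) (G (e θ)) with hγ
  have hn : ∀ θ, ‖e θ‖ = r := norm_circle hr0
  have he0 : ∀ θ, e θ ≠ 0 := fun θ => norm_ne_zero_iff.1 (by rw [hn]; exact hr0.ne')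
  have hγ0 : ∀ θ, γ θ ≠ 0 := fun θ => h.apply_ne_zero (hn θ).le (he0 θ)
  have hed : ∀ θ, HasDerivAt e (e θ * I) θ := fun θ => by
    have := ((((hasDerivAt_id θ).ofReal_comp.mul_const I).cexp).const_mul (r : ℂ))
    exact this.congr_deriv (by simp only [he, id, one_mul, ofReal_one, mul_assoc])
  have hγd : ∀ θ, HasDerivAt γ
      ((e θ * deriv H (e θ) - (starRingEnd ℂ) (e θ * deriv G (e θ))) * I) θ := fun θ => by
    have d1 : HasDerivAt (fun θ => H (e θ)) (deriv H (e θ) * (e θ * I)) θ :=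
      (h.hasDerivAt_left ((hn θ).trans_lt hr1)).comp θ (hed θ)
    have d2 : HasDerivAt (fun θ => G (e θ)) (deriv G (e θ) * (e θ * I)) θ :=
      (h.hasDerivAt_right ((hn θ).trans_lt hr1)).comp θ (hed θ)
    have d3 : HasDerivAt (fun θ => (starRingEnd ℂ) (G (e θ)))
        ((starRingEnd ℂ) (deriv G (e θ) * (e θ * I))) θ := conjCLE.hasFDerivAt.comp_hasDerivAt θ d2
    refine (d1.add d3).congr_deriv ?_
    simp only [map_mul, conj_I]
    ring
  -- The image of z lies within |z| of z, so the quotient is within 1 of 1 and its principal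
  -- logarithm is differentiable. Adding θ to its argument gives a branch that gains exactly 2π per
  -- turn.
  have hslit : ∀ θ, γ θ / e θ ∈ slitPlane := fun θ => by
    have h1 := h.norm_sub_lt (hn θ).le (he0 θ)
    have h2 : ‖γ θ / e θ - 1‖ < 1 := by
      rw [div_sub_one (he0 θ), norm_div, div_lt_one (norm_pos_iff.2 (he0 θ))]
      exact h1
    refine mem_slitPlane_of_norm_lt_one (z := γ θ / e θ - 1) h2 |> fun h3 => ?_
    rwa [add_sub_cancel] at h3
  have hφd : ∀ θ, HasDerivAt (fun θ => θ + (log (γ θ / e θ)).im)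
      ((e θ * deriv H (e θ) - (starRingEnd ℂ) (e θ * deriv G (e θ))) / γ θ).re θ := fun θ => by
    have d1 := ((hγd θ).div (hed θ) (he0 θ)).clog_real (hslit θ)
    have d2 := (hasDerivAt_id θ).add (imCLM.hasFDerivAt.comp_hasDerivAt θ d1)
    refine d2.congr_deriv ?_
    set X := e θ * deriv H (e θ) - (starRingEnd ℂ) (e θ * deriv G (e θ))
    have e1 := he0 θ
    have e2 := hγ0 θ
    have : (X * I * e θ - γ θ * (e θ * I)) / e θ ^ 2 / (γ θ / e θ) = X / γ θ * I - I := by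
      field_simp
    rw [Pi.div_apply, this, imCLM_apply, sub_im, mul_I_im, I_im]
    ring
  refine ⟨fun θ => θ + (log (γ θ / e θ)).im, fun θ => (hφd θ).differentiableAt, fun θ => ?_,
    fun θ => ?_, fun θ => ?_⟩
  · have : e (θ + 2 * Real.pi) = e θ := by
      simp only [he]
      push_cast
      rw [add_mul, exp_periodic]
    simp only [hγ, this]
    ring
  · change γ θ = (‖γ θ‖ : ℂ) * _
    have h1 := norm_mul_exp_arg_mul_I (γ θ / e θ)
    have h2 : e θ = ‖e θ‖ * exp (θ * I) := by rw [hn]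
    simp only [log_im]
    push_cast
    rw [add_mul, Complex.exp_add]
    have h3 : ‖γ θ‖ = ‖e θ‖ * ‖γ θ / e θ‖ := by
      rw [norm_div, mul_div_cancel₀ _ (norm_ne_zero_iff.2 (he0 θ))]
    rw [h3]
    calc γ θ = e θ * (γ θ / e θ) := (mul_div_cancel₀ _ (he0 θ)).symm
      _ = (‖e θ‖ * exp (θ * I)) * (‖γ θ / e θ‖ * exp (arg (γ θ / e θ) * I)) := by rw [← h2, h1]
      _ = _ := by push_cast; ring
  · rw [(hφd θ).deriv]
    exact h.lt_re_div (hn θ).le (he0 θ)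

theorem exists_angle_of_mem_sphere {z : ℂ} (hz : z ∈ sphere (0 : ℂ) r) :
    ∃ θ : ℝ, z = r * exp (θ * I) := by
  refine ⟨arg z, ?_⟩
  rw [mem_sphere_zero_iff_norm] at hz
  rw [← hz, norm_mul_exp_arg_mul_I]

/-- Two points of the image of the circle on the same ray coincide. -/
theorem eq_of_sameRay (h : StarlikeSeries α r H G A B) {z₁ z₂ : ℂ} (h1 : z₁ ∈ sphere (0 : ℂ) r)
    (h2 : z₂ ∈ sphere (0 : ℂ) r) {w : ℂ} {s t : ℝ} (hs : 0 < s) (ht : 0 < t)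
    (e1 : H z₁ + (starRingEnd ℂ) (G z₁) = s • w) (e2 : H z₂ + (starRingEnd ℂ) (G z₂) = t • w) :
    z₁ = z₂ := by
  have hr0 := h.radius_pos
  obtain ⟨φ, hφd, hφp, hφ, hφ'⟩ := h.exists_arg
  obtain ⟨a, rfl⟩ := exists_angle_of_mem_sphere h1
  obtain ⟨b, rfl⟩ := exists_angle_of_mem_sphere h2
  have hw : w ≠ 0 := fun hw => by
    rw [hw, smul_zero] at e1
    exact h.apply_ne_zero (norm_circle hr0 a).le
      (norm_ne_zero_iff.1 (by rw [norm_circle hr0]; exact hr0.ne')) e1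
  have f1 := hφ a
  have f2 := hφ b
  rw [e1, norm_smul, Real.norm_of_nonneg hs.le, real_smul] at f1
  rw [e2, norm_smul, Real.norm_of_nonneg ht.le, real_smul] at f2
  have hs' : (s : ℂ) ≠ 0 := ofReal_ne_zero.2 hs.ne'
  have ht' : (t : ℂ) ≠ 0 := ofReal_ne_zero.2 ht.ne'
  have hn' : (‖w‖ : ℂ) ≠ 0 := ofReal_ne_zero.2 (norm_ne_zero_iff.2 hw)
  push_cast at f1 f2
  rw [mul_assoc] at f1 f2
  have g1 := mul_left_cancel₀ hs' f1
  have g2 := mul_left_cancel₀ ht' f2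
  have g3 := mul_left_cancel₀ hn' (g1.symm.trans g2)
  obtain ⟨k, hk⟩ := Complex.exp_eq_exp_iff_exists_int.1 g3
  have hk' : φ a = φ b + k * (2 * Real.pi) := by
    have : ((φ a : ℝ) : ℂ) * I = ((φ b + k * (2 * Real.pi) : ℝ) : ℂ) * I := by
      rw [hk]; push_cast; ring
    exact_mod_cast mul_right_cancel₀ I_ne_zero this
  -- Absorbs the ambiguity 2πk of the argument into the parameter; strict monotonicity of φ then
  -- gives a = b + 2πk.
  have hper : Function.Periodic (fun θ => φ θ - θ) (2 * Real.pi) := fun θ => by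
    simp only [hφp]; ring
  have hk2 : φ (b + k * (2 * Real.pi)) = φ b + k * (2 * Real.pi) := by
    have := hper.int_mul k b
    linarith
  have hmono : StrictMono φ := strictMono_of_deriv_pos fun θ => h.nonneg_order.trans_lt (hφ' θ)
  have hab := hmono.injective (hk'.trans hk2.symm)
  rw [hab]
  push_cast
  rw [add_mul, mul_assoc (k : ℂ), Complex.exp_add, Complex.exp_int_mul_two_pi_mul_I, mul_one]

theorem continuousOn (h : StarlikeSeries α r H G A B) :
    ContinuousOn (fun z => H z + (starRingEnd ℂ) (G z)) (closedBall 0 r) := fun z hz => by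
  have hz' : ‖z‖ < 1 := (mem_closedBall_zero_iff.1 hz).trans_lt h.radius_lt_one
  exact ((h.hasDerivAt_left hz').continuousAt.add (continuous_conj.continuousAt.comp
    (h.hasDerivAt_right hz').continuousAt)).continuousWithinAt

/-- The domain is the image of the open disk. It is open because the map is a local homeomorphism
there, injectivity on the closed disk identifies its frontier, and one crossing per ray makes it
starlike. -/
theorem boundsStarlikeDomain (h : StarlikeSeries α r H G A B) :
    HarmonicMapping.BoundsStarlikeDomain
      ((fun z => H z + (starRingEnd ℂ) (G z)) '' sphere 0 r) := by
  set F : ℂ → ℂ := fun z => H z + (starRingEnd ℂ) (G z) with hF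
  have hr0 := h.radius_pos
  have hsub : ball (0 : ℂ) r ⊆ closedBall 0 r := ball_subset_closedBall
  have hm : ∀ z ∈ ball (0 : ℂ) r, map F (𝓝 z) = 𝓝 (F z) := fun z hz => by
    have hz1 : z ∈ ball (0 : ℂ) 1 := ball_subset_ball h.radius_lt_one.le hz
    exact map_nhds_eq_of_norm_deriv_lt
      (h.hH.differentiableOn.analyticAt (isOpen_ball.mem_nhds hz1))
      (h.hG.differentiableOn.analyticAt (isOpen_ball.mem_nhds hz1))
      (h.norm_deriv_lt (mem_ball_zero_iff.1 hz).le)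
  have ho : IsOpen (F '' ball 0 r) := isOpen_image_of_map_nhds_eq isOpen_ball hm
  have hcpt : IsCompact (F '' closedBall 0 r) :=
    (isCompact_closedBall _ _).image_of_continuousOn h.continuousOn
  have hbdd : Bornology.IsBounded (F '' ball 0 r) := hcpt.isBounded.subset (image_mono hsub)
  have h0 : (0 : ℂ) ∈ F '' ball 0 r := ⟨0, mem_ball_self hr0, h.map_zero⟩
  have hcl : closure (F '' ball 0 r) = F '' closedBall 0 r := by
    refine (closure_minimal (image_mono hsub) hcpt.isClosed).antisymm ?_
    have hc := h.continuousOn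
    rw [← closure_ball (0 : ℂ) hr0.ne'] at hc ⊢
    exact hc.image_closure
  have hfr : frontier (F '' ball 0 r) = F '' sphere 0 r := by
    rw [ho.frontier_eq, hcl, ← h.injOn.image_sdiff_subset hsub, closedBall_sdiff_ball]
  refine ⟨F '' ball 0 r, ho, ⟨⟨0, h0⟩, (convex_ball (0 : ℂ) r).isPreconnected.image _
    (h.continuousOn.mono hsub)⟩, hbdd, ?_, hfr⟩
  refine starConvex_of_frontier ho hbdd h0 fun w s t hs hst h1 h2 => ?_
  rw [hfr] at h1 h2
  obtain ⟨z₁, m1, e1⟩ := h1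
  obtain ⟨z₂, m2, e2⟩ := h2
  have hz := h.eq_of_sameRay m1 m2 hs (hs.trans hst) e1 e2
  rw [hz, e2] at e1
  have hw : w ≠ 0 := fun hw => by
    rw [hw, smul_zero] at e2
    rw [mem_sphere_zero_iff_norm] at m2
    exact h.apply_ne_zero m2.le (norm_ne_zero_iff.1 (by rw [m2]; exact hr0.ne')) e2
  exact hst.ne' (smul_left_injective ℝ hw e1)

end StarlikeSeries

/-- The coefficient criterion for full starlikeness of order `α`. -/
theorem isFullyStarlike_of_starlikeSeries {α R : ℝ} {H G : ℂ → ℂ} {A B : ℕ → ℂ} (hR0 : 0 < R)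
    (hR1 : R ≤ 1) (h : ∀ r, 0 < r → r < R → StarlikeSeries α r H G A B) :
    InjOn (fun z => H z + (starRingEnd ℂ) (G z)) (ball 0 R) ∧
      HarmonicMapping.IsFullyStarlike α R (fun z => H z + (starRingEnd ℂ) (G z)) := by
  have hH := (h (R / 2) (by linarith) (by linarith)).hH
  have hG := (h (R / 2) (by linarith) (by linarith)).hG
  refine ⟨fun z hz w hw hzw => ?_, ⟨fun z hz => ?_, ?_, fun r hr hrR => ?_, fun r hr hrR => ?_,
    fun r hr hrR => ⟨fun θ => ?_, ?_⟩⟩⟩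
  · obtain ⟨ρ, h1, h2⟩ := exists_between (max_lt hR0 (max_lt (mem_ball_zero_iff.1 hz)
      (mem_ball_zero_iff.1 hw)))
    obtain ⟨h1, h3⟩ := max_lt_iff.1 h1
    obtain ⟨h3, h4⟩ := max_lt_iff.1 h3
    exact (h ρ h1 h2).injOn (mem_closedBall_zero_iff.2 h3.le) (mem_closedBall_zero_iff.2 h4.le) hzw
  · have hz1 := isOpen_ball.mem_nhds (ball_subset_ball hR1 hz)
    exact (hH.differentiableOn.analyticAt hz1).harmonicAt.add
      (hG.differentiableOn.analyticAt hz1).harmonicAt_conj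
  · exact (h (R / 2) (by linarith) (by linarith)).map_zero
  · exact (h r hr hrR).injOn.mono sphere_subset_closedBall
  · exact (h r hr hrR).boundsStarlikeDomain
  · exact (h r hr hrR).apply_ne_zero (StarlikeSeries.norm_circle hr θ).le
      (norm_ne_zero_iff.1 (by rw [StarlikeSeries.norm_circle hr]; exact hr.ne'))
  · obtain ⟨φ, h1, -, h2, h3⟩ := (h r hr hrR).exists_arg
    exact ⟨φ, h1, h2, h3⟩

/-! ### The majorant and the radius equation. -/

theorem natCast_choose_three (n : ℕ) :
    (((n + 3).choose 3 : ℕ) : ℝ) = (n + 3) * (n + 2) * (n + 1) / 6 := by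
  induction n with
  | zero => norm_num
  | succ n ih =>
    rw [show n + 1 + 3 = (n + 3) + 1 by ring, Nat.choose_succ_succ' (n + 3) 2, Nat.cast_add, ih,
      Nat.cast_choose_two]
    push_cast
    ring

/-- In the binomial basis the cubic is 3·C(n+3,3) - 3·C(n+2,2) + (1-α)·C(n+1,1), and each binomial
series sums to a power of 1/(1-r). -/
theorem hasSum_starlike_majorant {α r : ℝ} (hr0 : 0 ≤ r) (hr1 : r < 1) :
    HasSum (fun n : ℕ => (((n : ℝ) + 1) * ((n + 1) ^ 2 + 1) / 2 - α * (n + 1)) * r ^ n)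
      ((1 + r + r ^ 2) / (1 - r) ^ 4 - α / (1 - r) ^ 2) := by
  have hn : ‖r‖ < 1 := by rwa [Real.norm_of_nonneg hr0]
  have h1 := hasSum_choose_mul_geometric_of_norm_lt_one 1 hn
  have h2 := hasSum_choose_mul_geometric_of_norm_lt_one 2 hn
  have h3 := hasSum_choose_mul_geometric_of_norm_lt_one 3 hn
  have h := ((h3.mul_left 3).sub (h2.mul_left 3)).add (h1.mul_left (1 - α))
  have hr : 1 - r ≠ 0 := by linarith
  have e1 : (1 + r + r ^ 2) / (1 - r) ^ 4 - α / (1 - r) ^ 2 = 3 * (1 / (1 - r) ^ (3 + 1)) -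
      3 * (1 / (1 - r) ^ (2 + 1)) + (1 - α) * (1 / (1 - r) ^ (1 + 1)) := by
    field_simp
    ring
  rw [e1]
  refine (congrArg (fun u : ℕ → ℝ => HasSum u _) (funext fun n => ?_)).mpr h
  rw [natCast_choose_three, Nat.cast_choose_two, Nat.choose_one_right]
  push_cast
  ring

namespace HarmonicMapping

theorem radiusPoly_lt {α x y : ℝ} (hα0 : 0 ≤ α) (hα1 : α < 1) (_hx : 0 ≤ x) (hxy : x < y)
    (hy : y ≤ 1) : radiusPoly α y < radiusPoly α x := by
  have h1 : (1 - y) ^ 4 ≤ (1 - x) ^ 4 := pow_le_pow_left₀ (by linarith) (by linarith) 4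
  have h2 : (1 - y) ^ 2 ≤ (1 - x) ^ 2 := pow_le_pow_left₀ (by linarith) (by linarith) 2
  have h3 := mul_le_mul_of_nonneg_left h1 (by linarith : 0 ≤ 2 * (1 - α))
  have h4 := mul_le_mul_of_nonneg_left h2 hα0
  simp only [radiusPoly]
  nlinarith

theorem continuous_radiusPoly (α : ℝ) : Continuous (radiusPoly α) := by
  unfold radiusPoly
  fun_prop

/-- Uniqueness of the root of the radius equation in an interval with a sign change. -/
theorem exists_radius {α : ℝ} (hα0 : 0 ≤ α) (hα1 : α < 1) {p q : ℝ} (hp : 0 ≤ p) (hpq : p ≤ q)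
    (hq : q ≤ 1) (h1 : 0 < radiusPoly α p) (h2 : radiusPoly α q < 0) :
    ∃ r₀ ∈ Ioo p q, (∀ r ∈ Ioo (0 : ℝ) 1, radiusPoly α r = 0 ↔ r = r₀) ∧
      ∀ r, 0 ≤ r → r < r₀ → 0 < radiusPoly α r := by
  obtain ⟨r₀, hr, hr0⟩ := intermediate_value_Ioo' hpq (continuous_radiusPoly α).continuousOn ⟨h2, h1⟩
  refine ⟨r₀, hr, fun r hr' => ⟨fun h => ?_, fun h => h ▸ hr0⟩, fun r h0 hlt => ?_⟩
  · rcases lt_trichotomy r r₀ with hlt | heq | hlt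
    · have := radiusPoly_lt hα0 hα1 hr'.1.le hlt (hr.2.le.trans hq)
      linarith
    · exact heq
    · have := radiusPoly_lt hα0 hα1 (hp.trans hr.1.le) hlt hr'.2.le
      linarith
  · rw [← hr0]
    exact radiusPoly_lt hα0 hα1 h0 hlt (hr.2.le.trans hq)

theorem hasCoeffs_of_norm_le {c : ℕ → ℂ}
    (hc : ∀ n : ℕ, ‖c (n + 1)‖ ≤ (n + 2) / 2 * ((n + 2) / 2)) :
    HasCoeffs (fun z => ∑' n, c n * z ^ n) c := by
  refine HasCoeffs.of_summable fun ρ h0 h1 => (summable_nat_add_iff 1).1 ?_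
  -- The cubic majorant is reused for convergence; α = -1 adds n + 1 to it for slack.
  have hs := ((hasSum_starlike_majorant (α := -1) h0 h1).summable).mul_right ρ
  refine hs.of_nonneg_of_le (fun n => mul_nonneg (norm_nonneg _) (pow_nonneg h0 _)) fun n => ?_
  rw [pow_succ, ← mul_assoc]
  refine mul_le_mul_of_nonneg_right (mul_le_mul_of_nonneg_right ?_ (pow_nonneg h0 _)) h0
  refine (hc n).trans ?_
  have hn : (0 : ℝ) ≤ n := n.cast_nonneg
  nlinarith [mul_nonneg hn hn, mul_nonneg hn (mul_nonneg hn hn)]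

/-- The weighted bounds (n+1-α)((n+2)/2)² + (n+1+α)(n/2)² add up to the majorant's coefficient, and
its sum falls short of 2(1-α) by `radiusPoly α r` / (1-r)⁴. -/
theorem starlikeSeries_of_norm_le {A B : ℕ → ℂ} (hA0 : A 0 = 0) (hA1 : A 1 = 1)
    (hB0 : B 0 = 0) (hA : ∀ n : ℕ, ‖A (n + 1)‖ ≤ (n + 2) / 2 * ((n + 2) / 2))
    (hB : ∀ n : ℕ, ‖B (n + 1)‖ ≤ n / 2 * (n / 2))
    {α r : ℝ} (hα0 : 0 ≤ α) (hα1 : α < 1) (hr0 : 0 < r) (hr1 : r < 1)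
    (hp : 0 < radiusPoly α r) :
    StarlikeSeries α r (fun z => ∑' n, A n * z ^ n) (fun z => ∑' n, B n * z ^ n) A B := by
  have hle : ∀ n : ℕ, ((n + 1 - α) * ‖A (n + 1)‖ + (n + 1 + α) * ‖B (n + 1)‖) ≤
      ((n : ℝ) + 1) * ((n + 1) ^ 2 + 1) / 2 - α * (n + 1) := fun n => by
    have hn : (0 : ℝ) ≤ n := n.cast_nonneg
    have h1 := mul_le_mul_of_nonneg_left (hA n) (by linarith : 0 ≤ n + 1 - α)
    have h2 := mul_le_mul_of_nonneg_left (hB n) (by linarith : 0 ≤ n + 1 + α)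
    refine (add_le_add h1 h2).trans_eq ?_
    ring
  have hB' : ∀ n : ℕ, ‖B (n + 1)‖ ≤ (n + 2) / 2 * ((n + 2) / 2) := fun n =>
    (hB n).trans (by nlinarith [n.cast_nonneg (α := ℝ)])
  have hm := hasSum_starlike_majorant (α := α) hr0.le hr1
  have hle' : ∀ n : ℕ, ((n + 1 - α) * ‖A (n + 1)‖ + (n + 1 + α) * ‖B (n + 1)‖) * r ^ n ≤
      (((n : ℝ) + 1) * ((n + 1) ^ 2 + 1) / 2 - α * (n + 1)) * r ^ n := fun n =>
    mul_le_mul_of_nonneg_right (hle n) (pow_nonneg hr0.le n)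
  have hnn : ∀ n : ℕ, 0 ≤ ((n + 1 - α) * ‖A (n + 1)‖ + (n + 1 + α) * ‖B (n + 1)‖) * r ^ n := by
    intro n
    have hn : (0 : ℝ) ≤ n := n.cast_nonneg
    have h1 : 0 ≤ n + 1 - α := by linarith
    have h2 : 0 ≤ n + 1 + α := by linarith
    positivity
  have hs : Summable fun n : ℕ =>
      ((n + 1 - α) * ‖A (n + 1)‖ + (n + 1 + α) * ‖B (n + 1)‖) * r ^ n :=
    Summable.of_nonneg_of_le hnn hle' hm.summable
  refine ⟨hasCoeffs_of_norm_le hA, hasCoeffs_of_norm_le hB', hA0, hA1, hB0, ?_, hα0, hα1, hr0, hr1, ?_⟩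
  -- The bound at n = 0 is zero, so B 1 = 0 needs no separate hypothesis.
  · have := hB 0
    simpa using this
  · refine (hs.tsum_le_tsum hle' hm.summable).trans_lt ?_
    rw [hm.tsum_eq]
    have hr : 0 < 1 - r := by linarith
    have e : (1 + r + r ^ 2) / (1 - r) ^ 4 - α / (1 - r) ^ 2 =
        2 * (1 - α) - radiusPoly α r / (1 - r) ^ 4 := by
      rw [radiusPoly]
      field_simp
      ring
    rw [e]
    have : 0 < radiusPoly α r / (1 - r) ^ 4 := by positivity
    linarith

theorem starlikeSeries_conv {f g : ℂ → ℂ} (hf : IsConvexHarmonic f) (hg : IsConvexHarmonic g)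
    {α r : ℝ} (hα0 : 0 ≤ α) (hα1 : α < 1) (hr0 : 0 < r) (hr1 : r < 1)
    (hp : 0 < radiusPoly α r) :
    StarlikeSeries α r (fun z => ∑' n, (coeffs f).1 n * (coeffs g).1 n * z ^ n)
      (fun z => ∑' n, (coeffs f).2 n * (coeffs g).2 n * z ^ n)
      (fun n => (coeffs f).1 n * (coeffs g).1 n) (fun n => (coeffs f).2 n * (coeffs g).2 n) := by
  obtain ⟨fa0, fb0, fa1, fb⟩ := hf.coeffs_bound
  obtain ⟨ga0, gb0, ga1, gb⟩ := hg.coeffs_bound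
  refine starlikeSeries_of_norm_le (by rw [fa0, zero_mul]) (by rw [fa1, ga1, one_mul])
    (by rw [fb0, zero_mul]) (fun n => ?_) (fun n => ?_) hα0 hα1 hr0 hr1 hp
  · rw [norm_mul]
    exact mul_le_mul (fb n).1 (gb n).1 (norm_nonneg _) (by positivity)
  · rw [norm_mul]
    exact mul_le_mul (fb n).2 (gb n).2 (norm_nonneg _) (by positivity)

theorem conv_fullyStarlike {f g : ℂ → ℂ} (hf : IsConvexHarmonic f) (hg : IsConvexHarmonic g)
    {α R : ℝ} (hα0 : 0 ≤ α) (hα1 : α < 1) (hR0 : 0 < R) (hR1 : R ≤ 1)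
    (hp : ∀ r, 0 ≤ r → r < R → 0 < radiusPoly α r) :
    InjOn (conv f g) (ball 0 R) ∧ IsFullyStarlike α R (conv f g) :=
  isFullyStarlike_of_starlikeSeries hR0 hR1 fun r h0 h1 =>
    starlikeSeries_conv hf hg hα0 hα1 h0 (h1.trans_le hR1) (hp r h0.le h1)

end HarmonicMapping

theorem corollary4p3 :
    (∀ α : ℝ, 0 ≤ α → α < 1 →
      ∃ r₀ ∈ Set.Ioo (0 : ℝ) 1,
        (∀ r ∈ Set.Ioo (0 : ℝ) 1, HarmonicMapping.radiusPoly α r = 0 ↔ r = r₀) ∧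
        ∀ f g : ℂ → ℂ, HarmonicMapping.IsConvexHarmonic f → HarmonicMapping.IsConvexHarmonic g →
          Set.InjOn (HarmonicMapping.conv f g) (Metric.ball 0 r₀) ∧
          HarmonicMapping.IsFullyStarlike α r₀ (HarmonicMapping.conv f g)) ∧
    (∃ r₀ ∈ Set.Ioo (0 : ℝ) 1,
      (∀ r ∈ Set.Ioo (0 : ℝ) 1, HarmonicMapping.radiusPoly 0 r = 0 ↔ r = r₀) ∧
      |r₀ - 0.129831| < 5e-7 ∧
      ∀ f g : ℂ → ℂ, HarmonicMapping.IsConvexHarmonic f → HarmonicMapping.IsConvexHarmonic g →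
        Set.InjOn (HarmonicMapping.conv f g) (Metric.ball 0 r₀) ∧
        HarmonicMapping.IsFullyStarlike 0 r₀ (HarmonicMapping.conv f g)) := by
  refine ⟨fun α hα0 hα1 => ?_, ?_⟩
  · obtain ⟨r₀, hr, huniq, hpos⟩ := HarmonicMapping.exists_radius hα0 hα1 le_rfl zero_le_one le_rfl
      (by simp only [HarmonicMapping.radiusPoly]; linarith)
      (by simp only [HarmonicMapping.radiusPoly]; linarith)
    exact ⟨r₀, hr, huniq, fun f g hf hg =>
      HarmonicMapping.conv_fullyStarlike hf hg hα0 hα1 hr.1 hr.2.le hpos⟩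
  -- The endpoints are 0.129831 ∓ 5·10⁻⁷; the sign change between them locates the root to the
  -- required accuracy.
  · obtain ⟨r₀, hr, huniq, hpos⟩ := HarmonicMapping.exists_radius (α := 0) le_rfl zero_lt_one
      (p := 0.1298305) (q := 0.1298315) (by norm_num) (by norm_num) (by norm_num)
      (by simp only [HarmonicMapping.radiusPoly]; norm_num)
      (by simp only [HarmonicMapping.radiusPoly]; norm_num)
    have h0 : 0 < r₀ := lt_trans (by norm_num) hr.1
    have h1 : r₀ < 1 := hr.2.trans (by norm_num)
    refine ⟨r₀, ⟨h0, h1⟩, huniq, ?_, fun f g hf hg =>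
      HarmonicMapping.conv_fullyStarlike hf hg le_rfl zero_lt_one h0 h1.le hpos⟩
    rw [abs_lt]
    constructor
    · have := hr.1
      norm_num at this ⊢
      linarith
    · have := hr.2
      norm_num at this ⊢
      linarith
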